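/- Let $n\ge 1$ and let $H\colon\mathbb R^{2n}\to\mathbb R$, $(q,p)\mapsto H(q,p)$, be a $C^2$ Hamiltonian of classical type: $H(q,\cdot)$ is even for every $q$, and there is a continuous $\nu\colon\mathbb R^n\to(0,\infty)$ with $\frac{\partial^2H}{\partial p^2}(q,p)[\xi,\xi]\ge\nu(q)\|\xi\|^2$ for all $q,p,\xi\in\mathbb R^n$. Put $V(q)=H(q,0)$. Let $E\in\mathbb R$ and let $D\subset\mathbb R^n$ be an open set with $C^2$ boundary and compact closure such that $V<E$ on $D$, and $V=E$ and $\nabla V\neq0$ on $\partial D$. Let $U\colon D\times\mathbb R^n\to\mathbb R$ be the unique function that is homogeneous of degree $2$ in $p$ and satisfies $U(q,p)=1$ if and only if $H(q,p)=E$ (that is, $U(q,\cdot)$ is the square of the Minkowski functional of $\{p: H(q,p)\le E\}$). Let $G(q,v)=\max_{p\in\mathbb R^n}\big(\langle v,p\rangle-U(q,p)\big)$ be its Legendre transform in $p$, and let $\mathcal L(q,p)=\big(q,\frac{\partial U}{\partial p}(q,p)\big)$. Let $W^{1,2}([0,1],\mathbb R^n)$ be the space of absolutely continuous curves with square-integrable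 derivative, and $W^{1,2}_0([0,1],\mathbb R^n)$ the subspace of those vanishing at $0$ and $1$. For $y\in D$ let $X_y$ be the set of all $\gamma\in W^{1,2}([0,1],\mathbb R^n)$ with $\gamma(0)=y$, $\gamma([0,1))\subset D$ and $\gamma(1)\in\partial D$, and put $$\mathcal J(\gamma)=\int_0^1G(\gamma(s),\gamma'(s))\,ds,\qquad \psi(y)=\inf_{\gamma\in X_y}\mathcal J(\gamma).$$ Then, for every $y\in D$, the integral $\mathcal J(\gamma)$ converges for every $\gamma\in X_y$, and $\psi(y)$ is attained by at least one curve in $X_y$. Moreover, every $\gamma_y\in X_y$ with $\mathcal J(\gamma_y)=\psi(y)$ has the following properties. 1. For all $\xi\in W^{1,2}_0([0,1],\mathbb R^n)$ the following integrand is integrable and $$\int_0^1\Big(\frac{\partial G}{\partial q}(\gamma_y(s),\gamma_y'(s))[\xi(s)]+\frac{\partial G}{\partial v}(\gamma_y(s),\gamma_y'(s))[\xi'(s)]\Big)ds=0 .$$ 2. There are a finite $T>0$ and an increasing homeomorphism $\sigma\colon[0,T]\to[0,1]$ of class $C^1$, with $\sigma'>0$ on $[0,T)$ (so that $\sigma$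 restricts to a diffeomorphism of $[0,T)$ onto $[0,1)$), and there is a curve $p\colon[0,T]\to\mathbb R^n$ such that, with $q=\gamma_y\circ\sigma$, the pair $(q,p)$ solves Hamilton's equations $\dot q=\frac{\partial H}{\partial p}(q,p)$, $\dot p=-\frac{\partial H}{\partial q}(q,p)$ on $[0,T]$ with energy $H(q,p)\equiv E$, and $q(0)=y$, $q(T)\in\partial D$. Moreover, for all $t\in[0,T)$, $G(q(t),\dot q(t))>0$ and $$\mathcal L(q(t),p(t))=\Big(q(t),\frac{\dot q(t)}{\sqrt{G(q(t),\dot q(t))}}\Big).$$ -/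

import Mathlib

open MeasureTheory Set

noncomputable section

/-- Euclidean space `ℝⁿ`. -/
abbrev Rn (n : ℕ) : Type := EuclideanSpace ℝ (Fin n)

/-- The vector `∂f/∂q (q, p)`. -/
def partialQ {n : ℕ} (f : Rn n × Rn n → ℝ) (q p : Rn n) : Rn n :=
  gradient (fun q' => f (q', p)) q

/-- The vector `∂f/∂p (q, p)` (also written `∂f/∂v` when the second variable is a velocity). -/
def partialP {n : ℕ} (f : Rn n × Rn n → ℝ) (q p : Rn n) : Rn n :=
  gradient (fun p' => f (q, p')) p

/-- `H` is a Hamiltonian function of classical type, of class `C²`: it is even in `p`, and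
`∂²H/∂p² (q, p)[ξ, ξ] ≥ ν(q) ‖ξ‖²` for some continuous positive function `ν`. -/
structure IsClassicalHamiltonian {n : ℕ} (H : Rn n × Rn n → ℝ) : Prop where
  contDiff : ContDiff ℝ 2 H
  even : ∀ q p, H (q, -p) = H (q, p)
  posDef : ∃ ν : Rn n → ℝ, Continuous ν ∧ (∀ q, 0 < ν q) ∧
    ∀ q p ξ, ν q * ‖ξ‖ ^ 2 ≤ fderiv ℝ (fderiv ℝ (fun p' => H (q, p'))) p ξ ξ

/-- The potential energy `V(q) = H(q, 0)`. -/
def potential {n : ℕ} (H : Rn n × Rn n → ℝ) (q : Rn n) : ℝ := H (q, 0)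

/-- `D` has boundary of class `C²`: near each boundary point, `D` is the sublevel set `{f < 0}`
of a `C²` function `f` whose differential does not vanish at that point. -/
def HasC2Boundary {n : ℕ} (D : Set (Rn n)) : Prop :=
  ∀ x ∈ frontier D, ∃ W : Set (Rn n), IsOpen W ∧ x ∈ W ∧ ∃ f : Rn n → ℝ,
    ContDiffOn ℝ 2 f W ∧ f x = 0 ∧ fderiv ℝ f x ≠ 0 ∧ D ∩ W = {z ∈ W | f z < 0}

/-- `D` is a potential well for `H`, with energy `E`. -/
structure IsPotentialWell {n : ℕ} (H : Rn n × Rn n → ℝ) (E : ℝ) (D : Set (Rn n)) : Prop where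
  isOpen : IsOpen D
  boundary : HasC2Boundary D
  lt_of_mem : ∀ q ∈ D, potential H q < E
  eq_of_mem_frontier : ∀ q ∈ frontier D, potential H q = E
  gradient_ne_zero : ∀ q ∈ frontier D, gradient (potential H) q ≠ 0

/-- `(q, p) : [0, T] → ℝ²ⁿ` is a solution of Hamilton's equations for `H` with energy `E`
(one-sided derivatives at the endpoints). -/
structure IsHamiltonSolution {n : ℕ} (H : Rn n × Rn n → ℝ) (E T : ℝ) (q p : ℝ → Rn n) :
    Prop where
  deriv_q : ∀ t ∈ Icc 0 T, HasDerivWithinAt q (partialP H (q t) (p t)) (Icc 0 T) t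
  deriv_p : ∀ t ∈ Icc 0 T, HasDerivWithinAt p (-partialQ H (q t) (p t)) (Icc 0 T) t
  energy : ∀ t ∈ Icc 0 T, H (q t, p t) = E

/-- The function `U`. If `V(q) < E`, then `{p | H(q, p) ≤ E}` is a convex compact symmetric
neighbourhood of the origin with boundary `{p | H(q, p) = E}`, so the square of its Minkowski
functional is the unique function of `p` that is homogeneous of degree `2` and equal to `1`
exactly where `H(q, p) = E`. -/
def jacobiU {n : ℕ} (H : Rn n × Rn n → ℝ) (E : ℝ) (x : Rn n × Rn n) : ℝ :=
  gauge {p : Rn n | H (x.1, p) ≤ E} x.2 ^ 2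

/-- The fibrewise Legendre transform `G(q, v) = max_p (⟨v, p⟩ - U(q, p))` of `U`: the square of
the Jacobi–Finsler metric. -/
def jacobiG {n : ℕ} (H : Rn n × Rn n → ℝ) (E : ℝ) (x : Rn n × Rn n) : ℝ :=
  ⨆ p : Rn n, (inner ℝ x.2 p - jacobiU H E (x.1, p))

/-- The Legendre map `ℒ(q, p) = (q, ∂U/∂p (q, p))`. -/
def legendreMap {n : ℕ} (H : Rn n × Rn n → ℝ) (E : ℝ) (x : Rn n × Rn n) : Rn n × Rn n :=
  (x.1, partialP (jacobiU H E) x.1 x.2)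

/-- `γ ∈ W^{1,2}([0,1], ℝⁿ)`: it is absolutely continuous on `[0,1]` and its (almost everywhere
defined) derivative is square integrable. -/
def IsW12 {n : ℕ} (γ : ℝ → Rn n) : Prop :=
  AbsolutelyContinuousOnInterval γ 0 1 ∧ MemLp (deriv γ) 2 (volume.restrict (Icc (0 : ℝ) 1))

/-- `ξ ∈ W^{1,2}_0([0,1], ℝⁿ)`. -/
def IsW12Zero {n : ℕ} (ξ : ℝ → Rn n) : Prop :=
  IsW12 ξ ∧ ξ 0 = 0 ∧ ξ 1 = 0

/-- The set `X_y` of the `W^{1,2}` curves from `y` to `∂D` that lie in `D` except at the final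
endpoint. -/
def curvesToBoundary {n : ℕ} (D : Set (Rn n)) (y : Rn n) : Set (ℝ → Rn n) :=
  {γ | IsW12 γ ∧ γ 0 = y ∧ (∀ s ∈ Ico (0 : ℝ) 1, γ s ∈ D) ∧ γ 1 ∈ frontier D}

/-- The functional `𝒥(γ) = ∫₀¹ G(γ, γ') ds`. -/
def jacobiEnergy {n : ℕ} (H : Rn n × Rn n → ℝ) (E : ℝ) (γ : ℝ → Rn n) : ℝ :=
  ∫ s in (0 : ℝ)..1, jacobiG H E (γ s, deriv γ s)

/-- `ψ(y) = inf_{γ ∈ X_y} 𝒥(γ)`. -/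
def psi {n : ℕ} (H : Rn n × Rn n → ℝ) (E : ℝ) (D : Set (Rn n)) (y : Rn n) : ℝ :=
  sInf (jacobiEnergy H E '' curvesToBoundary D y)

/-- The integrand `∂G/∂q (γ, γ')[ξ] + ∂G/∂v (γ, γ')[ξ']` of the first variation of `𝒥`. -/
def firstVariation {n : ℕ} (H : Rn n × Rn n → ℝ) (E : ℝ) (γ ξ : ℝ → Rn n) (s : ℝ) : ℝ :=
  inner ℝ (partialQ (jacobiG H E) (γ s) (deriv γ s)) (ξ s) +
    inner ℝ (partialP (jacobiG H E) (γ s) (deriv γ s)) (deriv ξ s)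

end

/-! Over a compact part of `{V < E}` the function `U(q, ·)` is the square of a strictly convex
gauge, `U` and `G` are `C¹`, and `G` is comparable to `‖v‖²`. At `∂D` the set `{H(q, ·) ≤ E}`
shrinks to the origin, so `U` blows up and `G` tends to `0`. Both the existence of minimizers and
their behaviour at the final endpoint are therefore delicate, and one a priori estimate settles
both.

Away from `s = 1`, a curve that minimizes among curves with its endpoints has a momentum `P` solving
Hamilton's equations for `U` (`exists_momentum`, by the lemma of du Bois-Reymond). `U` is conserved,
equal to some `k² > 0`, and `e = P / k` lies on `{H = E}`. In the time `t` with `dt = w ds`, `w = k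
/ l`, where `l = ⟨∂H/∂p, e⟩ / 2` is `radialSpeed`, the pair `(γ, e)` solves Hamilton's equations for
`H`, and `∫ l dt` is the Jacobi length.

The estimate, in `exists_timeChange`, bounds the total time. The function `β = dV(q)[p]` is bounded
on the energy surface over the closure of `D`. Its derivative along the flow equals `-‖∇V‖² < 0`
where `p = 0`, that is, over `∂D`, so by compactness it is at most `-c + C l`. Integration gives `c
T ≤ 2M + C · length`.

Existence: on `{V ≤ c}` with `c < E` the direct method applies (`exists_minimizer`), and its
minimizers, cut at the level `c`, are trajectories of length at most `√ψ(y)` and of uniformly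
bounded time. As `c → E`, Arzelà–Ascoli yields a trajectory that reaches `∂D` with length at most
`√ψ(y)`. Run at constant Jacobi speed it lies in `X_y`: its derivative is square integrable because
`‖∂H/∂p‖² ≤ C l`.

Properties: the same bound makes `w` integrable for any minimizer. So `T` is finite, `e` is
absolutely continuous up to `s = 1`, and the integrand of the first variation is almost everywhere
`k` times the derivative of `⟨e, ξ⟩`. -/

open Filter Topology

/-! ### Absolutely continuous curves in `ℝⁿ`. -/

section AbsolutelyContinuous

variable {n : ℕ}

theorem AbsolutelyContinuousOnInterval.of_dist_le {X Y : Type*} [PseudoMetricSpace X]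
    [PseudoMetricSpace Y] {f : ℝ → X} {g : ℝ → Y} {a b : ℝ}
    (hg : AbsolutelyContinuousOnInterval g a b)
    (h : ∀ x ∈ uIcc a b, ∀ y ∈ uIcc a b, dist (f x) (f y) ≤ dist (g x) (g y)) :
    AbsolutelyContinuousOnInterval f a b := by
  rw [absolutelyContinuousOnInterval_iff] at hg ⊢
  intro ε hε
  obtain ⟨δ, hδ, H⟩ := hg ε hε
  refine ⟨δ, hδ, fun I hI hI' => lt_of_le_of_lt ?_ (H I hI hI')⟩
  exact Finset.sum_le_sum fun i hi => h _ (hI.1 i hi).1 _ (hI.1 i hi).2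

theorem AbsolutelyContinuousOnInterval.coord {f : ℝ → Rn n} {a b : ℝ}
    (hf : AbsolutelyContinuousOnInterval f a b) (i : Fin n) :
    AbsolutelyContinuousOnInterval (fun t => f t i) a b := by
  refine hf.of_dist_le fun x _ y _ => ?_
  rw [Real.dist_eq, dist_eq_norm, ← PiLp.sub_apply, ← Real.norm_eq_abs]
  exact PiLp.norm_apply_le _ i

theorem AbsolutelyContinuousOnInterval.congr {X : Type*} [PseudoMetricSpace X] {f g : ℝ → X}
    {a b : ℝ} (hf : AbsolutelyContinuousOnInterval f a b) (h : ∀ x ∈ uIcc a b, g x = f x) :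
    AbsolutelyContinuousOnInterval g a b :=
  hf.of_dist_le fun x hx y hy => by rw [h x hx, h y hy]

/-- The increments of the primitive are dominated by those of the scalar primitive of `‖f‖`, which
reduces the vector-valued case to the real one. -/
theorem absolutelyContinuousOnInterval_add_integral {F : Type*} [NormedAddCommGroup F]
    [NormedSpace ℝ F] {f : ℝ → F} {a b : ℝ}
    (h : IntervalIntegrable f volume a b) (y : F) :
    AbsolutelyContinuousOnInterval (fun x => y + ∫ v in a..x, f v) a b := by
  refine (h.norm.absolutelyContinuousOnInterval_intervalIntegral
    (c := a) left_mem_uIcc).of_dist_le fun s hs t ht => ?_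
  have hsub : ∀ x ∈ uIcc a b, IntervalIntegrable f volume a x := fun x hx =>
    h.mono_set (uIcc_subset_uIcc left_mem_uIcc hx)
  rw [dist_eq_norm, Real.dist_eq, add_sub_add_left_eq_sub,
    intervalIntegral.integral_interval_sub_left (hsub s hs) (hsub t ht),
    intervalIntegral.integral_interval_sub_left (hsub s hs).norm (hsub t ht).norm]
  exact intervalIntegral.norm_integral_le_abs_integral_norm

theorem AbsolutelyContinuousOnInterval.ae_differentiableAt_vec {f : ℝ → Rn n} {a b : ℝ}
    (hf : AbsolutelyContinuousOnInterval f a b) :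
    ∀ᵐ x : ℝ, x ∈ uIcc a b → DifferentiableAt ℝ f x := by
  have : ∀ᵐ x : ℝ, ∀ i, x ∈ uIcc a b → DifferentiableAt ℝ (fun t => f t i) x :=
    ae_all_iff.2 fun i => (hf.coord i).ae_differentiableAt
  filter_upwards [this] with x hx hx'
  exact differentiableAt_euclidean.2 fun i => hx i hx'

theorem deriv_coord {f : ℝ → Rn n} {x : ℝ} (h : DifferentiableAt ℝ f x) (i : Fin n) :
    deriv (fun t => f t i) x = deriv f x i :=
  ((hasDerivAt_pi.1 ((PiLp.continuousLinearEquiv 2 ℝ (fun _ : Fin n => ℝ)).hasFDerivAt.comp_hasDerivAt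
    x h.hasDerivAt)) i).deriv

/-- Integration by parts for absolutely continuous curves. -/
theorem AbsolutelyContinuousOnInterval.integral_inner {f g : ℝ → Rn n} {a b : ℝ}
    (hf : AbsolutelyContinuousOnInterval f a b) (hg : AbsolutelyContinuousOnInterval g a b) :
    IntervalIntegrable (fun s => inner ℝ (deriv f s) (g s) + inner ℝ (f s) (deriv g s))
      volume a b ∧
    ∫ s in a..b, (inner ℝ (deriv f s) (g s) + inner ℝ (f s) (deriv g s)) =
      inner ℝ (f b) (g b) - inner ℝ (f a) (g a) := by
  set F : ℝ → ℝ := fun s => ∑ i, (deriv (fun t => f t i) s * g s i + f s i * deriv (fun t => g t i) s)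
  have hae : ∀ᵐ s : ℝ, s ∈ uIcc a b →
      F s = inner ℝ (deriv f s) (g s) + inner ℝ (f s) (deriv g s) := by
    filter_upwards [hf.ae_differentiableAt_vec, hg.ae_differentiableAt_vec] with s h1 h2 hs
    simp only [F, PiLp.inner_apply, ← Finset.sum_add_distrib]
    refine Finset.sum_congr rfl fun i _ => ?_
    rw [deriv_coord (h1 hs), deriv_coord (h2 hs)]
    simp [mul_comm]
  have hint : ∀ i, IntervalIntegrable (fun s => deriv (fun t => f t i) s * g s i
      + f s i * deriv (fun t => g t i) s) volume a b := fun i =>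
    ((hf.coord i).intervalIntegrable_deriv.mul_continuousOn (hg.coord i).continuousOn).add
      ((hg.coord i).intervalIntegrable_deriv.continuousOn_mul (hf.coord i).continuousOn)
  have hF : IntervalIntegrable F volume a b := by
    have h := IntervalIntegrable.sum Finset.univ fun i _ => hint i
    rwa [show (∑ i, fun s => deriv (fun t => f t i) s * g s i
      + f s i * deriv (fun t => g t i) s) = F from by ext s; simp [F]] at h
  have hae' : ∀ᵐ s : ℝ, s ∈ uIoc a b →
      F s = inner ℝ (deriv f s) (g s) + inner ℝ (f s) (deriv g s) := by
    filter_upwards [hae] with s h hs using h (uIoc_subset_uIcc hs)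
  refine ⟨hF.congr_ae ((ae_restrict_iff' measurableSet_uIoc).2 hae'), ?_⟩
  rw [← intervalIntegral.integral_congr_ae hae']
  simp only [F]
  rw [intervalIntegral.integral_finsetSum fun i _ => hint i]
  simp only [PiLp.inner_apply, ← Finset.sum_sub_distrib]
  refine Finset.sum_congr rfl fun i _ => ?_
  rw [(hf.coord i).integral_deriv_mul_eq_sub (hg.coord i)]
  simp [mul_comm]

end AbsolutelyContinuous

/-! ### The space `W^{1,2}([0,1], ℝⁿ)`. -/

section Sobolev

variable {n : ℕ} {γ : ℝ → Rn n}

theorem IsW12.continuousOn (h : IsW12 γ) : ContinuousOn γ (Icc 0 1) := by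
  simpa using h.1.continuousOn

theorem IsW12.integrableOn_deriv (h : IsW12 γ) : IntegrableOn (deriv γ) (Icc 0 1) :=
  h.2.integrable one_le_two

theorem IsW12.intervalIntegrable_deriv (h : IsW12 γ) : IntervalIntegrable (deriv γ) volume 0 1 :=
  (intervalIntegrable_iff_integrableOn_Icc_of_le zero_le_one).2 h.integrableOn_deriv

theorem IsW12.eq_integral (h : IsW12 γ) {s : ℝ} (hs : s ∈ Icc (0 : ℝ) 1) :
    γ s = γ 0 + ∫ r in (0 : ℝ)..s, deriv γ r := by
  have hsub : uIcc 0 s ⊆ uIcc (0 : ℝ) 1 := by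
    rw [uIcc_of_le hs.1, uIcc_of_le zero_le_one]; exact Icc_subset_Icc_right hs.2
  have hac := h.1.mono hsub
  have hint := h.intervalIntegrable_deriv.mono_set hsub
  rw [← sub_eq_iff_eq_add']
  ext i
  have h1 := (hac.coord i).integral_deriv_eq_sub
  rw [PiLp.sub_apply, ← h1]
  have h2 := ((PiLp.proj 2 (fun _ : Fin n => ℝ) i : Rn n →L[ℝ] ℝ)).intervalIntegral_comp_comm hint
  simp only [PiLp.proj_apply] at h2
  rw [← h2]
  refine intervalIntegral.integral_congr_ae ?_
  filter_upwards [hac.ae_differentiableAt_vec] with r hr hr'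
  rw [deriv_coord (hr (uIoc_subset_uIcc hr'))]

theorem intervalIntegrable_of_memLp {φ : ℝ → Rn n}
    (hφ : MemLp φ 2 (volume.restrict (Icc (0 : ℝ) 1))) : IntervalIntegrable φ volume 0 1 :=
  (intervalIntegrable_iff_integrableOn_Icc_of_le zero_le_one).2 (hφ.integrable one_le_two)

/-- This is how every curve constructed below is recognized as a `W^{1,2}` curve. -/
theorem isW12_of_eq_integral {φ : ℝ → Rn n}
    (hφ : MemLp φ 2 (volume.restrict (Icc (0 : ℝ) 1)))
    (h : ∀ s ∈ Icc (0 : ℝ) 1, γ s = γ 0 + ∫ r in (0 : ℝ)..s, φ r) :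
    IsW12 γ ∧ deriv γ =ᵐ[volume.restrict (Icc (0 : ℝ) 1)] φ := by
  have hint := intervalIntegrable_of_memLp hφ
  have hd : deriv γ =ᵐ[volume.restrict (Icc (0 : ℝ) 1)] φ := by
    -- At `0` and `1` the two-sided derivative depends on the arbitrary values of `γ` outside
    -- `[0,1]`, hence the open interval.
    have : ∀ᵐ s ∂volume.restrict (Ioo (0 : ℝ) 1), deriv γ s = φ s := by
      rw [ae_restrict_iff' measurableSet_Ioo]
      filter_upwards [hint.ae_hasDerivAt_integral] with s hs hs'
      have hs1 : s ∈ uIcc (0 : ℝ) 1 := by simpa using ⟨hs'.1.le, hs'.2.le⟩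
      have h1 := (hs hs1 0 (by simp)).const_add (γ 0)
      have h2 : γ =ᶠ[𝓝 s] fun x => γ 0 + ∫ t in (0 : ℝ)..x, φ t := by
        filter_upwards [Icc_mem_nhds hs'.1 hs'.2] with x hx using h x hx
      exact (h1.congr_of_eventuallyEq h2).deriv
    rwa [Filter.EventuallyEq, Measure.restrict_congr_set Ioo_ae_eq_Icc.symm]
  refine ⟨⟨?_, (memLp_congr_ae hd).2 hφ⟩, hd⟩
  refine (absolutelyContinuousOnInterval_add_integral hint (γ 0)).congr ?_
  intro x hx
  exact h x (by simpa using hx)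

theorem IsW12.add_smul {ξ : ℝ → Rn n} (h : IsW12 γ) (hξ : IsW12 ξ) (t : ℝ) :
    IsW12 (fun s => γ s + t • ξ s) ∧
      deriv (fun s => γ s + t • ξ s) =ᵐ[volume.restrict (Icc (0 : ℝ) 1)]
        fun s => deriv γ s + t • deriv ξ s := by
  refine isW12_of_eq_integral (h.2.add (hξ.2.const_smul t)) fun s hs => ?_
  have hsub : uIcc 0 s ⊆ uIcc (0 : ℝ) 1 := by
    rw [uIcc_of_le hs.1, uIcc_of_le zero_le_one]; exact Icc_subset_Icc_right hs.2
  have i1 := h.intervalIntegrable_deriv.mono_set hsub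
  have i2 := (hξ.intervalIntegrable_deriv.mono_set hsub)
  have := intervalIntegral.integral_add i1 (i2.smul t)
  simp only [Pi.smul_apply] at this ⊢
  rw [this, intervalIntegral.integral_smul, h.eq_integral hs, hξ.eq_integral hs, smul_add]
  abel

end Sobolev

/-! ### Partial gradients and total derivatives. -/

section Partials

variable {n : ℕ}

/-- The linear form `(a, b) ↦ ⟨A, a⟩ + ⟨B, b⟩` on `ℝ²ⁿ`. -/
noncomputable def pairForm (A B : Rn n) : Rn n × Rn n →L[ℝ] ℝ :=
  (innerSL ℝ A).coprod (innerSL ℝ B)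

@[simp] theorem pairForm_apply (A B : Rn n) (x : Rn n × Rn n) :
    pairForm A B x = inner ℝ A x.1 + inner ℝ B x.2 := by
  simp [pairForm]

theorem ContinuousAt.pairForm {X : Type*} [TopologicalSpace X] {A B : X → Rn n} {x : X}
    (hA : ContinuousAt A x) (hB : ContinuousAt B x) :
    ContinuousAt (fun y => pairForm (A y) (B y)) x := by
  have h1 := ((innerSL ℝ (E := Rn n)).continuous.continuousAt (x := A x)).comp hA
  have h2 := ((innerSL ℝ (E := Rn n)).continuous.continuousAt (x := B x)).comp hB
  have h3 := (ContinuousLinearMap.fst ℝ (Rn n) (Rn n)).precomp ℝ |>.continuous.continuousAt.comp h1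
  have h4 := (ContinuousLinearMap.snd ℝ (Rn n) (Rn n)).precomp ℝ |>.continuous.continuousAt.comp h2
  convert h3.add h4 using 1
  ext y x <;> simp

theorem partialQ_eq_of_hasFDerivAt {f : Rn n × Rn n → ℝ} {A B q p : Rn n}
    (h : HasFDerivAt f (pairForm A B) (q, p)) : partialQ f q p = A := by
  have h1 : HasFDerivAt (fun q' : Rn n => (q', p)) (ContinuousLinearMap.inl ℝ (Rn n) (Rn n)) q :=
    hasFDerivAt_prodMk_left q p
  have h2 := h.comp q h1
  have h3 : HasGradientAt (fun q' => f (q', p)) A q := by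
    rw [hasGradientAt_iff_hasFDerivAt]
    exact h2.congr_fderiv (by ext a; simp)
  exact h3.gradient

theorem partialP_eq_of_hasFDerivAt {f : Rn n × Rn n → ℝ} {A B q p : Rn n}
    (h : HasFDerivAt f (pairForm A B) (q, p)) : partialP f q p = B := by
  have h1 : HasFDerivAt (fun p' : Rn n => (q, p')) (ContinuousLinearMap.inr ℝ (Rn n) (Rn n)) p :=
    hasFDerivAt_prodMk_right q p
  have h2 := h.comp p h1
  have h3 : HasGradientAt (fun p' => f (q, p')) B p := by
    rw [hasGradientAt_iff_hasFDerivAt]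
    exact h2.congr_fderiv (by ext a; simp)
  exact h3.gradient

theorem exists_pairForm (L : Rn n × Rn n →L[ℝ] ℝ) :
    L = pairForm ((InnerProductSpace.toDual ℝ (Rn n)).symm (L ∘L .inl ℝ (Rn n) (Rn n)))
      ((InnerProductSpace.toDual ℝ (Rn n)).symm (L ∘L .inr ℝ (Rn n) (Rn n))) := by
  ext x <;> simp

theorem partialQ_eq {f : Rn n × Rn n → ℝ} {q p : Rn n} (h : DifferentiableAt ℝ f (q, p)) :
    partialQ f q p = (InnerProductSpace.toDual ℝ (Rn n)).symm
      (fderiv ℝ f (q, p) ∘L .inl ℝ (Rn n) (Rn n)) :=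
  partialQ_eq_of_hasFDerivAt (by rw [← exists_pairForm]; exact h.hasFDerivAt)

theorem partialP_eq {f : Rn n × Rn n → ℝ} {q p : Rn n} (h : DifferentiableAt ℝ f (q, p)) :
    partialP f q p = (InnerProductSpace.toDual ℝ (Rn n)).symm
      (fderiv ℝ f (q, p) ∘L .inr ℝ (Rn n) (Rn n)) :=
  partialP_eq_of_hasFDerivAt (by rw [← exists_pairForm]; exact h.hasFDerivAt)

theorem fderiv_eq_pairForm {f : Rn n × Rn n → ℝ} {x : Rn n × Rn n} (h : DifferentiableAt ℝ f x) :
    fderiv ℝ f x = pairForm (partialQ f x.1 x.2) (partialP f x.1 x.2) := by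
  rw [partialQ_eq h, partialP_eq h]; exact exists_pairForm _

end Partials

/-! ### Convexity of `H` in the momentum and compactness of the energy surface. -/

section Hamiltonian

variable {n : ℕ} {H : Rn n × Rn n → ℝ} {E : ℝ}

/-- Monotonicity is used twice: `g' - c t` is nondecreasing, hence so is `g - c t² / 2 - g'(0) t` on
`t ≥ 0`. Continuity of `g''` plays no role. -/
theorem taylor_lower_bound {g g' g'' : ℝ → ℝ} {c : ℝ} (h : ∀ t, HasDerivAt g (g' t) t)
    (h' : ∀ t, HasDerivAt g' (g'' t) t) (hc : ∀ t, c ≤ g'' t) : g 0 + g' 0 + c / 2 ≤ g 1 := by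
  have m1 : Monotone fun t => g' t - c * t := by
    refine monotone_of_hasDerivAt_nonneg
      (f' := fun t => g'' t - c * 1) (fun t => (h' t).sub ((hasDerivAt_id t).const_mul c)) ?_
    intro t; have := hc t; simp; linarith
  have m2 : MonotoneOn (fun t => g t - c / 2 * t ^ 2 - g' 0 * t) (Ici 0) := by
    have hd : ∀ t, HasDerivAt (fun t => g t - c / 2 * t ^ 2 - g' 0 * t)
        (g' t - c / 2 * (2 * t) - g' 0 * 1) t := fun t => by
      have := ((h t).sub ((hasDerivAt_pow 2 t).const_mul (c / 2))).sub
        ((hasDerivAt_id t).const_mul (g' 0))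
      exact this.congr_deriv (by simp)
    refine monotoneOn_of_deriv_nonneg (convex_Ici 0)
      (fun t _ => (hd t).continuousAt.continuousWithinAt)
      (fun t _ => (hd t).differentiableAt.differentiableWithinAt) fun t ht => ?_
    rw [(hd t).deriv]
    have h0 : (0 : ℝ) ≤ t := interior_subset ht
    have := m1 h0
    simp at this
    linarith
  have := m2 (mem_Ici.2 le_rfl) (mem_Ici.2 zero_le_one) zero_le_one
  simp at this
  linarith

namespace IsClassicalHamiltonian

variable (hH : IsClassicalHamiltonian H)
include hH

theorem differentiable : Differentiable ℝ H := hH.contDiff.differentiable (by norm_num)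

theorem hasStrictFDerivAt (x : Rn n × Rn n) :
    HasStrictFDerivAt H (pairForm (partialQ H x.1 x.2) (partialP H x.1 x.2)) x := by
  rw [← fderiv_eq_pairForm (hH.differentiable x)]
  exact hH.contDiff.contDiffAt.hasStrictFDerivAt (by norm_num)

theorem continuous_partialQ : Continuous fun x : Rn n × Rn n => partialQ H x.1 x.2 := by
  have h := hH.contDiff.continuous_fderiv (by norm_num)
  simp_rw [fun x : Rn n × Rn n => partialQ_eq (hH.differentiable (x.1, x.2))]
  exact (InnerProductSpace.toDual ℝ (Rn n)).symm.continuous.comp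
    (((ContinuousLinearMap.inl ℝ (Rn n) (Rn n)).precomp ℝ).continuous.comp h)

theorem continuous_partialP : Continuous fun x : Rn n × Rn n => partialP H x.1 x.2 := by
  have h := hH.contDiff.continuous_fderiv (by norm_num)
  simp_rw [fun x : Rn n × Rn n => partialP_eq (hH.differentiable (x.1, x.2))]
  exact (InnerProductSpace.toDual ℝ (Rn n)).symm.continuous.comp
    (((ContinuousLinearMap.inr ℝ (Rn n) (Rn n)).precomp ℝ).continuous.comp h)

theorem contDiff_potential : ContDiff ℝ 2 (potential H) :=
  hH.contDiff.comp (contDiff_prodMk_left 0)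

/-- The Hessian bound, integrated along the segment from `p` to `p'`. All later convexity arguments
go through this inequality. -/
theorem exists_strong_convexity : ∃ ν : Rn n → ℝ, Continuous ν ∧ (∀ q, 0 < ν q) ∧
    ∀ q p p', H (q, p) + inner ℝ (partialP H q p) (p' - p) + ν q / 2 * ‖p' - p‖ ^ 2
      ≤ H (q, p') := by
  obtain ⟨ν, h1, h2, h3⟩ := hH.posDef
  refine ⟨ν, h1, h2, fun q p p' => ?_⟩
  set w := p' - p
  set h : Rn n → ℝ := fun p' => H (q, p')
  have hh : ContDiff ℝ 2 h := hH.contDiff.comp (contDiff_prodMk_right q)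
  have hl : ∀ t : ℝ, HasDerivAt (fun t : ℝ => p + t • w) w t := fun t => by
    simpa using ((hasDerivAt_id t).smul_const w).const_add p
  have hd : ∀ t : ℝ, HasDerivAt (fun t : ℝ => h (p + t • w)) (fderiv ℝ h (p + t • w) w) t :=
    fun t => ((hh.differentiable (by norm_num)) _).hasFDerivAt.comp_hasDerivAt t (hl t)
  have hd' : ∀ t : ℝ, HasDerivAt (fun t : ℝ => fderiv ℝ h (p + t • w) w)
      (fderiv ℝ (fderiv ℝ h) (p + t • w) w w) t := fun t => by
    have hf : Differentiable ℝ (fderiv ℝ h) :=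
      (hh.fderiv_right (m := 1) (by norm_num)).differentiable (by norm_num)
    have := (hf (p + t • w)).hasFDerivAt.comp_hasDerivAt t (hl t)
    exact this.clm_apply (hasDerivAt_const t w) |>.congr_deriv (by simp)
  have key := taylor_lower_bound hd hd' fun t => h3 q (p + t • w) w
  have e0 : fderiv ℝ h p w = inner ℝ (partialP H q p) w := by
    rw [partialP, gradient, InnerProductSpace.toDual_symm_apply]
  simp only [zero_smul, add_zero, one_smul, e0] at key
  have e1 : p + w = p' := by simp [w]
  rw [e1] at key
  simp only [h] at key
  linarith

end IsClassicalHamiltonian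

/-- A continuous modulus of strong convexity of `H(q, ·)`. -/
noncomputable def IsClassicalHamiltonian.modulus (hH : IsClassicalHamiltonian H) : Rn n → ℝ :=
  hH.exists_strong_convexity.choose

/-- Half of the derivative of `H(q, ·)` at `p` in the direction `p`. -/
noncomputable def radialSpeed (H : Rn n × Rn n → ℝ) (x : Rn n × Rn n) : ℝ :=
  inner ℝ (partialP H x.1 x.2) x.2 / 2

namespace IsClassicalHamiltonian

variable (hH : IsClassicalHamiltonian H)
include hH

theorem continuous_modulus : Continuous hH.modulus := hH.exists_strong_convexity.choose_spec.1

theorem modulus_pos (q : Rn n) : 0 < hH.modulus q := hH.exists_strong_convexity.choose_spec.2.1 q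

theorem strong_convexity (q p p' : Rn n) :
    H (q, p) + inner ℝ (partialP H q p) (p' - p) + hH.modulus q / 2 * ‖p' - p‖ ^ 2 ≤ H (q, p') :=
  hH.exists_strong_convexity.choose_spec.2.2 q p p'

/-- An even function has a critical point at `0`; with convexity, `V(q)` is the minimum of `H(q,
·)`. Evenness enters only here. -/
theorem partialP_zero (q : Rn n) : partialP H q 0 = 0 := by
  set h : Rn n → ℝ := fun p' => H (q, p')
  have hd : HasFDerivAt h (fderiv ℝ h 0) 0 :=
    ((hH.contDiff.comp (contDiff_prodMk_right q)).differentiable (by norm_num) _).hasFDerivAt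
  have h2 : HasFDerivAt (fun p => h (-p)) (-fderiv ℝ h 0) 0 := by
    have h3 : HasFDerivAt h (fderiv ℝ h 0) (-0) := by simpa using hd
    have := h3.comp (0 : Rn n) (hasFDerivAt_id (0 : Rn n)).neg
    refine this.congr_fderiv ?_
    ext; simp
  have h4 : (fun p => h (-p)) = h := by ext p; exact hH.even q p
  rw [h4] at h2
  have h5 := hd.unique h2
  have h6 : fderiv ℝ h 0 = 0 := by
    ext x
    have := DFunLike.congr_fun h5 x
    simp at this ⊢
    linarith
  rw [partialP, gradient, h6, map_zero]

theorem potential_add_le (q p : Rn n) :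
    potential H q + hH.modulus q / 2 * ‖p‖ ^ 2 ≤ H (q, p) := by
  have := hH.strong_convexity q 0 p
  simpa [hH.partialP_zero, potential] using this

/-- Sum of the convexity inequalities based at `0` and at `p`. In particular `radialSpeed` vanishes
only for `p = 0`; on the energy surface over the closure of `D` this happens only over `∂D`. -/
theorem le_radialSpeed (q p : Rn n) : hH.modulus q / 2 * ‖p‖ ^ 2 ≤ radialSpeed H (q, p) := by
  have h1 := hH.strong_convexity q p 0
  have h2 := hH.potential_add_le q p
  simp only [zero_sub, inner_neg_right, norm_neg, potential, radialSpeed] at *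
  linarith

theorem radialSpeed_pos {q p : Rn n} (hp : p ≠ 0) : 0 < radialSpeed H (q, p) := by
  refine lt_of_lt_of_le ?_ (hH.le_radialSpeed q p)
  have := hH.modulus_pos q
  have := norm_pos_iff.2 hp
  positivity

theorem radialSpeed_nonneg (x : Rn n × Rn n) : 0 ≤ radialSpeed H x := by
  refine le_trans ?_ (hH.le_radialSpeed x.1 x.2)
  have := hH.modulus_pos x.1
  positivity

theorem continuous_radialSpeed : Continuous (radialSpeed H) :=
  (hH.continuous_partialP.inner continuous_snd).div_const 2

/-- The radial derivative is nonnegative and the quadratic term makes the growth strict. Hence a ray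
meets a level of `H(q, ·)` at most once. -/
theorem strictMonoOn_ray (q : Rn n) {p : Rn n} (hp : p ≠ 0) :
    StrictMonoOn (fun t : ℝ => H (q, t • p)) (Ici 0) := by
  intro s hs t ht hst
  have h1 := hH.strong_convexity q (s • p) (t • p)
  have h2 : 0 ≤ inner ℝ (partialP H q (s • p)) (t • p - s • p) := by
    rw [← sub_smul, inner_smul_right]
    rcases (mem_Ici.1 hs).eq_or_lt with h | h
    · simp [← h, hH.partialP_zero]
    · have h3 := hH.radialSpeed_nonneg (q, s • p)
      simp only [radialSpeed, inner_smul_right] at h3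
      have : 0 ≤ inner ℝ (partialP H q (s • p)) p := by
        by_contra! hc
        have := mul_neg_of_pos_of_neg h hc
        linarith
      exact mul_nonneg (by linarith) this
  have h3 : 0 < hH.modulus q / 2 * ‖t • p - s • p‖ ^ 2 := by
    have := hH.modulus_pos q
    have h4 : 0 < ‖t • p - s • p‖ := by
      rw [← sub_smul, norm_smul]
      exact mul_pos (norm_pos_iff.2 (by linarith)) (norm_pos_iff.2 hp)
    positivity
  show H (q, s • p) < H (q, t • p)
  linarith

theorem exists_ray_eq {q p : Rn n} (hq : potential H q < E) (hp : p ≠ 0) :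
    ∃ r : ℝ, 0 < r ∧ H (q, r • p) = E := by
  have hcont : Continuous fun t : ℝ => H (q, t • p) :=
    hH.contDiff.continuous.comp (by fun_prop)
  have hν := hH.modulus_pos q
  have hpn := norm_pos_iff.2 hp
  obtain ⟨R, hR0, hR⟩ : ∃ R : ℝ, 0 ≤ R ∧ E ≤ H (q, R • p) := by
    have hpos : 0 < hH.modulus q / 2 * ‖p‖ ^ 2 := by positivity
    set c := hH.modulus q / 2 * ‖p‖ ^ 2
    -- With `x = (E - V(q)) / c`, the quadratic growth at radius `x + 1` is `(x + 1)² c ≥ x c = E -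
    -- V(q)`.
    refine ⟨(E - potential H q) / c + 1, by have := div_pos (sub_pos.2 hq) hpos; linarith, ?_⟩
    have hx := div_pos (sub_pos.2 hq) hpos
    set x := (E - potential H q) / c
    have h1 := hH.potential_add_le q ((x + 1) • p)
    rw [norm_smul, mul_pow, Real.norm_eq_abs, sq_abs] at h1
    have h2 : x * c = E - potential H q := by simp [x]; field_simp
    have h3 : hH.modulus q / 2 * ((x + 1) ^ 2 * ‖p‖ ^ 2) = (x + 1) ^ 2 * c := by simp only [c]; ring
    nlinarith [sq_nonneg x, mul_pos hx hpos]
  obtain ⟨r, hr, hr'⟩ := intermediate_value_Icc hR0 hcont.continuousOn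
    (show E ∈ Icc (H (q, (0 : ℝ) • p)) (H (q, R • p)) from ⟨by simpa [potential] using hq.le, hR⟩)
  refine ⟨r, lt_of_le_of_ne hr.1 ?_, hr'⟩
  rintro rfl
  simp [potential] at hr' hq
  linarith

/-- Quadratic growth bounds `‖p‖²` by `(E - V) / (ν / 2)`, which is bounded on `K`. The set `K` may
meet `{V = E}`, so this covers the whole closure of `D`. -/
theorem isCompact_energy {K : Set (Rn n)} (hK : IsCompact K) :
    IsCompact {x : Rn n × Rn n | x.1 ∈ K ∧ H x = E} := by
  have hf : ContinuousOn (fun q => (E - potential H q) / (hH.modulus q / 2)) K :=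
    ((continuous_const.sub hH.contDiff_potential.continuous).div
      (hH.continuous_modulus.div_const 2)
      fun q => (half_pos (hH.modulus_pos q)).ne').continuousOn
  obtain ⟨C, hC⟩ := hK.exists_bound_of_continuousOn hf
  refine (hK.prod (isCompact_closedBall (0 : Rn n) (C + 1))).of_isClosed_subset ?_ ?_
  · exact (hK.isClosed.preimage continuous_fst).inter
      (isClosed_singleton.preimage hH.contDiff.continuous)
  · rintro ⟨q, p⟩ ⟨h1, h2⟩
    refine ⟨h1, ?_⟩
    have h3 := hC q h1
    have h4 := hH.potential_add_le q p
    have hν := half_pos (hH.modulus_pos q)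
    rw [Real.norm_eq_abs] at h3
    have h5 : ‖p‖ ^ 2 ≤ C := by
      refine le_trans ?_ ((le_abs_self _).trans h3)
      rw [le_div_iff₀ hν]
      have : H (q, p) = E := h2
      linarith
    rw [mem_closedBall_zero_iff]
    nlinarith [norm_nonneg p, sq_nonneg (‖p‖ - 1)]

end IsClassicalHamiltonian

end Hamiltonian

/-! ### The Minkowski functional of `{H(q, ·) ≤ E}` and its derivative. -/

section Gauge

variable {n : ℕ} {H : Rn n × Rn n → ℝ} {E : ℝ}

/-- The Minkowski functional of `{p | H(q, p) ≤ E}`. -/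
noncomputable def energyGauge (H : Rn n × Rn n → ℝ) (E : ℝ) (x : Rn n × Rn n) : ℝ :=
  gauge {p : Rn n | H (x.1, p) ≤ E} x.2

/-- Radial projection of `p` to the level set `{H(q, ·) = E}` (and `0` for `p = 0`). -/
noncomputable def energyProj (H : Rn n × Rn n → ℝ) (E : ℝ) (x : Rn n × Rn n) : Rn n :=
  (energyGauge H E x)⁻¹ • x.2

/-- The derivative `∂U/∂q`, in terms of `H`. -/
noncomputable def jacobiUq (H : Rn n × Rn n → ℝ) (E : ℝ) (x : Rn n × Rn n) : Rn n :=
  (jacobiU H E x / radialSpeed H (x.1, energyProj H E x)) • partialQ H x.1 (energyProj H E x)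

/-- The derivative `∂U/∂p`, in terms of `H`. -/
noncomputable def jacobiUp (H : Rn n × Rn n → ℝ) (E : ℝ) (x : Rn n × Rn n) : Rn n :=
  (energyGauge H E x / radialSpeed H (x.1, energyProj H E x)) • partialP H x.1 (energyProj H E x)

theorem jacobiU_eq (x : Rn n × Rn n) : jacobiU H E x = energyGauge H E x ^ 2 := rfl

theorem jacobiU_nonneg (x : Rn n × Rn n) : 0 ≤ jacobiU H E x := sq_nonneg _

@[simp] theorem energyGauge_zero (q : Rn n) : energyGauge H E (q, 0) = 0 := gauge_zero

@[simp] theorem jacobiU_zero (q : Rn n) : jacobiU H E (q, 0) = 0 := by simp [jacobiU_eq]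

@[simp] theorem jacobiUp_zero (q : Rn n) : jacobiUp H E (q, 0) = 0 := by simp [jacobiUp]

@[simp] theorem jacobiUq_zero (q : Rn n) : jacobiUq H E (q, 0) = 0 := by simp [jacobiUq]

theorem energyGauge_nonneg (x : Rn n × Rn n) : 0 ≤ energyGauge H E x := gauge_nonneg _

namespace IsClassicalHamiltonian

variable (hH : IsClassicalHamiltonian H)
include hH

theorem energyGauge_eq_inv {q p : Rn n} {r : ℝ} (hp : p ≠ 0) (hr : 0 < r)
    (h : H (q, r • p) = E) : energyGauge H E (q, p) = r⁻¹ := by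
  rw [energyGauge, gauge_def']
  have : {s ∈ Ioi (0 : ℝ) | s⁻¹ • p ∈ {p' | H (q, p') ≤ E}} = Ici r⁻¹ := by
    ext s
    simp only [mem_Ioi, mem_ofPred_eq, mem_Ici]
    constructor
    · rintro ⟨hs, h1⟩
      rw [← h] at h1
      have := ((hH.strictMonoOn_ray q hp).le_iff_le (mem_Ici.2 (inv_pos.2 hs).le)
        (mem_Ici.2 hr.le)).1 h1
      exact (inv_le_comm₀ hs hr).1 this
    · intro hs
      have hs0 : 0 < s := lt_of_lt_of_le (inv_pos.2 hr) hs
      refine ⟨hs0, ?_⟩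
      rw [← h]
      exact ((hH.strictMonoOn_ray q hp).le_iff_le (mem_Ici.2 (inv_pos.2 hs0).le)
        (mem_Ici.2 hr.le)).2 ((inv_le_comm₀ hr hs0).1 hs)
  exact (congrArg sInf this).trans csInf_Ici

theorem energyGauge_pos {q p : Rn n} (hq : potential H q < E) (hp : p ≠ 0) :
    0 < energyGauge H E (q, p) := by
  obtain ⟨r, hr, h⟩ := hH.exists_ray_eq hq hp
  rw [hH.energyGauge_eq_inv hp hr h]
  exact inv_pos.2 hr

theorem energy_energyProj {q p : Rn n} (hq : potential H q < E) (hp : p ≠ 0) :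
    H (q, energyProj H E (q, p)) = E := by
  obtain ⟨r, hr, h⟩ := hH.exists_ray_eq hq hp
  rw [energyProj, hH.energyGauge_eq_inv hp hr h, inv_inv]
  exact h

omit hH in
theorem ne_zero_of_energy {q e : Rn n} (hq : potential H q < E) (he : H (q, e) = E) : e ≠ 0 := by
  rintro rfl
  exact hq.ne he

theorem energyGauge_of_energy {q e : Rn n} (hq : potential H q < E) (he : H (q, e) = E) :
    energyGauge H E (q, e) = 1 := by
  rw [hH.energyGauge_eq_inv (ne_zero_of_energy hq he) one_pos (by rwa [one_smul]), inv_one]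

theorem gauge_smul_energyProj {q p : Rn n} (hq : potential H q < E) :
    energyGauge H E (q, p) • energyProj H E (q, p) = p := by
  rcases eq_or_ne p 0 with rfl | hp
  · simp [energyProj]
  · rw [energyProj, smul_inv_smul₀ (hH.energyGauge_pos hq hp).ne']

omit hH in
theorem energyGauge_smul {q p : Rn n} {c : ℝ} (hc : 0 ≤ c) :
    energyGauge H E (q, c • p) = c * energyGauge H E (q, p) := by
  rw [energyGauge, gauge_smul_of_nonneg hc]; rfl

theorem energyProj_of_energy {q e : Rn n} (hq : potential H q < E) (he : H (q, e) = E) {c : ℝ}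
    (hc : 0 < c) : energyProj H E (q, c • e) = e := by
  rw [energyProj, energyGauge_smul hc.le, hH.energyGauge_of_energy hq he, mul_one]
  simp [smul_smul, inv_mul_cancel₀ hc.ne']

/-- Strong convexity between two points of the same energy: the level set is strictly convex in a
quantitative way. -/
theorem inner_partialP_le {q e e' : Rn n} (he : H (q, e) = E) (he' : H (q, e') = E) :
    inner ℝ (partialP H q e) e' + hH.modulus q / 2 * ‖e' - e‖ ^ 2 ≤ 2 * radialSpeed H (q, e) := by
  have := hH.strong_convexity q e e'
  rw [he, he', inner_sub_right] at this
  simp only [radialSpeed]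
  linarith

/-- Euler's identity for degree `2`, computed from the formula, since `jacobiUp` is not yet known to
be a derivative. -/
theorem inner_jacobiUp_self {q p : Rn n} (hq : potential H q < E) :
    inner ℝ (jacobiUp H E (q, p)) p = 2 * jacobiU H E (q, p) := by
  rcases eq_or_ne p 0 with rfl | hp
  · simp
  have he := hH.energy_energyProj hq hp
  have hl := hH.radialSpeed_pos (q := q) (ne_zero_of_energy hq he)
  have h1 : energyGauge H E (q, p) • energyProj H E (q, p) = p := hH.gauge_smul_energyProj hq
  rw [jacobiUp, inner_smul_left, jacobiU_eq]
  simp only [radialSpeed, conj_trivial] at hl ⊢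
  generalize energyProj H E (q, p) = e at *
  generalize energyGauge H E (q, p) = N at *
  have hl' : inner ℝ (partialP H q e) e ≠ 0 := fun h => by simp [h] at hl
  rw [← h1, inner_smul_right]
  field_simp

/-- The tangent inequality for `U(q, ·)`, with its case of equality. -/
theorem jacobiU_tangent {q : Rn n} (hq : potential H q < E) (p p' : Rn n) :
    jacobiU H E (q, p) + inner ℝ (jacobiUp H E (q, p)) (p' - p) ≤ jacobiU H E (q, p') ∧
    (jacobiU H E (q, p) + inner ℝ (jacobiUp H E (q, p)) (p' - p) = jacobiU H E (q, p') →
      p' = p) := by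
  rw [inner_sub_right, hH.inner_jacobiUp_self hq]
  rcases eq_or_ne p 0 with rfl | hp
  · simp only [jacobiU_zero, jacobiUp_zero, inner_zero_left, mul_zero, sub_zero, zero_add]
    refine ⟨jacobiU_nonneg _, fun h => ?_⟩
    by_contra hp'
    exact (pow_pos (hH.energyGauge_pos hq hp') 2).ne h
  rcases eq_or_ne p' 0 with rfl | hp'
  · have : 0 < jacobiU H E (q, p) := pow_pos (hH.energyGauge_pos hq hp) 2
    simp only [jacobiU_zero, inner_zero_right]
    exact ⟨by linarith, fun h => by linarith⟩
  have he := hH.energy_energyProj hq hp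
  have he' := hH.energy_energyProj hq hp'
  have hl := hH.radialSpeed_pos (q := q) (ne_zero_of_energy hq he)
  have hN := hH.energyGauge_pos hq hp
  have hN' := hH.energyGauge_pos hq hp'
  have h1 := hH.gauge_smul_energyProj hq (p := p)
  have h1' := hH.gauge_smul_energyProj hq (p := p')
  have h2 := hH.inner_partialP_le he he'
  have hν := half_pos (hH.modulus_pos q)
  have h3 : inner ℝ (jacobiUp H E (q, p)) p' =
      energyGauge H E (q, p) * energyGauge H E (q, p') / radialSpeed H (q, energyProj H E (q, p)) *
        inner ℝ (partialP H q (energyProj H E (q, p))) (energyProj H E (q, p')) := by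
    rw [jacobiUp, inner_smul_left]
    conv_lhs => rw [← h1', inner_smul_right]
    simp only [conj_trivial]
    ring
  rw [h3, jacobiU_eq, jacobiU_eq]
  set N := energyGauge H E (q, p)
  set N' := energyGauge H E (q, p')
  set e := energyProj H E (q, p)
  set e' := energyProj H E (q, p')
  set l := radialSpeed H (q, e)
  set a := inner ℝ (partialP H q e) e'
  -- By `inner_partialP_le` the mixed term is at most `2 N N'` minus a multiple of `‖e' - e‖²`. The
  -- tangent inequality becomes `2 N N' ≤ N² + N'²`, and equality forces both `N = N'` and `e = e'`.
  have h4 : N * N' / l * a ≤ 2 * (N * N') - N * N' / l * (hH.modulus q / 2 * ‖e' - e‖ ^ 2) := by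
    have : N * N' / l * (a + hH.modulus q / 2 * ‖e' - e‖ ^ 2) ≤ N * N' / l * (2 * l) := by
      gcongr
    have h5 : N * N' / l * (2 * l) = 2 * (N * N') := by field_simp
    linarith
  have h6 : 0 ≤ N * N' / l * (hH.modulus q / 2 * ‖e' - e‖ ^ 2) := by positivity
  refine ⟨by nlinarith [sq_nonneg (N - N')], fun h => ?_⟩
  have h7 : N * N' / l * (hH.modulus q / 2 * ‖e' - e‖ ^ 2) = 0 := by
    nlinarith [sq_nonneg (N - N')]
  have h8 : (N - N') ^ 2 = 0 := by nlinarith [sq_nonneg (N - N')]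
  have h9 : N' = N := by
    have := pow_eq_zero_iff (two_ne_zero) |>.1 h8
    linarith
  have h10 : e' = e := by
    have h11 : N * N' / l * (hH.modulus q / 2) ≠ 0 := by positivity
    rw [← mul_assoc, mul_eq_zero] at h7
    have := h7.resolve_left h11
    rwa [sq_eq_zero_iff, norm_eq_zero, sub_eq_zero] at this
  rw [← h1, ← h1', h9, h10]

theorem isOpen_potential_lt : IsOpen {q : Rn n | potential H q < E} :=
  isOpen_lt hH.contDiff_potential.continuous continuous_const

/-- The gauge is `1 / ρ`, where `ρ(q, p)` solves `H(q, ρ p) = E`. The implicit function theorem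
applies because the derivative in `ρ`, namely `⟨∂H/∂p(q, r p), p⟩`, is not zero. -/
theorem hasStrictFDerivAt_energyGauge {q p : Rn n} (hq : potential H q < E) (hp : p ≠ 0) :
    HasStrictFDerivAt (energyGauge H E)
      (pairForm ((energyGauge H E (q, p) / (2 * radialSpeed H (q, energyProj H E (q, p)))) •
          partialQ H q (energyProj H E (q, p)))
        ((1 / (2 * radialSpeed H (q, energyProj H E (q, p)))) •
          partialP H q (energyProj H E (q, p)))) (q, p) := by
  obtain ⟨r, hr, hrE⟩ := hH.exists_ray_eq hq hp
  have hN := hH.energyGauge_eq_inv hp hr hrE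
  have heq : energyProj H E (q, p) = r • p := by simp [energyProj, hN]
  rw [heq]
  have hl : 0 < radialSpeed H (q, r • p) := hH.radialSpeed_pos (smul_ne_zero hr.ne' hp)
  set x₀ : Rn n × Rn n := (q, p)
  have hφ : HasStrictFDerivAt (fun u : (Rn n × Rn n) × ℝ => (u.1.1, u.2 • u.1.2))
      (((ContinuousLinearMap.fst ℝ _ _) ∘L (ContinuousLinearMap.fst ℝ (Rn n × Rn n) ℝ)).prod
        (r • ((ContinuousLinearMap.snd ℝ _ _) ∘L (ContinuousLinearMap.fst ℝ (Rn n × Rn n) ℝ)) +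
          (ContinuousLinearMap.snd ℝ (Rn n × Rn n) ℝ).smulRight p)) (x₀, r) := by
    refine HasStrictFDerivAt.prodMk ?_ ?_
    · exact hasStrictFDerivAt_fst.comp _ hasStrictFDerivAt_fst
    · exact (hasStrictFDerivAt_snd (𝕜 := ℝ) (E := Rn n × Rn n) (F := ℝ) (p := (x₀, r))).smul
        ((hasStrictFDerivAt_snd (𝕜 := ℝ)).comp _ hasStrictFDerivAt_fst)
  have hF := (hH.hasStrictFDerivAt (q, r • p)).comp (x₀, r) hφ
  set F' := (pairForm (partialQ H (q, r • p).1 (q, r • p).2)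
    (partialP H (q, r • p).1 (q, r • p).2)).comp (((ContinuousLinearMap.fst ℝ _ _) ∘L (ContinuousLinearMap.fst ℝ (Rn n × Rn n) ℝ)).prod
        (r • ((ContinuousLinearMap.snd ℝ _ _) ∘L (ContinuousLinearMap.fst ℝ (Rn n × Rn n) ℝ)) +
          (ContinuousLinearMap.snd ℝ (Rn n × Rn n) ℝ).smulRight p))
  have hc : inner ℝ (partialP H q (r • p)) p ≠ 0 := by
    intro h0
    simp [radialSpeed, inner_smul_right, h0] at hl
  have hinv : (F' ∘L .inr ℝ (Rn n × Rn n) ℝ).IsInvertible := by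
    refine ⟨ContinuousLinearEquiv.unitsEquivAut ℝ (Units.mk0 _ hc), ?_⟩
    ext
    simp [F']
  set ρ := hF.implicitFunctionOfProdDomain hinv
  have hρd := hF.hasStrictFDerivAt_implicitFunctionOfProdDomain hinv
  have hρt : Tendsto ρ (𝓝 x₀) (𝓝 r) := hF.tendsto_implicitFunctionOfProdDomain hinv
  have hρe : ∀ᶠ x in 𝓝 x₀, H (x.1, ρ x • x.2) = E := by
    have := hF.eventually_apply_implicitFunctionOfProdDomain hinv
    filter_upwards [this] with x hx
    exact hx.trans hrE
  have hgauge : ∀ᶠ x in 𝓝 x₀, (ρ x)⁻¹ = energyGauge H E x := by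
    filter_upwards [hρe, hρt.eventually (lt_mem_nhds hr),
      continuous_snd.continuousAt.eventually_ne hp] with x h1 h2 h3
    exact (hH.energyGauge_eq_inv h3 h2 h1).symm
  set ρ' := (-(F' ∘L .inr ℝ (Rn n × Rn n) ℝ).inverse ∘L (F' ∘L .inl ℝ (Rn n × Rn n) ℝ))
  have hρr : ρ x₀ = r := by
    have := hρd.continuousAt.tendsto
    exact tendsto_nhds_unique this hρt
  -- The derivative of `ρ` is read off by differentiating the constant `H(q, ρ p) = E`.
  have hρ' : ∀ ab : Rn n × Rn n, ρ' ab = -(inner ℝ (partialQ H q (r • p)) ab.1 +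
      r * inner ℝ (partialP H q (r • p)) ab.2) / inner ℝ (partialP H q (r • p)) p := by
    intro ab
    have h1 : HasFDerivAt (fun x : Rn n × Rn n => H (x.1, ρ x • x.2)) (F' ∘L
        (ContinuousLinearMap.prod (.id ℝ _) ρ')) x₀ := by
      have h2 := (hasFDerivAt_id x₀).prodMk hρd.hasFDerivAt
      have hF2 := hF.hasFDerivAt
      rw [← hρr] at hF2
      exact hF2.comp x₀ h2
    have h2 : HasFDerivAt (fun x : Rn n × Rn n => H (x.1, ρ x • x.2)) (0 : Rn n × Rn n →L[ℝ] ℝ)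
        x₀ := (hasFDerivAt_const E x₀).congr_of_eventuallyEq hρe
    have h3 := DFunLike.congr_fun (h1.unique h2) ab
    simp [F', inner_add_right, inner_smul_right] at h3
    field_simp
    linarith
  have hfin : HasStrictFDerivAt (fun x => (ρ x)⁻¹) (-(r ^ 2)⁻¹ • ρ') x₀ := by
    have := (hasStrictDerivAt_inv (x := ρ x₀) (by rw [hρr]; exact hr.ne')).comp_hasStrictFDerivAt x₀ hρd
    rw [hρr] at this
    exact this
  refine (hfin.congr_of_eventuallyEq hgauge).congr_fderiv ?_
  ext ab
  · simp [hρ', hN, radialSpeed, inner_smul_left, inner_smul_right]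
    field_simp
  · simp [hρ', hN, radialSpeed, inner_smul_left, inner_smul_right]
    field_simp

end IsClassicalHamiltonian

end Gauge

/-! ### `U` is of class `C¹` over `{V < E}`. -/

section JacobiU

variable {n : ℕ} {H : Rn n × Rn n → ℝ} {E : ℝ}

namespace IsClassicalHamiltonian

variable (hH : IsClassicalHamiltonian H)
include hH

/-- Here `‖p‖` is the gauge times `‖e‖`, with `e` in a compact energy surface. Only an upper bound
for `‖e‖` is needed, so the constant is uniform up to `{V = E}`. The reverse bound, in
`exists_bounds`, needs `‖e‖` away from `0` and hence `V < E` on all of `K`. -/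
theorem exists_norm_le_gauge {K : Set (Rn n)} (hK : IsCompact K) :
    ∃ C : ℝ, 0 < C ∧ ∀ q ∈ K, potential H q < E → ∀ p, ‖p‖ ≤ C * energyGauge H E (q, p) := by
  obtain ⟨C, hC⟩ := (hH.isCompact_energy (E := E) hK).exists_bound_of_continuousOn
    (continuous_snd.continuousOn)
  refine ⟨|C| + 1, by positivity, fun q hq hqE p => ?_⟩
  rcases eq_or_ne p 0 with rfl | hp
  · simp
  have h1 := hC (q, energyProj H E (q, p)) ⟨hq, hH.energy_energyProj hqE hp⟩
  have h2 := hH.gauge_smul_energyProj hqE (p := p)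
  have h3 := energyGauge_nonneg (H := H) (E := E) (q, p)
  have h4 : ‖p‖ = energyGauge H E (q, p) * ‖energyProj H E (q, p)‖ := by
    conv_lhs => rw [← h2]
    rw [norm_smul, Real.norm_of_nonneg h3]
  rw [h4, mul_comm]
  exact mul_le_mul_of_nonneg_right (h1.trans ((le_abs_self C).trans (by linarith))) h3

theorem exists_bounds {K : Set (Rn n)} (hK : IsCompact K) (hKE : ∀ q ∈ K, potential H q < E) :
    ∃ C : ℝ, 0 < C ∧ ∀ q ∈ K, ∀ p, energyGauge H E (q, p) ≤ C * ‖p‖ ∧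
      ‖jacobiUq H E (q, p)‖ ≤ C * ‖p‖ ^ 2 ∧ ‖jacobiUp H E (q, p)‖ ≤ C * ‖p‖ := by
  have hcpt := hH.isCompact_energy (E := E) hK
  have hne : ∀ x ∈ {x : Rn n × Rn n | x.1 ∈ K ∧ H x = E}, x.2 ≠ 0 := fun x hx =>
    ne_zero_of_energy (hKE _ hx.1) hx.2
  have hl : ∀ x ∈ {x : Rn n × Rn n | x.1 ∈ K ∧ H x = E}, radialSpeed H x ≠ 0 := fun x hx =>
    (hH.radialSpeed_pos (hne x hx)).ne'
  obtain ⟨C2, hC2⟩ := hcpt.exists_bound_of_continuousOn (f := fun x => ‖x.2‖⁻¹)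
    ((continuous_snd.norm.continuousOn).inv₀ fun x hx => norm_ne_zero_iff.2 (hne x hx))
  obtain ⟨C3, hC3⟩ := hcpt.exists_bound_of_continuousOn
    (f := fun x => (radialSpeed H x)⁻¹ • partialQ H x.1 x.2)
    ((hH.continuous_radialSpeed.continuousOn.inv₀ hl).smul hH.continuous_partialQ.continuousOn)
  obtain ⟨C4, hC4⟩ := hcpt.exists_bound_of_continuousOn
    (f := fun x => (radialSpeed H x)⁻¹ • partialP H x.1 x.2)
    ((hH.continuous_radialSpeed.continuousOn.inv₀ hl).smul hH.continuous_partialP.continuousOn)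
  refine ⟨1 + |C2| + C2 ^ 2 * |C3| + |C2| * |C4|, by positivity, fun q hq p => ?_⟩
  rcases eq_or_ne p 0 with rfl | hp
  · simp
  have hqE := hKE q hq
  have he := hH.energy_energyProj hqE hp
  have hmem : (q, energyProj H E (q, p)) ∈ {x : Rn n × Rn n | x.1 ∈ K ∧ H x = E} := ⟨hq, he⟩
  have h2 := hC2 _ hmem
  have h3 := hC3 _ hmem
  have h4 := hC4 _ hmem
  have hN := hH.energyGauge_pos hqE hp
  have hge := hH.gauge_smul_energyProj hqE (p := p)
  have hen : 0 < ‖energyProj H E (q, p)‖ := norm_pos_iff.2 (ne_zero_of_energy hqE he)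
  have hpn := norm_pos_iff.2 hp
  have hNp : energyGauge H E (q, p) ≤ |C2| * ‖p‖ := by
    have h5 : ‖p‖ = energyGauge H E (q, p) * ‖energyProj H E (q, p)‖ := by
      conv_lhs => rw [← hge]
      rw [norm_smul, Real.norm_of_nonneg hN.le]
    have h6 : energyGauge H E (q, p) = ‖energyProj H E (q, p)‖⁻¹ * ‖p‖ := by
      rw [h5]; field_simp
    rw [h6]
    have h7 : ‖energyProj H E (q, p)‖⁻¹ ≤ |C2| :=
      (le_abs_self _).trans (h2.trans (le_abs_self _))
    exact mul_le_mul_of_nonneg_right h7 hpn.le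
  have hC : ∀ a : ℝ, 0 ≤ a → a ≤ |C2| ∨ a ≤ C2 ^ 2 * |C3| ∨ a ≤ |C2| * |C4| →
      a ≤ 1 + |C2| + C2 ^ 2 * |C3| + |C2| * |C4| := by
    intro a _ h
    have i1 : 0 ≤ |C2| := abs_nonneg _
    have i2 : 0 ≤ C2 ^ 2 * |C3| := by positivity
    have i3 : 0 ≤ |C2| * |C4| := by positivity
    rcases h with h | h | h <;> linarith
  refine ⟨hNp.trans ?_, ?_, ?_⟩
  · exact mul_le_mul_of_nonneg_right (hC _ (abs_nonneg _) (Or.inl le_rfl)) hpn.le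
  · refine le_trans ?_ (mul_le_mul_of_nonneg_right
      (hC (C2 ^ 2 * |C3|) (by positivity) (Or.inr (Or.inl le_rfl))) (sq_nonneg _))
    rw [jacobiUq, div_eq_mul_inv, mul_smul, norm_smul, Real.norm_of_nonneg (jacobiU_nonneg _),
      jacobiU_eq]
    calc energyGauge H E (q, p) ^ 2 * _ ≤ (|C2| * ‖p‖) ^ 2 * |C3| := by
          gcongr
          exact h3.trans (le_abs_self _)
      _ = _ := by rw [mul_pow, sq_abs]; ring
  · refine le_trans ?_ (mul_le_mul_of_nonneg_right
      (hC (|C2| * |C4|) (by positivity) (Or.inr (Or.inr le_rfl))) hpn.le)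
    rw [jacobiUp, div_eq_mul_inv, mul_smul, norm_smul, Real.norm_of_nonneg hN.le]
    calc energyGauge H E (q, p) * _ ≤ (|C2| * ‖p‖) * |C4| := by
          gcongr
          exact h4.trans (le_abs_self _)
      _ = _ := by ring

theorem exists_compact_nhds {q : Rn n} (hq : potential H q < E) :
    ∃ K ∈ 𝓝 q, IsCompact K ∧ ∀ q' ∈ K, potential H q' < E := by
  obtain ⟨K, hK, hKs, hKc⟩ := local_compact_nhds (hH.isOpen_potential_lt.mem_nhds hq)
  exact ⟨K, hK, hKc, hKs⟩

theorem continuousAt_energyProj {q p : Rn n} (hq : potential H q < E) (hp : p ≠ 0) :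
    ContinuousAt (energyProj H E) (q, p) :=
  ((hH.hasStrictFDerivAt_energyGauge hq hp).continuousAt.inv₀
    (hH.energyGauge_pos hq hp).ne').smul continuousAt_snd

/-- Off the zero section this is the chain rule for the square of the gauge. At `p = 0`, where the
gauge need not be differentiable, `0 ≤ U ≤ C² ‖p‖²` holds uniformly for nearby `q`, so the
derivative is `0`. -/
theorem hasFDerivAt_jacobiU {q : Rn n} (hq : potential H q < E) (p : Rn n) :
    HasFDerivAt (jacobiU H E) (pairForm (jacobiUq H E (q, p)) (jacobiUp H E (q, p))) (q, p) := by
  rcases eq_or_ne p 0 with rfl | hp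
  · obtain ⟨K, hKn, hK, hKE⟩ := hH.exists_compact_nhds hq
    obtain ⟨C, hC, hb⟩ := hH.exists_bounds hK hKE
    have h0 : pairForm (jacobiUq H E (q, 0)) (jacobiUp H E (q, 0)) = 0 := by
      ext x <;> simp
    rw [h0]
    refine HasFDerivAt.of_isLittleO ?_
    have hO : (fun x : Rn n × Rn n => jacobiU H E x - jacobiU H E (q, 0) -
        (0 : Rn n × Rn n →L[ℝ] ℝ) (x - (q, 0))) =O[𝓝 (q, 0)]
        fun x => ‖x - (q, 0)‖ ^ 2 := by
      refine Asymptotics.IsBigO.of_bound (C ^ 2) ?_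
      filter_upwards [continuous_fst.continuousAt.preimage_mem_nhds hKn] with x hx
      have h1 := (hb x.1 hx x.2).1
      have h2 : ‖x.2‖ ≤ ‖x - (q, 0)‖ := by
        have := norm_snd_le (x - (q, 0))
        simpa using this
      simp only [jacobiU_zero, sub_zero, zero_apply, norm_pow, norm_norm]
      rw [Real.norm_of_nonneg (jacobiU_nonneg _), jacobiU_eq, ← mul_pow]
      have h3 := energyGauge_nonneg (H := H) (E := E) x
      gcongr
      exact h1.trans (by gcongr)
    refine hO.trans_isLittleO ?_
    have := (Asymptotics.isLittleO_pow_id (𝕜 := ℝ) (n := 2) (by norm_num)).comp_tendsto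
      (tendsto_norm_sub_self_nhdsGE (q, (0 : Rn n)) |>.mono_right nhdsWithin_le_nhds)
    exact Asymptotics.isLittleO_norm_right.1 this
  · have h1 := (hH.hasStrictFDerivAt_energyGauge hq hp).hasFDerivAt.pow 2
    refine h1.congr_fderiv ?_
    have hl := hH.radialSpeed_pos (q := q) (ne_zero_of_energy hq (hH.energy_energyProj hq hp))
    ext x
    · simp [jacobiUq, jacobiU_eq, inner_smul_left]
      field_simp
    · simp [jacobiUp, inner_smul_left]
      field_simp

theorem continuousAt_jacobiU {q : Rn n} (hq : potential H q < E) (p : Rn n) :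
    ContinuousAt (jacobiU H E) (q, p) := (hH.hasFDerivAt_jacobiU hq p).continuousAt

theorem continuousAt_jacobiUq {q : Rn n} (hq : potential H q < E) (p : Rn n) :
    ContinuousAt (jacobiUq H E) (q, p) := by
  rcases eq_or_ne p 0 with rfl | hp
  · obtain ⟨K, hKn, hK, hKE⟩ := hH.exists_compact_nhds hq
    obtain ⟨C, hC, hb⟩ := hH.exists_bounds hK hKE
    rw [ContinuousAt, jacobiUq_zero]
    refine squeeze_zero_norm' (a := fun x : Rn n × Rn n => C * ‖x.2‖ ^ 2) ?_ ?_
    · filter_upwards [continuous_fst.continuousAt.preimage_mem_nhds hKn] with x hx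
      exact (hb x.1 hx x.2).2.1
    · have : Continuous fun x : Rn n × Rn n => C * ‖x.2‖ ^ 2 := by fun_prop
      simpa using this.tendsto (q, 0)
  · have hl := hH.radialSpeed_pos (q := q) (ne_zero_of_energy hq (hH.energy_energyProj hq hp))
    have hc := continuousAt_fst.prodMk (hH.continuousAt_energyProj hq hp)
    exact ((hH.continuousAt_jacobiU hq p).div
      (hH.continuous_radialSpeed.continuousAt.comp (x := (q, p)) hc) hl.ne').smul
      (hH.continuous_partialQ.continuousAt.comp (x := (q, p)) hc)

theorem continuousAt_jacobiUp {q : Rn n} (hq : potential H q < E) (p : Rn n) :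
    ContinuousAt (jacobiUp H E) (q, p) := by
  rcases eq_or_ne p 0 with rfl | hp
  · obtain ⟨K, hKn, hK, hKE⟩ := hH.exists_compact_nhds hq
    obtain ⟨C, hC, hb⟩ := hH.exists_bounds hK hKE
    rw [ContinuousAt, jacobiUp_zero]
    refine squeeze_zero_norm' (a := fun x : Rn n × Rn n => C * ‖x.2‖) ?_ ?_
    · filter_upwards [continuous_fst.continuousAt.preimage_mem_nhds hKn] with x hx
      exact (hb x.1 hx x.2).2.2
    · have : Continuous fun x : Rn n × Rn n => C * ‖x.2‖ := by fun_prop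
      simpa using this.tendsto (q, 0)
  · have hl := hH.radialSpeed_pos (q := q) (ne_zero_of_energy hq (hH.energy_energyProj hq hp))
    have hc := continuousAt_fst.prodMk (hH.continuousAt_energyProj hq hp)
    exact ((hH.hasStrictFDerivAt_energyGauge hq hp).continuousAt.div
      (hH.continuous_radialSpeed.continuousAt.comp (x := (q, p)) hc) hl.ne').smul
      (hH.continuous_partialP.continuousAt.comp (x := (q, p)) hc)

/-- Strictness, a first-order expansion uniform in the base point, is what the envelope argument of
`hasFDerivAt_jacobiG` requires. -/
theorem hasStrictFDerivAt_jacobiU {q : Rn n} (hq : potential H q < E) (p : Rn n) :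
    HasStrictFDerivAt (jacobiU H E) (pairForm (jacobiUq H E (q, p)) (jacobiUp H E (q, p)))
      (q, p) := by
  refine hasStrictFDerivAt_of_hasFDerivAt_of_continuousAt
    (f' := fun x => pairForm (jacobiUq H E x) (jacobiUp H E x)) ?_
    ((hH.continuousAt_jacobiUq hq p).pairForm (hH.continuousAt_jacobiUp hq p))
  filter_upwards [continuous_fst.continuousAt.preimage_mem_nhds
    (hH.isOpen_potential_lt.mem_nhds hq)] with x hx
  exact hH.hasFDerivAt_jacobiU hx x.2

theorem partialP_jacobiU {q : Rn n} (hq : potential H q < E) (p : Rn n) :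
    partialP (jacobiU H E) q p = jacobiUp H E (q, p) :=
  partialP_eq_of_hasFDerivAt (hH.hasFDerivAt_jacobiU hq p)

end IsClassicalHamiltonian

end JacobiU

/-! ### Legendre duality between `U` and `G`. -/

section JacobiG

variable {n : ℕ} {H : Rn n × Rn n → ℝ} {E : ℝ}

open Classical in
/-- The inverse `p = p(q, v)` of the fibrewise Legendre map `p ↦ v = ∂U/∂p (q, p)`. -/
noncomputable def legendreInv (H : Rn n × Rn n → ℝ) (E : ℝ) (x : Rn n × Rn n) : Rn n :=
  if h : ∃ p, jacobiUp H E (x.1, p) = x.2 then h.choose else 0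

namespace IsClassicalHamiltonian

variable (hH : IsClassicalHamiltonian H)
include hH

/-- A maximizer of `⟨v, p⟩ - U(q, p)` is a critical point, which is the required equation. -/
theorem exists_jacobiUp_eq {q : Rn n} (hq : potential H q < E) (v : Rn n) :
    ∃ p, jacobiUp H E (q, p) = v := by
  obtain ⟨C, hC, hb⟩ := hH.exists_norm_le_gauge (E := E) (isCompact_singleton (x := q))
  set f : Rn n → ℝ := fun p => inner ℝ v p - jacobiU H E (q, p)
  have hd : ∀ p, HasFDerivAt f (innerSL ℝ v - innerSL ℝ (jacobiUp H E (q, p))) p := by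
    intro p
    have h1 := ((innerSL ℝ v).hasFDerivAt (x := p)).sub
      ((hH.hasFDerivAt_jacobiU hq p).comp p (hasFDerivAt_prodMk_right q p))
    exact h1.congr_fderiv (by ext a; simp)
  have hcont : Continuous f := continuous_iff_continuousAt.2 fun p => (hd p).continuousAt
  -- Outside this ball `‖p‖ > C² ‖v‖`, and `‖p‖² ≤ C² U`, so `U ≥ ‖v‖ ‖p‖`: the objective is at most
  -- its value `0` at the origin.
  obtain ⟨p, hp, hmax⟩ := (isCompact_closedBall (0 : Rn n) (C ^ 2 * ‖v‖ + 1)).exists_isMaxOn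
    ⟨0, by simp; positivity⟩ hcont.continuousOn
  have hglob : ∀ p', f p' ≤ f p := by
    intro p'
    by_cases h : p' ∈ Metric.closedBall (0 : Rn n) (C ^ 2 * ‖v‖ + 1)
    · exact hmax h
    · have h0 : f 0 ≤ f p := hmax (by simp; positivity)
      refine le_trans ?_ h0
      simp only [f, inner_zero_right, jacobiU_zero, sub_zero]
      rw [mem_closedBall_zero_iff, not_le] at h
      have h1 := hb q rfl hq p'
      have h2 : inner ℝ v p' ≤ ‖v‖ * ‖p'‖ := real_inner_le_norm v p'
      have h3 : ‖p'‖ ^ 2 ≤ C ^ 2 * jacobiU H E (q, p') := by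
        rw [jacobiU_eq, ← mul_pow]; gcongr
      have h4 : C ^ 2 * (‖v‖ * ‖p'‖) ≤ ‖p'‖ ^ 2 := by nlinarith [norm_nonneg p']
      have h5 : ‖v‖ * ‖p'‖ ≤ jacobiU H E (q, p') :=
        le_of_mul_le_mul_left (h4.trans h3) (by positivity)
      linarith
  have h0 := (show IsLocalMax f p from Eventually.of_forall hglob).hasFDerivAt_eq_zero
    (hd p)
  refine ⟨p, ?_⟩
  have h1 := DFunLike.congr_fun h0 (v - jacobiUp H E (q, p))
  simp only [sub_apply, innerSL_apply_apply, zero_apply,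
    ← inner_sub_left, inner_self_eq_zero, sub_eq_zero] at h1
  exact h1.symm

theorem jacobiUp_legendreInv {q : Rn n} (hq : potential H q < E) (v : Rn n) :
    jacobiUp H E (q, legendreInv H E (q, v)) = v := by
  have h := hH.exists_jacobiUp_eq hq v
  rw [legendreInv, dif_pos h]
  exact h.choose_spec

theorem inner_sub_jacobiU_le {q : Rn n} (hq : potential H q < E) (v p : Rn n) :
    inner ℝ v p - jacobiU H E (q, p) ≤
      inner ℝ v (legendreInv H E (q, v)) - jacobiU H E (q, legendreInv H E (q, v)) := by
  have h := (hH.jacobiU_tangent hq (legendreInv H E (q, v)) p).1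
  rw [hH.jacobiUp_legendreInv hq, inner_sub_right] at h
  linarith

/-- Injectivity of the Legendre map, from the equality case of the tangent inequality. -/
theorem legendreInv_jacobiUp {q : Rn n} (hq : potential H q < E) (p : Rn n) :
    legendreInv H E (q, jacobiUp H E (q, p)) = p := by
  refine ((hH.jacobiU_tangent hq p _).2 ?_)
  refine le_antisymm (hH.jacobiU_tangent hq p _).1 ?_
  have := hH.inner_sub_jacobiU_le hq (jacobiUp H E (q, p)) p
  rw [inner_sub_right]
  linarith

theorem jacobiG_eq_inner_sub {q : Rn n} (hq : potential H q < E) (v : Rn n) :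
    jacobiG H E (q, v) = inner ℝ v (legendreInv H E (q, v)) -
      jacobiU H E (q, legendreInv H E (q, v)) := by
  have h : IsGreatest (range fun p : Rn n => (inner ℝ v p - jacobiU H E (q, p)))
      (inner ℝ v (legendreInv H E (q, v)) - jacobiU H E (q, legendreInv H E (q, v))) :=
    ⟨⟨_, rfl⟩, by rintro _ ⟨p, rfl⟩; exact hH.inner_sub_jacobiU_le hq v p⟩
  exact h.csSup_eq

theorem inner_sub_le_jacobiG {q : Rn n} (hq : potential H q < E) (v p : Rn n) :
    inner ℝ v p - jacobiU H E (q, p) ≤ jacobiG H E (q, v) := by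
  rw [hH.jacobiG_eq_inner_sub hq]; exact hH.inner_sub_jacobiU_le hq v p

theorem inner_legendreInv {q : Rn n} (hq : potential H q < E) (v : Rn n) :
    inner ℝ v (legendreInv H E (q, v)) = 2 * jacobiU H E (q, legendreInv H E (q, v)) := by
  have := hH.inner_jacobiUp_self hq (p := legendreInv H E (q, v))
  rwa [hH.jacobiUp_legendreInv hq] at this

theorem jacobiG_eq {q : Rn n} (hq : potential H q < E) (v : Rn n) :
    jacobiG H E (q, v) = jacobiU H E (q, legendreInv H E (q, v)) := by
  rw [hH.jacobiG_eq_inner_sub hq, hH.inner_legendreInv hq]; ring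

theorem jacobiG_jacobiUp {q : Rn n} (hq : potential H q < E) (p : Rn n) :
    jacobiG H E (q, jacobiUp H E (q, p)) = jacobiU H E (q, p) := by
  rw [hH.jacobiG_eq hq, hH.legendreInv_jacobiUp hq]

theorem jacobiG_nonneg {q : Rn n} (hq : potential H q < E) (v : Rn n) :
    0 ≤ jacobiG H E (q, v) := by
  rw [hH.jacobiG_eq hq]; exact jacobiU_nonneg _

/-- From `‖p‖² ≤ C² U` and `2 U = ⟨v, p⟩ ≤ ‖v‖ ‖p‖`. The bound is uniform up to `{V = E}`, which is
why the energy of every curve of `X_y` is finite. -/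
theorem exists_jacobiG_le {K : Set (Rn n)} (hK : IsCompact K) :
    ∃ C : ℝ, 0 < C ∧ ∀ q ∈ K, potential H q < E → ∀ v,
      jacobiG H E (q, v) ≤ C * ‖v‖ ^ 2 ∧ ‖legendreInv H E (q, v)‖ ≤ C * ‖v‖ := by
  obtain ⟨C, hC, hb⟩ := hH.exists_norm_le_gauge (E := E) hK
  refine ⟨C ^ 2, by positivity, fun q hq hqE v => ?_⟩
  set p := legendreInv H E (q, v)
  have h1 := hb q hq hqE p
  have h2 := hH.inner_legendreInv hqE v
  have h3 : inner ℝ v p ≤ ‖v‖ * ‖p‖ := real_inner_le_norm v p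
  have h4 : ‖p‖ ^ 2 ≤ C ^ 2 * jacobiU H E (q, p) := by
    rw [jacobiU_eq, ← mul_pow]; gcongr
  have hU := jacobiU_nonneg (H := H) (E := E) (q, p)
  have h5 : ‖p‖ ≤ C ^ 2 * ‖v‖ := by
    by_contra! hc
    have hp : 0 < ‖p‖ := lt_of_le_of_lt (by positivity) hc
    have : C ^ 2 * jacobiU H E (q, p) ≤ C ^ 2 * (‖v‖ * ‖p‖) := by
      gcongr; linarith
    nlinarith
  refine ⟨?_, h5⟩
  rw [hH.jacobiG_eq hqE]
  have : ‖v‖ * ‖p‖ ≤ ‖v‖ * (C ^ 2 * ‖v‖) := by gcongr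
  nlinarith

/-- Coercivity. It degenerates at `{V = E}`, which confines the direct method to sublevels `{V ≤ c}`
with `c < E`. -/
theorem exists_le_jacobiG {K : Set (Rn n)} (hK : IsCompact K) (hKE : ∀ q ∈ K, potential H q < E) :
    ∃ c : ℝ, 0 < c ∧ ∀ q ∈ K, ∀ v, c * ‖v‖ ^ 2 ≤ jacobiG H E (q, v) := by
  obtain ⟨C, hC, hb⟩ := hH.exists_bounds hK hKE
  refine ⟨1 / (4 * C ^ 2), by positivity, fun q hq v => ?_⟩
  -- The test momentum `v / (2 C²)` maximizes `⟨v, p⟩ - C² ‖p‖²`, a lower bound for `⟨v, p⟩ - U`.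
  have h1 := hH.inner_sub_le_jacobiG (hKE q hq) v ((1 / (2 * C ^ 2)) • v)
  refine le_trans ?_ h1
  have h2 := (hb q hq ((1 / (2 * C ^ 2)) • v)).1
  have h3 : jacobiU H E (q, (1 / (2 * C ^ 2)) • v) ≤ (C * ‖(1 / (2 * C ^ 2)) • v‖) ^ 2 := by
    rw [jacobiU_eq]
    exact pow_le_pow_left₀ (energyGauge_nonneg _) h2 2
  rw [norm_smul, Real.norm_of_nonneg (by positivity)] at h3
  rw [inner_smul_right, real_inner_self_eq_norm_sq]
  have h4 : (C * (1 / (2 * C ^ 2) * ‖v‖)) ^ 2 = 1 / (4 * C ^ 2) * ‖v‖ ^ 2 := by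
    field_simp; ring
  have h5 : 1 / (2 * C ^ 2) * ‖v‖ ^ 2 = 2 * (1 / (4 * C ^ 2) * ‖v‖ ^ 2) := by
    field_simp; ring
  linarith

/-- The values are locally bounded, and by continuity of `jacobiUp` a cluster point `p` satisfies
`∂U/∂p(q, p) = v`, which determines it. No second derivative of `U` is involved. -/
theorem continuousAt_legendreInv {q : Rn n} (hq : potential H q < E) (v : Rn n) :
    ContinuousAt (legendreInv H E) (q, v) := by
  obtain ⟨K, hKn, hK, hKE⟩ := hH.exists_compact_nhds hq
  obtain ⟨C, hC, hb⟩ := hH.exists_jacobiG_le (E := E) hK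
  have hev : ∀ᶠ x : Rn n × Rn n in 𝓝 (q, v), x.1 ∈ K :=
    continuous_fst.continuousAt.preimage_mem_nhds hKn
  have hev2 : ∀ᶠ x : Rn n × Rn n in 𝓝 (q, v), ‖x.2‖ < ‖v‖ + 1 :=
    continuous_snd.norm.continuousAt.eventually (gt_mem_nhds (by simp))
  refine (isCompact_closedBall (0 : Rn n) (C * (‖v‖ + 1))).tendsto_nhds_of_unique_mapClusterPt
    ?_ ?_
  · filter_upwards [hev, hev2] with x h1 h2
    rw [mem_closedBall_zero_iff]
    exact (hb x.1 h1 (hKE _ h1) x.2).2.trans (by gcongr)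
  · intro p _ hp
    obtain ⟨u, hu, hup⟩ := mapClusterPt_iff_ultrafilter.1 hp
    have h1 : Tendsto (fun x : Rn n × Rn n => (x.1, legendreInv H E x)) u (𝓝 (q, p)) :=
      ((continuous_fst.tendsto (q, v)).mono_left hu).prodMk_nhds hup
    have h2 := (hH.continuousAt_jacobiUp hq p).tendsto.comp h1
    have h3 : Tendsto (fun x : Rn n × Rn n => x.2) u (𝓝 v) :=
      (continuous_snd.tendsto (q, v)).mono_left hu
    have h4 : (jacobiUp H E ∘ fun x : Rn n × Rn n => (x.1, legendreInv H E x)) =ᶠ[u]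
        fun x => x.2 := by
      filter_upwards [hu hev] with x hx
      exact hH.jacobiUp_legendreInv (hKE _ hx) x.2
    have h5 := tendsto_nhds_unique (h2.congr' h4) h3
    rw [← h5, hH.legendreInv_jacobiUp hq]

/-- Envelope theorem. Testing the maximum at each point with the optimal momentum of the other
encloses the increment of `G` between `⟨v' - v, P⟩ + U(q, P) - U(q', P)` and the same expression
with `P'`. As `P' → P`, the two have the same first-order part. -/
theorem hasFDerivAt_jacobiG {q : Rn n} (hq : potential H q < E) (v : Rn n) :
    HasFDerivAt (jacobiG H E) (pairForm (-jacobiUq H E (q, legendreInv H E (q, v)))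
      (legendreInv H E (q, v))) (q, v) := by
  set P := legendreInv H E (q, v) with hP
  have hst := (hH.hasStrictFDerivAt_jacobiU hq P).isLittleO
  have hPc := hH.continuousAt_legendreInv hq v
  have hfst : Tendsto (fun x : Rn n × Rn n => x.1) (𝓝 (q, v)) (𝓝 q) := continuous_fst.tendsto _
  have t1 : Tendsto (fun x : Rn n × Rn n => ((x.1, P), (q, P))) (𝓝 (q, v))
      (𝓝 ((q, P), (q, P))) :=
    (hfst.prodMk_nhds tendsto_const_nhds).prodMk_nhds tendsto_const_nhds
  have t2 : Tendsto (fun x : Rn n × Rn n => ((x.1, legendreInv H E x), (q, legendreInv H E x)))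
      (𝓝 (q, v)) (𝓝 ((q, P), (q, P))) :=
    (hfst.prodMk_nhds hPc.tendsto).prodMk_nhds (tendsto_const_nhds.prodMk_nhds hPc.tendsto)
  have o1 := hst.comp_tendsto t1
  have o2 := hst.comp_tendsto t2
  simp only [Function.comp_def] at o1 o2
  refine HasFDerivAt.of_isLittleO (Asymptotics.IsLittleO.of_bound fun ε hε => ?_)
  have hε' : 0 < ε / 3 := by positivity
  have hPe : ∀ᶠ x in 𝓝 (q, v), ‖legendreInv H E x - P‖ < ε / 3 := by
    have := (hPc.sub continuousAt_const).norm (f := fun x => legendreInv H E x - P)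
    have h0 : ‖legendreInv H E (q, v) - P‖ < ε / 3 := by simpa [P] using hε'
    exact this.eventually (gt_mem_nhds h0)
  filter_upwards [o1.def hε', o2.def hε', hPe,
    hfst.eventually (hH.isOpen_potential_lt.mem_nhds hq)] with x h1 h2 h3 hx
  obtain ⟨q', v'⟩ := x
  set P' := legendreInv H E (q', v') with hP'
  have hx' : potential H q' < E := hx
  have lower := hH.inner_sub_le_jacobiG hx' v' P
  have upper := hH.inner_sub_le_jacobiG hq v P'
  have e0 := hH.jacobiG_eq_inner_sub hq v
  have e1 := hH.jacobiG_eq_inner_sub hx' v'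
  rw [← hP] at e0
  rw [← hP'] at e1
  simp only [pairForm_apply, Prod.fst_sub, Prod.snd_sub, sub_self, inner_zero_right,
    add_zero, Real.norm_eq_abs] at h1 h2 ⊢
  have hn1 : ‖q' - q‖ ≤ ‖((q', v') : Rn n × Rn n) - (q, v)‖ := norm_fst_le (((q', v') : Rn n × Rn n) - (q, v))
  have hn2 : ‖v' - v‖ ≤ ‖((q', v') : Rn n × Rn n) - (q, v)‖ := norm_snd_le (((q', v') : Rn n × Rn n) - (q, v))
  have hz : ∀ a b : Rn n, ‖((q', a) : Rn n × Rn n) - (q, a)‖ = ‖q' - q‖ := by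
    intro a b; simp [Prod.norm_def]
  rw [hz P P] at h1
  rw [hz P' P'] at h2
  have i1 : |inner ℝ (v' - v) (P' - P)| ≤ ‖v' - v‖ * (ε / 3) :=
    (abs_real_inner_le_norm _ _).trans (by gcongr)
  have j1 : ‖v' - v‖ * (ε / 3) ≤ ε / 3 * ‖((q', v') : Rn n × Rn n) - (q, v)‖ := by
    rw [mul_comm]; gcongr
  have j2 : ε / 3 * ‖q' - q‖ ≤ ε / 3 * ‖((q', v') : Rn n × Rn n) - (q, v)‖ := by gcongr
  have j3 : 0 ≤ ε / 3 * ‖((q', v') : Rn n × Rn n) - (q, v)‖ := by positivity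
  simp only [inner_sub_right, inner_neg_left, real_inner_comm P,
    real_inner_comm P'] at *
  rw [abs_le] at *
  constructor <;> linarith [h1.1, h1.2, h2.1, h2.2, i1.1, i1.2]

theorem continuousAt_jacobiG {q : Rn n} (hq : potential H q < E) (v : Rn n) :
    ContinuousAt (jacobiG H E) (q, v) := (hH.hasFDerivAt_jacobiG hq v).continuousAt

theorem partialQ_jacobiG {q : Rn n} (hq : potential H q < E) (v : Rn n) :
    partialQ (jacobiG H E) q v = -jacobiUq H E (q, legendreInv H E (q, v)) :=
  partialQ_eq_of_hasFDerivAt (hH.hasFDerivAt_jacobiG hq v)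

theorem partialP_jacobiG {q : Rn n} (hq : potential H q < E) (v : Rn n) :
    partialP (jacobiG H E) q v = legendreInv H E (q, v) :=
  partialP_eq_of_hasFDerivAt (hH.hasFDerivAt_jacobiG hq v)

/-- Continuity is known only over the open set `{V < E}`; extending `f` by `0` off that set gives a
Borel function. -/
theorem aestronglyMeasurable_comp {F : Type*} [NormedAddCommGroup F]
    [SecondCountableTopology F] {f : Rn n × Rn n → F}
    (hf : ∀ q, potential H q < E → ∀ v, ContinuousAt f (q, v)) {μ : Measure ℝ} {u v : ℝ → Rn n}
    (hu : AEStronglyMeasurable u μ) (hv : AEStronglyMeasurable v μ)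
    (huE : ∀ᵐ s ∂μ, potential H (u s) < E) :
    AEStronglyMeasurable (fun s => f (u s, v s)) μ := by
  classical
  borelize F
  set S : Set (Rn n × Rn n) := {x | potential H x.1 < E}
  have hS : IsOpen S := hH.isOpen_potential_lt.preimage continuous_fst
  have hm : Measurable (S.piecewise f 0) :=
    ContinuousOn.measurable_piecewise
      (fun x hx => (hf x.1 hx x.2).continuousWithinAt) continuousOn_const hS.measurableSet
  have h1 := (hm.comp_aemeasurable (hu.aemeasurable.prodMk hv.aemeasurable)).aestronglyMeasurable
  refine h1.congr ?_
  filter_upwards [huE] with s hs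
  have : (u s, v s) ∈ S := hs
  simp [this]

end IsClassicalHamiltonian

end JacobiG

/-! ### The fundamental lemma of the calculus of variations. -/

section DuBoisReymond

variable {n : ℕ}

theorem MeasureTheory.MemLp.intervalIntegrable_Icc {F : Type*} [NormedAddCommGroup F]
    {φ : ℝ → F} {b : ℝ} (hb : 0 ≤ b)
    (h : MemLp φ 2 (volume.restrict (Icc (0 : ℝ) b))) : IntervalIntegrable φ volume 0 b :=
  (intervalIntegrable_iff_integrableOn_Icc_of_le hb).2 (h.integrable one_le_two)

theorem MeasureTheory.MemLp.integrable_real_inner {α : Type*} [MeasurableSpace α]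
    {μ : Measure α} {f g : α → Rn n} (hf : MemLp f 2 μ) (hg : MemLp g 2 μ) :
    Integrable (fun s => inner ℝ (f s) (g s)) μ := by
  refine (hf.norm.integrable_mul hg.norm).mono (hf.1.inner hg.1) (Eventually.of_forall fun s => ?_)
  simpa using norm_inner_le_norm (𝕜 := ℝ) (f s) (g s)

theorem integral_inner_primitive {A φ : ℝ → Rn n} {b : ℝ}
    (hA : IntervalIntegrable A volume 0 b) (hφ : IntervalIntegrable φ volume 0 b) :
    IntervalIntegrable (fun s => inner ℝ (A s) (∫ r in (0 : ℝ)..s, φ r) +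
      inner ℝ (∫ r in (0 : ℝ)..s, A r) (φ s)) volume 0 b ∧
    ∫ s in (0 : ℝ)..b, (inner ℝ (A s) (∫ r in (0 : ℝ)..s, φ r) +
      inner ℝ (∫ r in (0 : ℝ)..s, A r) (φ s)) =
      inner ℝ (∫ r in (0 : ℝ)..b, A r) (∫ r in (0 : ℝ)..b, φ r) := by
  have h1 := absolutelyContinuousOnInterval_add_integral hA 0
  have h2 := absolutelyContinuousOnInterval_add_integral hφ 0
  simp only [zero_add] at h1 h2
  obtain ⟨h3, h4⟩ := h1.integral_inner h2
  have hae : ∀ᵐ s : ℝ, s ∈ uIoc 0 b →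
      inner ℝ (deriv (fun s => ∫ r in (0 : ℝ)..s, A r) s) (∫ r in (0 : ℝ)..s, φ r) +
        inner ℝ (∫ r in (0 : ℝ)..s, A r) (deriv (fun s => ∫ r in (0 : ℝ)..s, φ r) s) =
      inner ℝ (A s) (∫ r in (0 : ℝ)..s, φ r) + inner ℝ (∫ r in (0 : ℝ)..s, A r) (φ s) := by
    filter_upwards [hA.ae_hasDerivAt_integral, hφ.ae_hasDerivAt_integral] with s i1 i2 hs
    have hs' := uIoc_subset_uIcc hs
    rw [(i1 hs' 0 left_mem_uIcc).deriv, (i2 hs' 0 left_mem_uIcc).deriv]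
  refine ⟨h3.congr_ae ((ae_restrict_iff' measurableSet_uIoc).2 hae), ?_⟩
  rw [← intervalIntegral.integral_congr_ae hae, h4]
  simp

/-- The lemma of du Bois-Reymond. -/
theorem ae_eq_const_add_integral {A B : ℝ → Rn n} {b : ℝ} (hb : 0 < b)
    (hA : IntervalIntegrable A volume 0 b) (hB : MemLp B 2 (volume.restrict (Icc (0 : ℝ) b)))
    (h : ∀ φ : ℝ → Rn n, MemLp φ 2 (volume.restrict (Icc (0 : ℝ) b)) →
      ∫ s in (0 : ℝ)..b, φ s = 0 →
      ∫ s in (0 : ℝ)..b, (inner ℝ (A s) (∫ r in (0 : ℝ)..s, φ r) + inner ℝ (B s) (φ s)) = 0) :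
    ∃ c, ∀ᵐ s ∂volume.restrict (Icc (0 : ℝ) b), B s = c + ∫ r in (0 : ℝ)..s, A r := by
  set Q : ℝ → Rn n := fun s => ∫ r in (0 : ℝ)..s, A r with hQ
  have hQac := absolutelyContinuousOnInterval_add_integral hA 0
  simp only [zero_add] at hQac
  have hQc : ContinuousOn Q (Icc 0 b) := by simpa [uIcc_of_le hb.le] using hQac.continuousOn
  have hQL : MemLp Q 2 (volume.restrict (Icc (0 : ℝ) b)) := by
    obtain ⟨C, hC⟩ := isCompact_Icc.exists_bound_of_continuousOn hQc
    exact MemLp.of_bound (hQc.aestronglyMeasurable measurableSet_Icc) C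
      ((ae_restrict_iff' measurableSet_Icc).2 (Eventually.of_forall hC))
  set R : ℝ → Rn n := fun s => B s - Q s
  have hR : MemLp R 2 (volume.restrict (Icc (0 : ℝ) b)) := hB.sub hQL
  have hRi := hR.intervalIntegrable_Icc hb.le
  set m : Rn n := b⁻¹ • ∫ s in (0 : ℝ)..b, R s
  -- The remainder `R = B - ∫ A` minus its mean is itself an admissible test function, and testing
  -- with it gives `∫ ‖φ‖² = 0`.
  set φ : ℝ → Rn n := fun s => R s - m
  have hφ : MemLp φ 2 (volume.restrict (Icc (0 : ℝ) b)) := hR.sub (memLp_const m)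
  have hφi := hφ.intervalIntegrable_Icc hb.le
  have hφ0 : ∫ s in (0 : ℝ)..b, φ s = 0 := by
    simp only [φ]
    rw [intervalIntegral.integral_sub hRi intervalIntegrable_const]
    simp [m, smul_smul, inv_mul_cancel₀ hb.ne']
  obtain ⟨j1, j2⟩ := integral_inner_primitive hA hφi
  rw [hφ0, inner_zero_right] at j2
  have k1 := h φ hφ hφ0
  have hinn : ∀ f : ℝ → Rn n, MemLp f 2 (volume.restrict (Icc (0 : ℝ) b)) →
      IntervalIntegrable (fun s => inner ℝ (f s) (φ s)) volume 0 b := fun f hf =>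
    (intervalIntegrable_iff_integrableOn_Icc_of_le hb.le).2 (hf.integrable_real_inner hφ)
  have iQ := hinn Q hQL
  have iB := hinn B hB
  have iA : IntervalIntegrable (fun s => inner ℝ (A s) (∫ r in (0 : ℝ)..s, φ r)) volume 0 b := by
    have := j1.sub iQ
    refine this.congr_ae (Eventually.of_forall fun s => ?_)
    simp [Q]
  rw [intervalIntegral.integral_add iA iB] at k1
  rw [intervalIntegral.integral_add iA iQ] at j2
  have l1 : ∫ s in (0 : ℝ)..b, inner ℝ (φ s) (φ s) = 0 := by
    have e : ∀ s, inner ℝ (φ s) (φ s) = inner ℝ (B s) (φ s) - inner ℝ (Q s) (φ s) -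
        inner ℝ m (φ s) := fun s => by
      simp only [← inner_sub_left]; rfl
    simp_rw [e]
    have i3 := hinn (fun _ => m) (memLp_const m)
    rw [intervalIntegral.integral_sub (iB.sub iQ) i3, intervalIntegral.integral_sub iB iQ]
    have e2 : ∫ s in (0 : ℝ)..b, inner ℝ m (φ s) = inner ℝ m (∫ s in (0 : ℝ)..b, φ s) :=
      (innerSL ℝ m).intervalIntegral_comp_comm hφi
    rw [e2, hφ0, inner_zero_right]
    linarith
  have l2 : ∀ᵐ s ∂volume.restrict (Icc (0 : ℝ) b), inner ℝ (φ s) (φ s) = 0 := by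
    rw [intervalIntegral.integral_of_le hb.le, ← integral_Icc_eq_integral_Ioc] at l1
    exact (integral_eq_zero_iff_of_nonneg (fun s => real_inner_self_nonneg)
      (hφ.integrable_real_inner hφ)).1 l1
  refine ⟨m, ?_⟩
  filter_upwards [l2] with s hs
  rw [inner_self_eq_zero] at hs
  have : B s - Q s - m = 0 := hs
  rw [sub_eq_zero, sub_eq_iff_eq_add] at this
  exact this

theorem hasDerivWithinAt_of_eq_integral {F : Type*} [NormedAddCommGroup F] [NormedSpace ℝ F]
    [CompleteSpace F] {f g : ℝ → F} (hf : ContinuousOn f (Ico 0 1)) {c : F}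
    (h : ∀ s ∈ Ico (0 : ℝ) 1, g s = c + ∫ r in (0 : ℝ)..s, f r) {s : ℝ} (hs : s ∈ Ico (0 : ℝ) 1) :
    HasDerivWithinAt g (f s) (Icc 0 1) s := by
  obtain ⟨b, hsb, hb1⟩ := exists_between hs.2
  have hb0 : 0 ≤ b := hs.1.trans hsb.le
  have hfb : ContinuousOn f (Icc 0 b) := hf.mono fun x hx => ⟨hx.1, hx.2.trans_lt hb1⟩
  -- Nothing is known of `f` at `1`; on `[0, b]` with `s < b < 1` it agrees with a function
  -- continuous on the line.
  set f' := IccExtend hb0 ((Icc 0 b).domRestrict f)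
  have hf' : Continuous f' := hfb.domRestrict.Icc_extend'
  have heq : ∀ x ∈ Icc 0 b, f' x = f x := fun x hx => by simp [f', IccExtend_of_mem _ _ hx]
  have hd : HasDerivAt (fun x => c + ∫ r in (0 : ℝ)..x, f' r) (f' s) s :=
    ((hf'.integral_hasStrictDerivAt 0 s).hasDerivAt).const_add c
  rw [heq s ⟨hs.1, hsb.le⟩] at hd
  have h2 : HasDerivWithinAt g (f s) (Icc 0 b) s := by
    have hg : ∀ x ∈ Icc 0 b, g x = c + ∫ r in (0 : ℝ)..x, f' r := by
      intro x hx
      rw [h x ⟨hx.1, hx.2.trans_lt hb1⟩]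
      congr 1
      refine intervalIntegral.integral_congr fun r hr => (heq r ?_).symm
      rw [uIcc_of_le hx.1] at hr
      exact ⟨hr.1, hr.2.trans hx.2⟩
    exact hd.hasDerivWithinAt.congr hg (hg s ⟨hs.1, hsb.le⟩)
  refine h2.mono_of_mem_nhdsWithin ?_
  have : Iio b ∈ 𝓝 s := Iio_mem_nhds hsb
  filter_upwards [mem_nhdsWithin_of_mem_nhds this, self_mem_nhdsWithin] with x h3 h4
  exact ⟨h4.1, le_of_lt h3⟩

end DuBoisReymond

/-! ### Differentiation of the energy along variations supported away from `s = 1`. -/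

section FirstVariation

variable {n : ℕ} {H : Rn n × Rn n → ℝ} {E : ℝ}

namespace IsClassicalHamiltonian

variable (hH : IsClassicalHamiltonian H)
include hH

theorem integrable_jacobiG_comp {K : Set (Rn n)} (hK : IsCompact K) {μ : Measure ℝ}
    {u v : ℝ → Rn n} (hu : AEStronglyMeasurable u μ) (hv : MemLp v 2 μ)
    (h : ∀ᵐ s ∂μ, u s ∈ K ∧ potential H (u s) < E) :
    Integrable (fun s => jacobiG H E (u s, v s)) μ := by
  obtain ⟨C, hC, hb⟩ := hH.exists_jacobiG_le (E := E) hK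
  refine (hv.norm.integrable_sq.const_mul C).mono'
    (hH.aestronglyMeasurable_comp (fun q hq v => hH.continuousAt_jacobiG hq v) hu hv.1
      (h.mono fun s hs => hs.2)) ?_
  filter_upwards [h] with s hs
  rw [Real.norm_of_nonneg (hH.jacobiG_nonneg hs.2 _)]
  exact (hb _ hs.1 hs.2 _).1

theorem memLp_legendreInv_comp {K : Set (Rn n)} (hK : IsCompact K) {μ : Measure ℝ}
    {u v : ℝ → Rn n} (hu : AEStronglyMeasurable u μ) (hv : MemLp v 2 μ)
    (h : ∀ᵐ s ∂μ, u s ∈ K ∧ potential H (u s) < E) :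
    MemLp (fun s => legendreInv H E (u s, v s)) 2 μ := by
  obtain ⟨C, hC, hb⟩ := hH.exists_jacobiG_le (E := E) hK
  refine hv.of_le_mul (c := C)
    (hH.aestronglyMeasurable_comp (fun q hq v => hH.continuousAt_legendreInv hq v) hu hv.1
      (h.mono fun s hs => hs.2)) ?_
  filter_upwards [h] with s hs
  exact (hb _ hs.1 hs.2 _).2

theorem integrable_jacobiUq_comp {K : Set (Rn n)} (hK : IsCompact K)
    (hKE : ∀ q ∈ K, potential H q < E) {μ : Measure ℝ}
    {u v : ℝ → Rn n} (hu : AEStronglyMeasurable u μ) (hv : MemLp v 2 μ)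
    (h : ∀ᵐ s ∂μ, u s ∈ K) :
    Integrable (fun s => jacobiUq H E (u s, v s)) μ := by
  obtain ⟨C, hC, hb⟩ := hH.exists_bounds hK hKE
  refine (hv.norm.integrable_sq.const_mul C).mono'
    (hH.aestronglyMeasurable_comp (fun q hq v => hH.continuousAt_jacobiUq hq v) hu hv.1
      (h.mono fun s hs => hKE _ hs)) ?_
  filter_upwards [h] with s hs
  exact (hb _ hs _).2.1

/-- Since `ξ` vanishes on `[b, 1]`, small variations move the curve only inside a compact
neighbourhood of `γ([0, b])` in `D'`. There the derivatives of `G` obey uniform bounds, whereas near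
`s = 1` the curve may approach `{V = E}`. -/
theorem integral_variation_eq_zero {D' : Set (Rn n)} (hD' : IsOpen D')
    (hE : ∀ q ∈ D', potential H q < E) {γ : ℝ → Rn n} (hγ : IsW12 γ)
    (hmem : ∀ s ∈ Ico (0 : ℝ) 1, γ s ∈ D')
    (hint : IntervalIntegrable (fun s => jacobiG H E (γ s, deriv γ s)) volume 0 1)
    (hmin : ∀ η : ℝ → Rn n, IsW12 η → η 0 = γ 0 → η 1 = γ 1 → (∀ s ∈ Ico (0 : ℝ) 1, η s ∈ D') →
      jacobiEnergy H E γ ≤ jacobiEnergy H E η)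
    {b : ℝ} (hb0 : 0 < b) (hb1 : b < 1) {ξ : ℝ → Rn n} (hξ : IsW12 ξ) (hξ0 : ξ 0 = 0)
    (hξb : ∀ s ∈ Icc b 1, ξ s = 0) :
    ∫ s in (0 : ℝ)..b, (inner ℝ (-jacobiUq H E (γ s, legendreInv H E (γ s, deriv γ s))) (ξ s) +
      inner ℝ (legendreInv H E (γ s, deriv γ s)) (deriv ξ s)) = 0 := by
  have hsub : Icc 0 b ⊆ Icc (0 : ℝ) 1 := Icc_subset_Icc_right hb1.le
  have hK₀ : IsCompact (γ '' Icc 0 b) := isCompact_Icc.image_of_continuousOn (hγ.continuousOn.mono hsub)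
  have hK₀D : γ '' Icc 0 b ⊆ D' := by
    rintro _ ⟨s, hs, rfl⟩; exact hmem s ⟨hs.1, hs.2.trans_lt hb1⟩
  obtain ⟨δ, hδ, hδD⟩ := hK₀.exists_cthickening_subset_open hD' hK₀D
  set K := Metric.cthickening δ (γ '' Icc 0 b)
  have hK : IsCompact K := hK₀.cthickening
  have hKE : ∀ q ∈ K, potential H q < E := fun q hq => hE q (hδD hq)
  obtain ⟨M, hM⟩ := isCompact_Icc.exists_bound_of_continuousOn hξ.continuousOn
  have hM0 : 0 ≤ M := (norm_nonneg _).trans (hM 0 ⟨le_rfl, zero_le_one⟩)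
  obtain ⟨C1, hC1, hb1'⟩ := hH.exists_jacobiG_le (E := E) hK
  obtain ⟨C2, hC2, hb2⟩ := hH.exists_bounds hK hKE
  -- So that `‖t ξ‖ ≤ δ` keeps the curve in the thickening and `|t| ≤ 1` bounds its velocity by `w`.
  set ε := min 1 (δ / (M + 1)) with hεdef
  have hε : 0 < ε := lt_min one_pos (by positivity)
  have hinK : ∀ s ∈ Icc 0 b, ∀ t ∈ Ioo (-ε) ε, γ s + t • ξ s ∈ K := by
    intro s hs t ht
    refine Metric.mem_cthickening_of_dist_le _ (γ s) _ _ (mem_image_of_mem γ hs) ?_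
    have h1 : |t| ≤ δ / (M + 1) := (abs_lt.2 ht).le.trans (min_le_right _ _)
    rw [dist_self_add_left, norm_smul, Real.norm_eq_abs]
    calc |t| * ‖ξ s‖ ≤ δ / (M + 1) * (M + 1) := by
          gcongr
          exact (hM s (hsub hs)).trans (by linarith)
      _ = δ := by field_simp
  set F : ℝ → ℝ → ℝ := fun t s => jacobiG H E (γ s + t • ξ s, deriv γ s + t • deriv ξ s) with hF
  set F' : ℝ → ℝ → ℝ := fun t s =>
    inner ℝ (-jacobiUq H E (γ s + t • ξ s, legendreInv H E (γ s + t • ξ s, deriv γ s + t • deriv ξ s))) (ξ s) +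
      inner ℝ (legendreInv H E (γ s + t • ξ s, deriv γ s + t • deriv ξ s)) (deriv ξ s) with hF'
  have hI : uIoc (0 : ℝ) b = Ioc 0 b := uIoc_of_le hb0.le
  have hres : volume.restrict (uIoc (0 : ℝ) b) ≤ volume.restrict (Icc (0 : ℝ) 1) := by
    rw [hI]; exact Measure.restrict_mono (Ioc_subset_Icc_self.trans hsub) le_rfl
  have hγm : AEStronglyMeasurable γ (volume.restrict (uIoc (0 : ℝ) b)) :=
    (hγ.continuousOn.aestronglyMeasurable measurableSet_Icc).mono_measure hres
  have hξm : AEStronglyMeasurable ξ (volume.restrict (uIoc (0 : ℝ) b)) :=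
    (hξ.continuousOn.aestronglyMeasurable measurableSet_Icc).mono_measure hres
  have hγL : MemLp (deriv γ) 2 (volume.restrict (uIoc (0 : ℝ) b)) := hγ.2.mono_measure hres
  have hξL : MemLp (deriv ξ) 2 (volume.restrict (uIoc (0 : ℝ) b)) := hξ.2.mono_measure hres
  have hKae : ∀ t ∈ Ioo (-ε) ε, ∀ᵐ s ∂volume.restrict (uIoc (0 : ℝ) b),
      γ s + t • ξ s ∈ K ∧ potential H (γ s + t • ξ s) < E := fun t ht => by
    rw [ae_restrict_iff' measurableSet_uIoc, hI]
    exact Eventually.of_forall fun s hs =>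
      ⟨hinK s (Ioc_subset_Icc_self hs) t ht, hKE _ (hinK s (Ioc_subset_Icc_self hs) t ht)⟩
  have h0mem : (0 : ℝ) ∈ Ioo (-ε) ε := ⟨by linarith, hε⟩
  have hFint : ∀ t ∈ Ioo (-ε) ε, Integrable (F t) (volume.restrict (uIoc (0 : ℝ) b)) :=
    fun t ht => hH.integrable_jacobiG_comp hK (hγm.add (hξm.const_smul t))
      (hγL.add (hξL.const_smul t)) (hKae t ht)
  set w : ℝ → ℝ := fun s => ‖deriv γ s‖ + ‖deriv ξ s‖
  have hwL : MemLp w 2 (volume.restrict (uIoc (0 : ℝ) b)) := hγL.norm.add hξL.norm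
  -- The dominating function comes from `‖P‖ ≤ C1 w`, `‖∂U/∂q‖ ≤ C2 ‖P‖²`, `‖ξ‖ ≤ M` and `‖ξ'‖ ≤ w`.
  have hder := intervalIntegral.hasDerivAt_integral_of_dominated_loc_of_deriv_le (μ := volume)
    (F := F) (F' := F') (x₀ := 0) (s := Ioo (-ε) ε) (a := 0) (b := b)
    (bound := fun s => (C2 * C1 ^ 2 * M + C1) * w s ^ 2)
    (Ioo_mem_nhds h0mem.1 h0mem.2)
    (by
      filter_upwards [Ioo_mem_nhds h0mem.1 h0mem.2] with t ht using (hFint t ht).1)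
    (intervalIntegrable_iff.2 (hFint 0 h0mem))
    (by
      have hP := hH.memLp_legendreInv_comp hK (hγm.add (hξm.const_smul (0 : ℝ)))
        (hγL.add (hξL.const_smul (0 : ℝ))) (hKae 0 h0mem)
      have hA := hH.integrable_jacobiUq_comp hK hKE (hγm.add (hξm.const_smul (0 : ℝ))) hP
        ((hKae 0 h0mem).mono fun s hs => hs.1)
      exact (hA.1.neg.inner hξm).add (hP.1.inner hξL.1))
    (by
      refine Eventually.of_forall fun s hs t ht => ?_
      rw [hI] at hs
      have hk := hinK s (Ioc_subset_Icc_self hs) t ht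
      have ht1 : |t| ≤ 1 := (abs_lt.2 ht).le.trans (min_le_left _ _)
      have hv : ‖deriv γ s + t • deriv ξ s‖ ≤ w s := by
        refine (norm_add_le _ _).trans ?_
        rw [norm_smul, Real.norm_eq_abs]
        have : |t| * ‖deriv ξ s‖ ≤ 1 * ‖deriv ξ s‖ := by gcongr
        simp only [w]; linarith
      have hP := (hb1' _ hk (hKE _ hk) (deriv γ s + t • deriv ξ s)).2
      have hU := (hb2 _ hk (legendreInv H E (γ s + t • ξ s, deriv γ s + t • deriv ξ s))).2.1
      have hw0 : 0 ≤ w s := by positivity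
      have hPw : ‖legendreInv H E (γ s + t • ξ s, deriv γ s + t • deriv ξ s)‖ ≤ C1 * w s :=
        hP.trans (by gcongr)
      refine (norm_add_le _ _).trans ?_
      have i1 := norm_inner_le_norm (𝕜 := ℝ) (-jacobiUq H E (γ s + t • ξ s,
        legendreInv H E (γ s + t • ξ s, deriv γ s + t • deriv ξ s))) (ξ s)
      have i2 := norm_inner_le_norm (𝕜 := ℝ)
        (legendreInv H E (γ s + t • ξ s, deriv γ s + t • deriv ξ s)) (deriv ξ s)
      rw [norm_neg] at i1
      have i3 : ‖jacobiUq H E (γ s + t • ξ s,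
          legendreInv H E (γ s + t • ξ s, deriv γ s + t • deriv ξ s))‖ * ‖ξ s‖ ≤
          C2 * (C1 * w s) ^ 2 * M := by
        gcongr
        · exact hU.trans (by gcongr)
        · exact hM s (hsub (Ioc_subset_Icc_self hs))
      have i4 : ‖legendreInv H E (γ s + t • ξ s, deriv γ s + t • deriv ξ s)‖ * ‖deriv ξ s‖ ≤
          (C1 * w s) * w s := by
        gcongr
        exact le_add_of_nonneg_left (norm_nonneg _)
      calc _ ≤ C2 * (C1 * w s) ^ 2 * M + (C1 * w s) * w s := by linarith
        _ = _ := by ring)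
    (intervalIntegrable_iff.2 (hwL.integrable_sq.const_mul _))
    (by
      refine Eventually.of_forall fun s hs t ht => ?_
      rw [hI] at hs
      have hk := hinK s (Ioc_subset_Icc_self hs) t ht
      have h1 : HasDerivAt (fun t : ℝ => (γ s + t • ξ s, deriv γ s + t • deriv ξ s))
          (ξ s, deriv ξ s) t := by
        have h2 := ((hasDerivAt_id t).smul_const (ξ s)).const_add (γ s)
        have h3 := ((hasDerivAt_id t).smul_const (deriv ξ s)).const_add (deriv γ s)
        simpa using h2.prodMk h3
      have h4 := (hH.hasFDerivAt_jacobiG (hKE _ hk) (deriv γ s + t • deriv ξ s)).comp_hasDerivAt t h1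
      exact h4.congr_deriv (by simp [F']))
  have hF0 : F 0 = fun s => jacobiG H E (γ s, deriv γ s) := by ext s; simp [F]
  -- At `b` itself `deriv ξ` need not vanish, hence the open interval.
  have htail : ∀ t, ∀ s ∈ Ioo b 1, F t s = F 0 s := by
    intro t s hs
    have h1 : ξ =ᶠ[𝓝 s] fun _ => 0 := by
      filter_upwards [Ioo_mem_nhds hs.1 hs.2] with r hr using hξb r ⟨hr.1.le, hr.2.le⟩
    have h2 : deriv ξ s = 0 := by rw [h1.deriv_eq]; simp
    simp [F, h2, h1.self_of_nhds]
  have htailae : ∀ t, ∀ᵐ s ∂volume.restrict (uIoc b 1), F t s = F 0 s := fun t => by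
    rw [uIoc_of_le hb1.le, Measure.restrict_congr_set Ioo_ae_eq_Ioc.symm,
      ae_restrict_iff' measurableSet_Ioo]
    exact Eventually.of_forall (htail t)
  have hsubint : uIcc b 1 ⊆ uIcc (0 : ℝ) 1 := by
    rw [uIcc_of_le hb1.le, uIcc_of_le zero_le_one]; exact Icc_subset_Icc_left hb0.le
  have hJ : ∀ t ∈ Ioo (-ε) ε, jacobiEnergy H E (fun s => γ s + t • ξ s) =
      (∫ s in (0 : ℝ)..b, F t s) + ∫ s in b..1, F 0 s := by
    intro t ht
    have h1 : jacobiEnergy H E (fun s => γ s + t • ξ s) = ∫ s in (0 : ℝ)..1, F t s := by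
      refine intervalIntegral.integral_congr_ae ?_
      have := (hγ.add_smul hξ t).2
      rw [Filter.EventuallyEq, ae_restrict_iff' measurableSet_Icc] at this
      filter_upwards [this] with s hs hs'
      rw [uIoc_of_le zero_le_one] at hs'
      rw [hs (Ioc_subset_Icc_self hs')]
    have i1 : IntervalIntegrable (F 0) volume b 1 := by
      rw [hF0]; exact hint.mono_set hsubint
    have i2 : IntervalIntegrable (F t) volume b 1 :=
      i1.congr_ae ((htailae t).mono fun s hs => hs.symm)
    rw [h1, ← intervalIntegral.integral_add_adjacent_intervals
      (intervalIntegrable_iff.2 (hFint t ht)) i2]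
    congr 1
    exact intervalIntegral.integral_congr_ae ((ae_restrict_iff' measurableSet_uIoc).1 (htailae t))
  have hloc : IsLocalMin (fun t => ∫ s in (0 : ℝ)..b, F t s) 0 := by
    filter_upwards [Ioo_mem_nhds h0mem.1 h0mem.2] with t ht
    have h1 := hJ t ht
    have h0 := hJ 0 h0mem
    have hle := hmin (fun s => γ s + t • ξ s) (hγ.add_smul hξ t).1 (by simp [hξ0])
      (by simp [hξb 1 ⟨hb1.le, le_rfl⟩]) (fun s hs => by
        rcases le_or_gt s b with h | h
        · exact hδD (hinK s ⟨hs.1, h⟩ t ht)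
        · simpa [hξb s ⟨h.le, hs.2.le⟩] using hmem s hs)
    simp only [zero_smul, add_zero] at h0
    have e : jacobiEnergy H E (fun s => γ s) = jacobiEnergy H E γ := rfl
    linarith
  have hfin := hloc.hasDerivAt_eq_zero hder.2
  simpa [F'] using hfin

end IsClassicalHamiltonian

end FirstVariation

/-! ### Hamilton's equations for `U` along a minimizer. -/

section Momentum

variable {n : ℕ} {H : Rn n × Rn n → ℝ} {E : ℝ}

namespace IsClassicalHamiltonian

variable (hH : IsClassicalHamiltonian H)
include hH

theorem integrable_of_mem_Ico {D' : Set (Rn n)} (hE : ∀ q ∈ D', potential H q < E) {γ : ℝ → Rn n}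
    (hγ : IsW12 γ) (hmem : ∀ s ∈ Ico (0 : ℝ) 1, γ s ∈ D') {b : ℝ} (hb1 : b < 1) :
    IntegrableOn (fun s => jacobiUq H E (γ s, legendreInv H E (γ s, deriv γ s))) (Icc 0 b) ∧
    MemLp (fun s => legendreInv H E (γ s, deriv γ s)) 2 (volume.restrict (Icc 0 b)) := by
  have hsub : Icc 0 b ⊆ Icc (0 : ℝ) 1 := Icc_subset_Icc_right hb1.le
  have hK : IsCompact (γ '' Icc 0 b) :=
    isCompact_Icc.image_of_continuousOn (hγ.continuousOn.mono hsub)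
  have hKE : ∀ q ∈ γ '' Icc 0 b, potential H q < E := by
    rintro _ ⟨s, hs, rfl⟩; exact hE _ (hmem s ⟨hs.1, hs.2.trans_lt hb1⟩)
  have hm : AEStronglyMeasurable γ (volume.restrict (Icc 0 b)) :=
    (hγ.continuousOn.mono hsub).aestronglyMeasurable measurableSet_Icc
  have hL : MemLp (deriv γ) 2 (volume.restrict (Icc 0 b)) :=
    hγ.2.mono_measure (Measure.restrict_mono hsub le_rfl)
  have hae : ∀ᵐ s ∂volume.restrict (Icc 0 b), γ s ∈ γ '' Icc 0 b := by
    rw [ae_restrict_iff' measurableSet_Icc]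
    exact Eventually.of_forall fun s hs => mem_image_of_mem γ hs
  have hP := hH.memLp_legendreInv_comp (E := E) hK hm hL (hae.mono fun s hs => ⟨hs, hKE _ hs⟩)
  exact ⟨hH.integrable_jacobiUq_comp hK hKE hm hP hae, hP⟩

/-- A mean-zero test function on `[0, b]`, extended by `0`, has a primitive vanishing on `[b, 1]`.
This is an admissible variation, so the lemma of du Bois-Reymond applies. -/
theorem ae_legendreInv_eq {D' : Set (Rn n)} (hD' : IsOpen D')
    (hE : ∀ q ∈ D', potential H q < E) {γ : ℝ → Rn n} (hγ : IsW12 γ)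
    (hmem : ∀ s ∈ Ico (0 : ℝ) 1, γ s ∈ D')
    (hint : IntervalIntegrable (fun s => jacobiG H E (γ s, deriv γ s)) volume 0 1)
    (hmin : ∀ η : ℝ → Rn n, IsW12 η → η 0 = γ 0 → η 1 = γ 1 → (∀ s ∈ Ico (0 : ℝ) 1, η s ∈ D') →
      jacobiEnergy H E γ ≤ jacobiEnergy H E η)
    {b : ℝ} (hb0 : 0 < b) (hb1 : b < 1) :
    ∃ c, ∀ᵐ s ∂volume.restrict (Icc (0 : ℝ) b), legendreInv H E (γ s, deriv γ s) =
      c + ∫ r in (0 : ℝ)..s, -jacobiUq H E (γ r, legendreInv H E (γ r, deriv γ r)) := by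
  obtain ⟨hA, hB⟩ := hH.integrable_of_mem_Ico hE hγ hmem hb1
  have hA' := (intervalIntegrable_iff_integrableOn_Icc_of_le hb0.le).2 hA
  refine ae_eq_const_add_integral hb0 hA'.neg hB fun φ hφ hφ0 => ?_
  set φ' : ℝ → Rn n := (Icc 0 b).indicator φ
  have hsub : Icc 0 b ⊆ Icc (0 : ℝ) 1 := Icc_subset_Icc_right hb1.le
  have hφ' : MemLp φ' 2 (volume.restrict (Icc (0 : ℝ) 1)) := by
    rw [memLp_indicator_iff_restrict measurableSet_Icc, Measure.restrict_restrict measurableSet_Icc,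
      inter_eq_left.2 hsub]
    exact hφ
  set ξ : ℝ → Rn n := fun s => ∫ r in (0 : ℝ)..s, φ' r
  obtain ⟨hξ, hξd⟩ := isW12_of_eq_integral (γ := ξ) hφ' (fun s _ => by simp [ξ])
  have heq : ∀ s ∈ Icc 0 b, ξ s = ∫ r in (0 : ℝ)..s, φ r := fun s hs => by
    refine intervalIntegral.integral_congr fun r hr => ?_
    rw [uIcc_of_le hs.1] at hr
    exact indicator_of_mem (show r ∈ Icc 0 b from ⟨hr.1, hr.2.trans hs.2⟩) φ
  have hφi := intervalIntegrable_of_memLp hφ'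
  have hzero : ∀ s ∈ Icc b 1, ξ s = 0 := fun s hs => by
    have i1 : IntervalIntegrable φ' volume 0 b := hφi.mono_set
      (by rw [uIcc_of_le hb0.le, uIcc_of_le zero_le_one]; exact hsub)
    have i2 : IntervalIntegrable φ' volume b s := hφi.mono_set
      (by rw [uIcc_of_le hs.1, uIcc_of_le zero_le_one]; exact Icc_subset_Icc hb0.le hs.2)
    have e1 : ξ s = ξ b + ∫ r in b..s, φ' r := by
      simp only [ξ]
      exact (intervalIntegral.integral_add_adjacent_intervals i1 i2).symm
    rw [e1, heq b ⟨hb0.le, le_rfl⟩, hφ0, zero_add]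
    rw [show (0 : Rn n) = ∫ _ in b..s, (0 : Rn n) by simp]
    refine intervalIntegral.integral_congr_ae (Eventually.of_forall fun r hr => ?_)
    rw [uIoc_of_le hs.1] at hr
    exact indicator_of_notMem (fun h : r ∈ Icc 0 b => lt_irrefl _ (hr.1.trans_le h.2)) φ
  have key := hH.integral_variation_eq_zero hD' hE hγ hmem hint hmin hb0 hb1 hξ (by simp [ξ]) hzero
  refine Eq.trans ?_ key
  refine intervalIntegral.integral_congr_ae ?_
  rw [Filter.EventuallyEq, ae_restrict_iff' measurableSet_Icc] at hξd
  filter_upwards [hξd] with s hs hs'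
  rw [uIoc_of_le hb0.le] at hs'
  have hs2 := Ioc_subset_Icc_self hs'
  rw [hs (hsub hs2), heq s hs2, show φ' s = φ s from indicator_of_mem hs2 φ]

/-- A minimizer of `𝒥` with fixed endpoints solves Hamilton's equations for `U`. -/
theorem exists_momentum {D' : Set (Rn n)} (hD' : IsOpen D')
    (hE : ∀ q ∈ D', potential H q < E) {γ : ℝ → Rn n} (hγ : IsW12 γ)
    (hmem : ∀ s ∈ Ico (0 : ℝ) 1, γ s ∈ D')
    (hint : IntervalIntegrable (fun s => jacobiG H E (γ s, deriv γ s)) volume 0 1)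
    (hmin : ∀ η : ℝ → Rn n, IsW12 η → η 0 = γ 0 → η 1 = γ 1 → (∀ s ∈ Ico (0 : ℝ) 1, η s ∈ D') →
      jacobiEnergy H E γ ≤ jacobiEnergy H E η) :
    ∃ P : ℝ → Rn n, (∀ s ∈ Ico (0 : ℝ) 1,
      HasDerivWithinAt γ (jacobiUp H E (γ s, P s)) (Icc 0 1) s ∧
      HasDerivWithinAt P (-jacobiUq H E (γ s, P s)) (Icc 0 1) s) := by
  set A : ℝ → Rn n := fun r => -jacobiUq H E (γ r, legendreInv H E (γ r, deriv γ r))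
  have hAint : ∀ b < 1, ∀ a, 0 ≤ a → a ≤ b → IntervalIntegrable A volume 0 a := fun b hb a ha hab => by
    have := (hH.integrable_of_mem_Ico hE hγ hmem hb).1.neg
    exact ((intervalIntegrable_iff_integrableOn_Icc_of_le (ha.trans hab)).2 this).mono_set
      (by rw [uIcc_of_le ha, uIcc_of_le (ha.trans hab)]; exact Icc_subset_Icc_right hab)
  have hex : ∀ b : ℝ, 0 < b → b < 1 → ∃ c, ∀ᵐ s ∂volume.restrict (Icc (0 : ℝ) b),
      legendreInv H E (γ s, deriv γ s) = c + ∫ r in (0 : ℝ)..s, A r := fun b h0 h1 =>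
    hH.ae_legendreInv_eq hD' hE hγ hmem hint hmin h0 h1
  obtain ⟨c, hc⟩ := hex (1 / 2) (by norm_num) (by norm_num)
  -- The integration constant does not depend on `b`: two of them agree because both formulas hold
  -- almost everywhere on `[0, 1/2]`.
  have hall : ∀ b : ℝ, b < 1 → ∀ᵐ s ∂volume.restrict (Icc (0 : ℝ) b),
      legendreInv H E (γ s, deriv γ s) = c + ∫ r in (0 : ℝ)..s, A r := by
    intro b hb
    have hm0 : 0 < max b (1 / 2) := lt_max_of_lt_right (by norm_num)
    obtain ⟨c', hc'⟩ := hex (max b (1 / 2)) hm0 (max_lt hb (by norm_num))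
    have h1 := ae_restrict_of_ae_restrict_of_subset
      (Icc_subset_Icc_right (le_max_right b (1 / 2))) hc'
    have hne : (ae (volume.restrict (Icc (0 : ℝ) (1 / 2)))).NeBot := by
      rw [ae_neBot]
      intro h
      have := Measure.restrict_eq_zero.1 h
      simp at this
    obtain ⟨s, hs1, hs2⟩ := (hc.and h1).exists
    have : c' = c := by
      rw [hs1] at hs2
      exact (add_right_cancel hs2).symm
    rw [this] at hc'
    exact ae_restrict_of_ae_restrict_of_subset (Icc_subset_Icc_right (le_max_left b (1 / 2))) hc'
  set P : ℝ → Rn n := fun s => c + ∫ r in (0 : ℝ)..s, A r with hP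
  have hγc : ContinuousOn γ (Ico 0 1) := hγ.continuousOn.mono Ico_subset_Icc_self
  have hPc : ContinuousOn P (Ico 0 1) := by
    intro s hs
    obtain ⟨b, hsb, hb1⟩ := exists_between hs.2
    have hb0 : 0 ≤ b := hs.1.trans hsb.le
    have h1 := (absolutelyContinuousOnInterval_add_integral (hAint b hb1 b hb0 le_rfl) c).continuousOn
    rw [uIcc_of_le hb0] at h1
    refine (h1 s ⟨hs.1, hsb.le⟩).mono_of_mem_nhdsWithin ?_
    filter_upwards [mem_nhdsWithin_of_mem_nhds (Iio_mem_nhds hsb), self_mem_nhdsWithin] with x h3 h4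
    exact ⟨h4.1, le_of_lt h3⟩
  have hpair : ContinuousOn (fun s => (γ s, P s)) (Ico 0 1) := hγc.prodMk hPc
  have hUp : ContinuousOn (fun s => jacobiUp H E (γ s, P s)) (Ico 0 1) := fun s hs =>
    (hH.continuousAt_jacobiUp (hE _ (hmem s hs)) (P s)).comp_continuousWithinAt
      (f := fun s => (γ s, P s)) (hpair s hs)
  have hUq : ContinuousOn (fun s => -jacobiUq H E (γ s, P s)) (Ico 0 1) := fun s hs =>
    ((hH.continuousAt_jacobiUq (hE _ (hmem s hs)) (P s)).comp_continuousWithinAt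
      (f := fun s => (γ s, P s)) (hpair s hs)).neg
  have hae : ∀ b ∈ Ico (0 : ℝ) 1, ∀ᵐ r : ℝ, r ∈ uIoc 0 b →
      legendreInv H E (γ r, deriv γ r) = P r ∧ r ∈ Ico (0 : ℝ) 1 := by
    intro b hb
    have := hall b hb.2
    rw [ae_restrict_iff' measurableSet_Icc] at this
    filter_upwards [this] with r hr hr'
    rw [uIoc_of_le hb.1] at hr'
    exact ⟨hr (Ioc_subset_Icc_self hr'), hr'.1.le, hr'.2.trans_lt hb.2⟩
  refine ⟨P, fun s hs => ⟨?_, ?_⟩⟩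
  · refine hasDerivWithinAt_of_eq_integral hUp (c := γ 0) (fun b hb => ?_) hs
    rw [hγ.eq_integral (Ico_subset_Icc_self hb)]
    congr 1
    refine intervalIntegral.integral_congr_ae ?_
    filter_upwards [hae b hb] with r hr hr'
    obtain ⟨h1, h2⟩ := hr hr'
    rw [← h1, hH.jacobiUp_legendreInv (hE _ (hmem r h2))]
  · refine hasDerivWithinAt_of_eq_integral hUq (c := c) (fun b hb => ?_) hs
    simp only [hP]
    congr 1
    refine intervalIntegral.integral_congr_ae ?_
    filter_upwards [hae b hb] with r hr hr'
    obtain ⟨h1, h2⟩ := hr hr'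
    simp only [A, h1]
    rfl

/-- Conservation of `U` along solutions of its Hamilton equations. -/
theorem jacobiU_const {γ P : ℝ → Rn n} (hmem : ∀ s ∈ Ico (0 : ℝ) 1, potential H (γ s) < E)
    (h : ∀ s ∈ Ico (0 : ℝ) 1,
      HasDerivWithinAt γ (jacobiUp H E (γ s, P s)) (Icc 0 1) s ∧
      HasDerivWithinAt P (-jacobiUq H E (γ s, P s)) (Icc 0 1) s) :
    ∀ s ∈ Ico (0 : ℝ) 1, jacobiU H E (γ s, P s) = jacobiU H E (γ 0, P 0) := by
  have hd : ∀ s ∈ Ico (0 : ℝ) 1,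
      HasDerivWithinAt (fun s => jacobiU H E (γ s, P s)) 0 (Icc 0 1) s := fun s hs => by
    have h1 := (hH.hasFDerivAt_jacobiU (hmem s hs) (P s)).comp_hasDerivWithinAt s
      ((h s hs).1.prodMk (h s hs).2)
    refine h1.congr_deriv ?_
    simp [real_inner_comm]
  intro s hs
  refine constant_of_has_deriv_right_zero (f := fun s => jacobiU H E (γ s, P s)) (a := 0) (b := s) (fun r hr => ?_) (fun r hr => ?_) s
    ⟨hs.1, le_rfl⟩
  · have hr' : r ∈ Ico (0 : ℝ) 1 := ⟨hr.1, hr.2.trans_lt hs.2⟩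
    exact (hd r hr').continuousWithinAt.mono (Icc_subset_Icc_right hs.2.le)
  · have hr' : r ∈ Ico (0 : ℝ) 1 := ⟨hr.1, hr.2.trans hs.2⟩
    refine (hd r hr').mono_of_mem_nhdsWithin ?_
    filter_upwards [mem_nhdsWithin_of_mem_nhds (Iio_mem_nhds hr'.2), self_mem_nhdsWithin] with x h3 h4
    exact ⟨hr'.1.trans h4, le_of_lt h3⟩

end IsClassicalHamiltonian

end Momentum

/-! ### Compactness, endpoint derivatives and inverse functions in one variable. -/

section Calculus

/-- On a compact set, a function that is negative on the zero set of `l ≥ 0` is bounded by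
`-c + C l` with `c > 0`. -/
theorem IsCompact.exists_le_neg_add_mul {X : Type*} [TopologicalSpace X] {K : Set X}
    (hK : IsCompact K) {f l : X → ℝ} (hf : Continuous f) (hl : Continuous l)
    (hl0 : ∀ x ∈ K, 0 ≤ l x) (h : ∀ x ∈ K, l x = 0 → f x < 0) :
    ∃ c C : ℝ, 0 < c ∧ 0 < C ∧ ∀ x ∈ K, f x ≤ -c + C * l x := by
  -- An increasing open cover, with `c = 1 / (m + 1)` and `C = m + 1`; the truncation `max (l x) 0`
  -- keeps it increasing where `l` is negative off `K`.
  obtain ⟨m, hm⟩ := hK.elim_directed_cover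
    (fun m : ℕ => {x | f x < -((m : ℝ) + 1)⁻¹ + ((m : ℝ) + 1) * max (l x) 0})
    (fun m => isOpen_lt hf (by fun_prop)) (fun x hx => by
      rw [mem_iUnion]
      rcases (hl0 x hx).eq_or_lt with h0 | h0
      · obtain ⟨m, hm⟩ := exists_nat_one_div_lt (neg_pos.2 (h x hx h0.symm))
        refine ⟨m, ?_⟩
        simp only [mem_ofPred_eq, ← h0, max_self, mul_zero, add_zero]
        rw [one_div] at hm
        linarith
      · obtain ⟨m, hm⟩ := exists_nat_gt ((f x + 1) / l x)
        refine ⟨m, ?_⟩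
        rw [div_lt_iff₀ h0] at hm
        simp only [mem_ofPred_eq, max_eq_left h0.le]
        have : ((m : ℝ) + 1)⁻¹ ≤ 1 := inv_le_one_of_one_le₀ (by linarith [m.cast_nonneg (α := ℝ)])
        nlinarith)
    (directed_of_isDirected_le fun i j hij x hx => by
      simp only [mem_ofPred_eq] at hx ⊢
      have hij' : (i : ℝ) ≤ j := by exact_mod_cast hij
      have h1 : ((j : ℝ) + 1)⁻¹ ≤ ((i : ℝ) + 1)⁻¹ := by gcongr
      have h2 : ((i : ℝ) + 1) * max (l x) 0 ≤ ((j : ℝ) + 1) * max (l x) 0 := by gcongr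
      linarith)
  refine ⟨((m : ℝ) + 1)⁻¹, (m : ℝ) + 1, by positivity, by positivity, fun x hx => ?_⟩
  have := hm hx
  simp only [mem_ofPred_eq, max_eq_left (hl0 x hx)] at this
  exact this.le

theorem hasDerivWithinAt_right_endpoint {F : Type*} [NormedAddCommGroup F] [NormedSpace ℝ F]
    {f f' : ℝ → F} {T : ℝ} (hT : 0 < T) (hf : ContinuousOn f (Icc 0 T))
    (hf' : ContinuousOn f' (Icc 0 T))
    (h : ∀ t ∈ Ico 0 T, HasDerivWithinAt f (f' t) (Icc 0 T) t) :
    ∀ t ∈ Icc 0 T, HasDerivWithinAt f (f' t) (Icc 0 T) t := by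
  intro t ht
  rcases ht.2.lt_or_eq with h1 | rfl
  · exact h t ⟨ht.1, h1⟩
  have hd : ∀ s ∈ Ioo 0 t, HasDerivAt f (f' s) s := fun s hs =>
    (h s ⟨hs.1.le, hs.2⟩).hasDerivAt (Icc_mem_nhds hs.1 hs.2)
  have hmem : Ioo 0 t ∈ 𝓝[<] t := Ioo_mem_nhdsLT hT
  refine (hasDerivWithinAt_Iic_of_tendsto_deriv (s := Ioo 0 t)
    (fun s hs => (hd s hs).differentiableAt.differentiableWithinAt)
    ((hf t ht).mono Ioo_subset_Icc_self) hmem ?_).mono Icc_subset_Iic_self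
  have h2 : Tendsto f' (𝓝[<] t) (𝓝 (f' t)) :=
    (hf' t ht).mono_left (nhdsWithin_le_of_mem (mem_of_superset hmem Ioo_subset_Icc_self))
  refine h2.congr' ?_
  filter_upwards [hmem] with s hs using (hd s hs).deriv.symm

/-- No derivative is assumed at `a`: in the applications the density `w` may become infinite or zero
there. -/
theorem exists_inverse_of_deriv_pos {a : ℝ} (ha : 0 < a) {τ w : ℝ → ℝ}
    (hc : ContinuousOn τ (Icc 0 a)) (h0 : τ 0 = 0)
    (hd : ∀ s ∈ Ico 0 a, HasDerivWithinAt τ (w s) (Icc 0 a) s) (hw : ∀ s ∈ Ico 0 a, 0 < w s) :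
    0 < τ a ∧ ∃ σ : ℝ → ℝ, BijOn σ (Icc 0 (τ a)) (Icc 0 a) ∧ StrictMonoOn σ (Icc 0 (τ a)) ∧
      ContinuousOn σ (Icc 0 (τ a)) ∧ σ 0 = 0 ∧ σ (τ a) = a ∧
      (∀ s ∈ Icc 0 a, τ s ∈ Icc 0 (τ a) ∧ σ (τ s) = s) ∧
      ∀ t ∈ Ico 0 (τ a), σ t ∈ Ico 0 a ∧
        HasDerivWithinAt σ (w (σ t))⁻¹ (Icc 0 (τ a)) t := by
  have hmono : StrictMonoOn τ (Icc 0 a) := by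
    refine strictMonoOn_of_deriv_pos (convex_Icc 0 a) hc fun s hs => ?_
    rw [interior_Icc] at hs
    rw [((hd s ⟨hs.1.le, hs.2⟩).hasDerivAt (Icc_mem_nhds hs.1 hs.2)).deriv]
    exact hw s ⟨hs.1.le, hs.2⟩
  have h0m : (0 : ℝ) ∈ Icc 0 a := ⟨le_rfl, ha.le⟩
  have ham : a ∈ Icc 0 a := ⟨ha.le, le_rfl⟩
  have hT : 0 < τ a := by rw [← h0]; exact hmono h0m ham ha
  have hmaps : MapsTo τ (Icc 0 a) (Icc 0 (τ a)) := fun s hs =>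
    ⟨by rw [← h0]; exact hmono.monotoneOn h0m hs hs.1, hmono.monotoneOn hs ham hs.2⟩
  have hsurj : SurjOn τ (Icc 0 a) (Icc 0 (τ a)) := by
    have := intermediate_value_Icc ha.le hc
    rwa [h0] at this
  have hbij : BijOn τ (Icc 0 a) (Icc 0 (τ a)) := ⟨hmaps, hmono.injOn, hsurj⟩
  set σ := Function.invFunOn τ (Icc 0 a)
  have hinv : InvOn σ τ (Icc 0 a) (Icc 0 (τ a)) := hbij.invOn_invFunOn
  have hσmaps : MapsTo σ (Icc 0 (τ a)) (Icc 0 a) := hsurj.mapsTo_invFunOn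
  have hσbij : BijOn σ (Icc 0 (τ a)) (Icc 0 a) := BijOn.symm hinv.symm hbij
  have hσmono : StrictMonoOn σ (Icc 0 (τ a)) := fun t ht t' ht' htt' => by
    rw [← hmono.lt_iff_lt (hσmaps ht) (hσmaps ht'), hinv.2 ht, hinv.2 ht']
    exact htt'
  have hσ0 : σ 0 = 0 := by have := hinv.1 h0m; rwa [h0] at this
  have hσa : σ (τ a) = a := hinv.1 ham
  have hσc : ContinuousOn σ (Icc 0 (τ a)) := by
    intro t ht
    refine isCompact_Icc.tendsto_nhds_of_unique_mapClusterPt (s := Icc 0 a)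
      (eventually_mem_nhdsWithin.mono fun x hx => hσmaps hx) fun y hy hcl => ?_
    obtain ⟨u, hu, huy⟩ := mapClusterPt_iff_ultrafilter.1 hcl
    have hev : ∀ᶠ x in (u : Filter ℝ), x ∈ Icc 0 (τ a) := hu eventually_mem_nhdsWithin
    have h1 : Tendsto σ u (𝓝[Icc 0 a] y) :=
      tendsto_nhdsWithin_iff.2 ⟨huy, hev.mono fun x hx => hσmaps hx⟩
    have h2 : Tendsto (τ ∘ σ) u (𝓝 (τ y)) := (hc y hy).tendsto.comp h1
    have h3 : Tendsto (τ ∘ σ) u (𝓝 t) := by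
      have : Tendsto id (u : Filter ℝ) (𝓝 t) := hu.trans nhdsWithin_le_nhds
      exact this.congr' (hev.mono fun x hx => (hinv.2 hx).symm)
    rw [← tendsto_nhds_unique h2 h3]
    exact (hinv.1 hy).symm
  refine ⟨hT, σ, hσbij, hσmono, hσc, hσ0, hσa, fun s hs => ⟨hmaps hs, hinv.1 hs⟩,
    fun t ht => ?_⟩
  have htI : t ∈ Icc 0 (τ a) := Ico_subset_Icc_self ht
  have hst : σ t ∈ Ico 0 a := by
    refine ⟨(hσmaps htI).1, ?_⟩
    rw [← hσa]
    exact hσmono htI ⟨hT.le, le_rfl⟩ ht.2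
  refine ⟨hst, ?_⟩
  rw [hasDerivWithinAt_iff_tendsto_slope]
  have h1 := hasDerivWithinAt_iff_tendsto_slope.1 (hd (σ t) hst)
  have h2 : Tendsto σ (𝓝[Icc 0 (τ a) \ {t}] t) (𝓝[Icc 0 a \ {σ t}] (σ t)) := by
    refine tendsto_nhdsWithin_iff.2 ⟨((hσc t htI).mono sdiff_subset).tendsto, ?_⟩
    filter_upwards [self_mem_nhdsWithin] with x hx
    exact ⟨hσmaps hx.1, fun h => hx.2 (hσmono.injOn hx.1 htI h)⟩
  refine ((h1.comp h2).inv₀ (hw _ hst).ne').congr' ?_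
  filter_upwards [self_mem_nhdsWithin] with x hx
  simp only [Function.comp_apply, slope_def_field, inv_div, hinv.2 hx.1, hinv.2 htI]

end Calculus

/-! ### The time change to trajectories of `H`, and the bound on total time. -/

section Reparametrization

variable {n : ℕ} {H : Rn n × Rn n → ℝ} {E : ℝ} {D : Set (Rn n)}

theorem IsPotentialWell.mem_frontier (hD : IsPotentialWell H E D) {q : Rn n}
    (hq : q ∈ closure D) (h : potential H q = E) : q ∈ frontier D := by
  rw [hD.isOpen.frontier_eq]
  exact ⟨hq, fun h' => (hD.lt_of_mem q h').ne h⟩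

theorem IsPotentialWell.mem_of_lt (hD : IsPotentialWell H E D) {q : Rn n}
    (hq : q ∈ closure D) (h : potential H q < E) : q ∈ D := by
  by_contra h'
  exact h.ne (hD.eq_of_mem_frontier q (by rw [hD.isOpen.frontier_eq]; exact ⟨hq, h'⟩))

namespace IsClassicalHamiltonian

variable (hH : IsClassicalHamiltonian H)
include hH

omit hH in
theorem partialQ_zero (q : Rn n) : partialQ H q 0 = gradient (potential H) q := rfl

omit hH in
theorem fderiv_potential_apply (q a : Rn n) :
    fderiv ℝ (potential H) q a = inner ℝ (gradient (potential H) q) a := by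
  rw [gradient, InnerProductSpace.toDual_symm_apply]

theorem contDiff_fderiv_potential : ContDiff ℝ 1 (fderiv ℝ (potential H)) :=
  hH.contDiff_potential.fderiv_right (by norm_num)

/-- The left side is the derivative of `dV(q)[p]` along the Hamiltonian flow. If `radialSpeed`
vanishes then `e = 0` and `q ∈ ∂D`, where the expression is `-‖∇V‖² < 0`; compactness does the rest.
This is where `∇V ≠ 0` on `∂D` enters. -/
theorem exists_force_bound (hD : IsPotentialWell H E D) (hc : IsCompact (closure D)) :
    ∃ c C : ℝ, 0 < c ∧ 0 < C ∧ ∀ q ∈ closure D, ∀ e, H (q, e) = E →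
      fderiv ℝ (fderiv ℝ (potential H)) q (partialP H q e) e -
        fderiv ℝ (potential H) q (partialQ H q e) ≤ -c + C * radialSpeed H (q, e) := by
  have hV2 : Continuous (fderiv ℝ (fderiv ℝ (potential H))) :=
    hH.contDiff_fderiv_potential.continuous_fderiv (by norm_num)
  have hV1 : Continuous (fderiv ℝ (potential H)) := hH.contDiff_fderiv_potential.continuous
  have hf : Continuous fun x : Rn n × Rn n =>
      fderiv ℝ (fderiv ℝ (potential H)) x.1 (partialP H x.1 x.2) x.2 -
        fderiv ℝ (potential H) x.1 (partialQ H x.1 x.2) :=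
    (((hV2.comp continuous_fst).clm_apply hH.continuous_partialP).clm_apply continuous_snd).sub
      ((hV1.comp continuous_fst).clm_apply hH.continuous_partialQ)
  obtain ⟨c, C, hc0, hC0, h⟩ := (hH.isCompact_energy (E := E) hc).exists_le_neg_add_mul hf
    hH.continuous_radialSpeed (fun x _ => hH.radialSpeed_nonneg x) (by
      rintro ⟨q, e⟩ ⟨hq, he⟩ hl
      have he0 : e = 0 := by
        by_contra h
        exact (hH.radialSpeed_pos h).ne' hl
      subst he0
      have hq' : q ∈ frontier D := hD.mem_frontier hq he
      have hg := hD.gradient_ne_zero q hq'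
      simp only [map_zero, zero_sub]
      rw [partialQ_zero, fderiv_potential_apply, real_inner_self_eq_norm_sq, neg_lt_zero]
      have := norm_pos_iff.2 hg
      positivity)
  exact ⟨c, C, hc0, hC0, fun q hq e he => h (q, e) ⟨hq, he⟩⟩

/-- A solution of Hamilton's equations for `U` with `U = k²`, seen as a solution of Hamilton's
equations for `H` up to a change of time with density `w`. -/
structure TimeChange (H : Rn n × Rn n → ℝ) (E k : ℝ) (γ e : ℝ → Rn n) (w : ℝ → ℝ) : Prop where
  continuousOn : ContinuousOn e (Icc 0 1)
  integrable : IntervalIntegrable w volume 0 1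
  energy : ∀ s ∈ Icc (0 : ℝ) 1, H (γ s, e s) = E
  pos : ∀ s ∈ Ico (0 : ℝ) 1, 0 < w s
  mul_eq : ∀ s ∈ Ico (0 : ℝ) 1, w s * radialSpeed H (γ s, e s) = k
  deriv_q : ∀ s ∈ Ico (0 : ℝ) 1, HasDerivWithinAt γ (w s • partialP H (γ s) (e s)) (Icc 0 1) s
  deriv_p : ∀ s ∈ Ico (0 : ℝ) 1, HasDerivWithinAt e (-(w s • partialQ H (γ s) (e s))) (Icc 0 1) s
  deriv_time : ∀ s ∈ Ico (0 : ℝ) 1,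
    HasDerivWithinAt (fun s => ∫ r in (0 : ℝ)..s, w r) (w s) (Icc 0 1) s

/-- The central estimate. By homogeneity `e = P / k` has energy `E`, and Hamilton's equations for
`U` are those for `H` multiplied by `w = k / l`. The constant `C₀` depends on neither the curve nor
`k`; this uniformity gives compactness of the approximating trajectories. -/
theorem exists_timeChange (hD : IsPotentialWell H E D) (hc : IsCompact (closure D)) :
    ∃ C₀ : ℝ, 0 < C₀ ∧ ∀ (γ P : ℝ → Rn n) (k : ℝ), 0 < k → ContinuousOn γ (Icc 0 1) →
      (∀ s ∈ Ico (0 : ℝ) 1, γ s ∈ D) →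
      (∀ s ∈ Ico (0 : ℝ) 1,
        HasDerivWithinAt γ (jacobiUp H E (γ s, P s)) (Icc 0 1) s ∧
        HasDerivWithinAt P (-jacobiUq H E (γ s, P s)) (Icc 0 1) s) →
      (∀ s ∈ Ico (0 : ℝ) 1, jacobiU H E (γ s, P s) = k ^ 2) →
      ∃ e : ℝ → Rn n, ∃ w : ℝ → ℝ, TimeChange H E k γ e w ∧
        ∫ s in (0 : ℝ)..1, w s ≤ C₀ * (k + 1) ∧ ∀ s ∈ Ico (0 : ℝ) 1, P s = k • e s := by
  obtain ⟨c, C, hc0, hC0, hforce⟩ := hH.exists_force_bound hD hc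
  have hcpt := hH.isCompact_energy (E := E) hc
  have hV1 : Continuous (fderiv ℝ (potential H)) := hH.contDiff_fderiv_potential.continuous
  obtain ⟨M, hM⟩ := hcpt.exists_bound_of_continuousOn
    (f := fun x : Rn n × Rn n => fderiv ℝ (potential H) x.1 x.2)
    ((hV1.comp continuous_fst).clm_apply continuous_snd).continuousOn
  obtain ⟨M', hM'⟩ := hcpt.exists_bound_of_continuousOn
    (f := fun x : Rn n × Rn n => partialQ H x.1 x.2) hH.continuous_partialQ.continuousOn
  refine ⟨(C + 2 * |M|) / c, by positivity, fun γ P k hk hγc hγD hder hU => ?_⟩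
  set e₀ : ℝ → Rn n := fun s => k⁻¹ • P s
  set w : ℝ → ℝ := fun s => k / radialSpeed H (γ s, e₀ s)
  have hVE : ∀ s ∈ Ico (0 : ℝ) 1, potential H (γ s) < E := fun s hs => hD.lt_of_mem _ (hγD s hs)
  have hgauge : ∀ s ∈ Ico (0 : ℝ) 1, energyGauge H E (γ s, P s) = k := fun s hs => by
    have h1 := hU s hs
    rw [jacobiU_eq] at h1
    exact (pow_left_inj₀ (energyGauge_nonneg _) hk.le two_ne_zero).1 h1
  have hproj : ∀ s ∈ Ico (0 : ℝ) 1, energyProj H E (γ s, P s) = e₀ s := fun s hs => by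
    simp only [energyProj, hgauge s hs, e₀]
  have hP0 : ∀ s ∈ Ico (0 : ℝ) 1, P s ≠ 0 := fun s hs h0 => by
    have := hgauge s hs
    rw [h0, energyGauge_zero] at this
    exact hk.ne this
  have hen : ∀ s ∈ Ico (0 : ℝ) 1, H (γ s, e₀ s) = E := fun s hs => by
    rw [← hproj s hs]; exact hH.energy_energyProj (hVE s hs) (hP0 s hs)
  have hl : ∀ s ∈ Ico (0 : ℝ) 1, 0 < radialSpeed H (γ s, e₀ s) := fun s hs =>
    hH.radialSpeed_pos (ne_zero_of_energy (hVE s hs) (hen s hs))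
  have hw : ∀ s ∈ Ico (0 : ℝ) 1, 0 < w s := fun s hs => div_pos hk (hl s hs)
  have hwl : ∀ s ∈ Ico (0 : ℝ) 1, w s * radialSpeed H (γ s, e₀ s) = k := fun s hs =>
    div_mul_cancel₀ k (hl s hs).ne'
  have hdq : ∀ s ∈ Ico (0 : ℝ) 1,
      HasDerivWithinAt γ (w s • partialP H (γ s) (e₀ s)) (Icc 0 1) s := fun s hs => by
    have h1 := (hder s hs).1
    simp only [jacobiUp, hproj s hs, hgauge s hs] at h1
    exact h1
  have hdp : ∀ s ∈ Ico (0 : ℝ) 1,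
      HasDerivWithinAt e₀ (-(w s • partialQ H (γ s) (e₀ s))) (Icc 0 1) s := fun s hs => by
    have h1 := (hder s hs).2.const_smul k⁻¹
    simp only [jacobiUq, hproj s hs, hU s hs] at h1
    refine h1.congr_deriv ?_
    rw [smul_neg, smul_smul]
    congr 2
    simp only [w]
    field_simp
  have hγc' : ContinuousOn γ (Ico 0 1) := hγc.mono Ico_subset_Icc_self
  have he₀c : ContinuousOn e₀ (Ico 0 1) := fun s hs =>
    (hdp s hs).continuousWithinAt.mono Ico_subset_Icc_self
  have hpair : ContinuousOn (fun s => (γ s, e₀ s)) (Ico 0 1) := hγc'.prodMk he₀c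
  have hwc : ContinuousOn w (Ico 0 1) :=
    continuousOn_const.div (hH.continuous_radialSpeed.comp_continuousOn hpair)
      fun s hs => (hl s hs).ne'
  have hdt : ∀ s ∈ Ico (0 : ℝ) 1,
      HasDerivWithinAt (fun s => ∫ r in (0 : ℝ)..s, w r) (w s) (Icc 0 1) s := fun s hs =>
    hasDerivWithinAt_of_eq_integral hwc (c := 0) (fun s _ => (zero_add _).symm) hs
  have hmemE : ∀ s ∈ Ico (0 : ℝ) 1,
      (γ s, e₀ s) ∈ {x : Rn n × Rn n | x.1 ∈ closure D ∧ H x = E} := fun s hs =>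
    ⟨subset_closure (hγD s hs), hen s hs⟩
  set β : ℝ → ℝ := fun s => fderiv ℝ (potential H) (γ s) (e₀ s)
  have hβ : ∀ s ∈ Ico (0 : ℝ) 1, |β s| ≤ |M| := fun s hs =>
    (hM _ (hmemE s hs)).trans (le_abs_self _)
  have hdβ : ∀ s ∈ Ico (0 : ℝ) 1, HasDerivWithinAt β
      (w s * (fderiv ℝ (fderiv ℝ (potential H)) (γ s) (partialP H (γ s) (e₀ s)) (e₀ s) -
        fderiv ℝ (potential H) (γ s) (partialQ H (γ s) (e₀ s)))) (Icc 0 1) s := fun s hs => by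
    have h1 := ((hH.contDiff_fderiv_potential.differentiable (by norm_num)
      (γ s)).hasFDerivAt.comp_hasDerivWithinAt s (hdq s hs)).clm_apply (hdp s hs)
    refine h1.congr_deriv ?_
    simp
    ring
  have hbound : ∀ b ∈ Ico (0 : ℝ) 1, ∫ r in (0 : ℝ)..b, w r ≤ (C + 2 * |M|) / c * (k + 1) := by
    intro b hb
    -- By `exists_force_bound` and `w l = k`, `β' ≤ w (-c + C l) = -c w + C k`. Since `|β| ≤ |M|`,
    -- integration bounds `c ∫ w` by `C k + 2 |M|`.
    have hanti : AntitoneOn (fun s => c * (∫ r in (0 : ℝ)..s, w r) + β s - C * k * s) (Icc 0 b) := by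
      have hd : ∀ s ∈ Ico (0 : ℝ) 1, HasDerivWithinAt
          (fun s => c * (∫ r in (0 : ℝ)..s, w r) + β s - C * k * s) (c * w s +
            (w s * (fderiv ℝ (fderiv ℝ (potential H)) (γ s) (partialP H (γ s) (e₀ s)) (e₀ s) -
            fderiv ℝ (potential H) (γ s) (partialQ H (γ s) (e₀ s)))) - C * k * 1) (Icc 0 1) s :=
        fun s hs => (((hdt s hs).const_mul c).add (hdβ s hs)).sub
          ((hasDerivWithinAt_id s _).const_mul (C * k))
      refine antitoneOn_of_deriv_nonpos (convex_Icc 0 b) (fun s hs => ?_) (fun s hs => ?_)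
        fun s hs => ?_
      · exact (hd s ⟨hs.1, hs.2.trans_lt hb.2⟩).continuousWithinAt.mono
          (Icc_subset_Icc_right hb.2.le)
      · rw [interior_Icc] at hs
        exact ((hd s ⟨hs.1.le, hs.2.trans hb.2⟩).hasDerivAt
          (Icc_mem_nhds hs.1 (hs.2.trans hb.2))).differentiableAt.differentiableWithinAt
      · rw [interior_Icc] at hs
        have hs' : s ∈ Ico (0 : ℝ) 1 := ⟨hs.1.le, hs.2.trans hb.2⟩
        rw [((hd s hs').hasDerivAt (Icc_mem_nhds hs.1 (hs.2.trans hb.2))).deriv]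
        have h1 := mul_le_mul_of_nonneg_left
          (hforce _ (subset_closure (hγD s hs')) _ (hen s hs')) (hw s hs').le
        have h2 := hwl s hs'
        have h3 : w s * (-c + C * radialSpeed H (γ s, e₀ s)) = -(c * w s) + C * k := by
          rw [← h2]; ring
        linarith
    have h1 := hanti ⟨le_rfl, hb.1⟩ ⟨hb.1, le_rfl⟩ hb.1
    simp only [intervalIntegral.integral_same, mul_zero, zero_add, sub_zero] at h1
    have h2 := abs_le.1 (hβ b hb)
    have h3 := abs_le.1 (hβ 0 ⟨le_rfl, one_pos⟩)
    have h4 : C * k * b ≤ C * k * 1 := by gcongr; exact hb.2.le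
    rw [div_mul_eq_mul_div, le_div_iff₀ hc0]
    nlinarith [abs_nonneg M]
  -- Integrability up to `1`, where `w` may blow up, follows from the uniform bounds on `[0, b]` as
  -- `b → 1`.
  have hwint : IntervalIntegrable w volume 0 1 := by
    rw [intervalIntegrable_iff_integrableOn_Ioc_of_le zero_le_one]
    have hbi : ∀ i : ℕ, 1 - ((i : ℝ) + 1)⁻¹ ∈ Ico (0 : ℝ) 1 := fun i => by
      have h1 : (0 : ℝ) < ((i : ℝ) + 1)⁻¹ := by positivity
      have h2 : ((i : ℝ) + 1)⁻¹ ≤ 1 := inv_le_one_of_one_le₀ (by linarith [i.cast_nonneg (α := ℝ)])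
      exact ⟨by linarith, by linarith⟩
    refine integrableOn_Ioc_of_intervalIntegral_norm_bounded_right (l := atTop)
      (b := fun i : ℕ => 1 - ((i : ℝ) + 1)⁻¹) (I := (C + 2 * |M|) / c * (k + 1))
      (fun i => ?_) ?_ (Eventually.of_forall fun i => ?_)
    · have : ContinuousOn w (Icc 0 (1 - ((i : ℝ) + 1)⁻¹)) :=
        hwc.mono fun x hx => ⟨hx.1, hx.2.trans_lt (hbi i).2⟩
      exact this.integrableOn_Icc.mono_set Ioc_subset_Icc_self
    · have := (tendsto_one_div_add_atTop_nhds_zero_nat (𝕜 := ℝ)).const_sub 1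
      simpa using this
    · refine le_trans (le_of_eq ?_) (hbound _ (hbi i))
      rw [intervalIntegral.integral_of_le (hbi i).1]
      refine setIntegral_congr_fun measurableSet_Ioc fun x hx => ?_
      exact Real.norm_of_nonneg (hw x ⟨hx.1.le, hx.2.trans_lt (hbi i).2⟩).le
  have hm : ∀ {F : Type} [NormedAddCommGroup F] [SecondCountableTopology F] {f : ℝ → F},
      ContinuousOn f (Ico 0 1) → AEStronglyMeasurable f (volume.restrict (uIoc (0 : ℝ) 1)) := by
    intro F _ _ f hf
    rw [uIoc_of_le zero_le_one, Measure.restrict_congr_set Ico_ae_eq_Ioc.symm]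
    exact hf.aestronglyMeasurable measurableSet_Ico
  have hpint : IntervalIntegrable (fun s => -(w s • partialQ H (γ s) (e₀ s))) volume 0 1 := by
    refine (hwint.const_mul |M'|).mono_fun (hm (hwc.smul
      (hH.continuous_partialQ.comp_continuousOn hpair)).neg) ?_
    have : ∀ᵐ s ∂volume.restrict (Ico (0 : ℝ) 1), ‖-(w s • partialQ H (γ s) (e₀ s))‖ ≤
        ‖|M'| * w s‖ := by
      rw [ae_restrict_iff' measurableSet_Ico]
      refine Eventually.of_forall fun s hs => ?_
      rw [norm_neg, norm_smul, norm_mul, Real.norm_eq_abs |M'|, abs_abs, mul_comm]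
      gcongr
      exact (hM' _ (hmemE s hs)).trans (le_abs_self _)
    rwa [uIoc_of_le zero_le_one, Measure.restrict_congr_set Ico_ae_eq_Ioc.symm]
  -- The value of `e₀` at `1` carries no information, so it is replaced by the limit from the left,
  -- written as an integral.
  set e : ℝ → Rn n := fun s => e₀ 0 + ∫ r in (0 : ℝ)..s, -(w r • partialQ H (γ r) (e₀ r)) with he
  have hec : ContinuousOn e (Icc 0 1) := by
    have := (absolutelyContinuousOnInterval_add_integral hpint (e₀ 0)).continuousOn
    rwa [uIcc_of_le zero_le_one] at this
  have hee : ∀ s ∈ Ico (0 : ℝ) 1, e s = e₀ s := fun s hs => by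
    have := intervalIntegral.integral_eq_sub_of_hasDerivAt_of_le hs.1
      (he₀c.mono fun x hx => ⟨hx.1, hx.2.trans_lt hs.2⟩)
      (fun x hx => (hdp x ⟨hx.1.le, hx.2.trans hs.2⟩).hasDerivAt
        (Icc_mem_nhds hx.1 (hx.2.trans hs.2)))
      (hpint.mono_set (by
        rw [uIcc_of_le hs.1, uIcc_of_le zero_le_one]; exact Icc_subset_Icc_right hs.2.le))
    simp only [he, this, add_sub_cancel]
  refine ⟨e, w, ⟨hec, hwint, ?_, hw, ?_, ?_, ?_, hdt⟩, ?_, ?_⟩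
  · have h1 : EqOn (fun s => H (γ s, e s)) (fun _ => E) (Ico 0 1) := fun s hs => by
      simp only [hee s hs, hen s hs]
    exact h1.of_subset_closure (hH.contDiff.continuous.comp_continuousOn (hγc.prodMk hec))
      continuousOn_const Ico_subset_Icc_self (by rw [closure_Ico zero_ne_one])
  · intro s hs; rw [hee s hs]; exact hwl s hs
  · intro s hs; rw [hee s hs]; exact hdq s hs
  · intro s hs
    rw [hee s hs]
    refine (hdp s hs).congr_of_eventuallyEq ?_ (hee s hs)
    filter_upwards [self_mem_nhdsWithin, mem_nhdsWithin_of_mem_nhds (Iio_mem_nhds hs.2)] with x h1 h2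
    exact hee x ⟨h1.1, h2⟩
  · have hcont := (absolutelyContinuousOnInterval_add_integral hwint 0).continuousOn
    rw [uIcc_of_le zero_le_one] at hcont
    simp only [zero_add] at hcont
    have h1 : Tendsto (fun s => ∫ r in (0 : ℝ)..s, w r) (𝓝[Ico 0 1] 1)
        (𝓝 (∫ r in (0 : ℝ)..1, w r)) :=
      ((hcont 1 ⟨zero_le_one, le_rfl⟩).mono Ico_subset_Icc_self).tendsto
    have hne : (𝓝[Ico (0 : ℝ) 1] 1).NeBot := by
      rw [← mem_closure_iff_nhdsWithin_neBot, closure_Ico zero_ne_one]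
      exact ⟨zero_le_one, le_rfl⟩
    refine le_of_tendsto h1 ?_
    filter_upwards [self_mem_nhdsWithin] with s hs using hbound s hs
  · intro s hs
    rw [hee s hs]
    simp only [e₀, smul_inv_smul₀ hk.ne']

/-- After the change of time, the curve solves Hamilton's equations up to its final point. -/
theorem TimeChange.exists_solution {k : ℝ} (hk : 0 < k) {γ e : ℝ → Rn n} {w : ℝ → ℝ}
    (hγ : ContinuousOn γ (Icc 0 1)) (h : TimeChange H E k γ e w) :
    0 < ∫ s in (0 : ℝ)..1, w s ∧ ∃ σ : ℝ → ℝ,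
      BijOn σ (Icc 0 (∫ s in (0 : ℝ)..1, w s)) (Icc 0 1) ∧
      StrictMonoOn σ (Icc 0 (∫ s in (0 : ℝ)..1, w s)) ∧ σ 0 = 0 ∧
      σ (∫ s in (0 : ℝ)..1, w s) = 1 ∧
      (∀ t ∈ Ico 0 (∫ s in (0 : ℝ)..1, w s), σ t ∈ Ico (0 : ℝ) 1) ∧
      (∀ t ∈ Icc 0 (∫ s in (0 : ℝ)..1, w s), HasDerivWithinAt σ
        (radialSpeed H (γ (σ t), e (σ t)) / k) (Icc 0 (∫ s in (0 : ℝ)..1, w s)) t) ∧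
      IsHamiltonSolution H E (∫ s in (0 : ℝ)..1, w s) (fun t => γ (σ t)) (fun t => e (σ t)) := by
  set τ : ℝ → ℝ := fun s => ∫ r in (0 : ℝ)..s, w r
  have hcont : ContinuousOn τ (Icc 0 1) := by
    have := (absolutelyContinuousOnInterval_add_integral h.integrable 0).continuousOn
    rw [uIcc_of_le zero_le_one] at this
    simpa only [zero_add] using this
  obtain ⟨hT, σ, hbij, hmono, hσc, hσ0, hσT, -, hσd⟩ :=
    exists_inverse_of_deriv_pos one_pos hcont (by simp [τ]) h.deriv_time h.pos
  have e1 : τ 1 = ∫ s in (0 : ℝ)..1, w s := rfl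
  rw [← e1]
  set T := τ 1
  have hqc : ContinuousOn (fun t => γ (σ t)) (Icc 0 T) := hγ.comp hσc hbij.mapsTo
  have hpc : ContinuousOn (fun t => e (σ t)) (Icc 0 T) := h.continuousOn.comp hσc hbij.mapsTo
  -- Written as `l / k`, the derivative of `σ` extends continuously to `t = T`, even if `w` blows
  -- up. This makes `σ` of class `C¹` on the closed interval.
  have hinv : ∀ s ∈ Ico (0 : ℝ) 1, (w s)⁻¹ = radialSpeed H (γ s, e s) / k := fun s hs => by
    rw [← h.mul_eq s hs]
    have hw := h.pos s hs
    have hl : radialSpeed H (γ s, e s) ≠ 0 := by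
      intro h0
      have := h.mul_eq s hs
      rw [h0, mul_zero] at this
      exact hk.ne this
    field_simp
  refine ⟨hT, σ, hbij, hmono, hσ0, hσT, fun t ht => (hσd t ht).1, ?_, ?_, ?_, ?_⟩
  · refine hasDerivWithinAt_right_endpoint hT hσc
      ((hH.continuous_radialSpeed.comp_continuousOn (hqc.prodMk hpc)).div_const k) fun t ht => ?_
    exact (hσd t ht).2.congr_deriv (hinv _ (hσd t ht).1)
  · refine hasDerivWithinAt_right_endpoint hT hqc
      (hH.continuous_partialP.comp_continuousOn (hqc.prodMk hpc)) fun t ht => ?_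
    have h1 := (h.deriv_q _ (hσd t ht).1).scomp t (hσd t ht).2 hbij.mapsTo
    refine h1.congr_deriv ?_
    rw [smul_smul, inv_mul_cancel₀ (h.pos _ (hσd t ht).1).ne', one_smul]
  · refine hasDerivWithinAt_right_endpoint hT hpc
      (f' := fun t => -partialQ H (γ (σ t)) (e (σ t)))
      (hH.continuous_partialQ.comp_continuousOn (hqc.prodMk hpc)).neg fun t ht => ?_
    have h1 := (h.deriv_p _ (hσd t ht).1).scomp t (hσd t ht).2 hbij.mapsTo
    refine h1.congr_deriv ?_
    rw [smul_neg, smul_smul, inv_mul_cancel₀ (h.pos _ (hσd t ht).1).ne', one_smul]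
  · exact fun t ht => h.energy _ (hbij.mapsTo ht)

end IsClassicalHamiltonian

end Reparametrization

/-! ### Regularity and first variation of minimizers. -/

section Minimizers

variable {n : ℕ} {H : Rn n × Rn n → ℝ} {E : ℝ} {D : Set (Rn n)}

namespace IsClassicalHamiltonian

variable (hH : IsClassicalHamiltonian H)
include hH

theorem jacobiUp_of_energy {q e : Rn n} (hq : potential H q < E) (he : H (q, e) = E) {c : ℝ}
    (hc : 0 < c) :
    jacobiUp H E (q, c • e) = (c / radialSpeed H (q, e)) • partialP H q e := by
  rw [jacobiUp, hH.energyProj_of_energy hq he hc, energyGauge_smul hc.le,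
    hH.energyGauge_of_energy hq he, mul_one]

theorem jacobiU_of_energy {q e : Rn n} (hq : potential H q < E) (he : H (q, e) = E) {c : ℝ}
    (hc : 0 < c) : jacobiU H E (q, c • e) = c ^ 2 := by
  rw [jacobiU_eq, energyGauge_smul hc.le, hH.energyGauge_of_energy hq he, mul_one]

/-- The velocity `c ∂H/∂p` is `∂U/∂p` at `c l e`, where `U = (c l)²`. With `c = 1`, `radialSpeed` is
the Jacobi length per unit of Hamiltonian time. -/
theorem jacobiG_partialP {q e : Rn n} (hq : potential H q < E) (he : H (q, e) = E) {c : ℝ}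
    (hc : 0 < c) :
    jacobiG H E (q, c • partialP H q e) = (c * radialSpeed H (q, e)) ^ 2 := by
  have hl := hH.radialSpeed_pos (q := q) (ne_zero_of_energy hq he)
  have h1 := hH.jacobiUp_of_energy hq he (mul_pos hc hl)
  rw [mul_div_cancel_right₀ _ hl.ne'] at h1
  rw [← h1, hH.jacobiG_jacobiUp hq, hH.jacobiU_of_energy hq he (mul_pos hc hl)]

theorem intervalIntegrable_jacobiG {K : Set (Rn n)} (hK : IsCompact K) {γ : ℝ → Rn n}
    (hγ : IsW12 γ) (hγK : ∀ s ∈ Ico (0 : ℝ) 1, γ s ∈ K ∧ potential H (γ s) < E) :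
    IntervalIntegrable (fun s => jacobiG H E (γ s, deriv γ s)) volume 0 1 := by
  rw [intervalIntegrable_iff_integrableOn_Icc_of_le zero_le_one]
  refine hH.integrable_jacobiG_comp hK (hγ.continuousOn.aestronglyMeasurable measurableSet_Icc)
    hγ.2 ?_
  rw [Measure.restrict_congr_set Ico_ae_eq_Icc.symm, ae_restrict_iff' measurableSet_Ico]
  exact Eventually.of_forall hγK

theorem jacobiEnergy_nonneg {γ : ℝ → Rn n}
    (hγE : ∀ s ∈ Ico (0 : ℝ) 1, potential H (γ s) < E) : 0 ≤ jacobiEnergy H E γ := by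
  rw [jacobiEnergy, intervalIntegral.integral_of_le zero_le_one,
    Measure.restrict_congr_set Ico_ae_eq_Ioc.symm]
  exact setIntegral_nonneg measurableSet_Ico fun s hs => hH.jacobiG_nonneg (hγE s hs) _

omit hH in
theorem jacobiEnergy_eq_of_Ioo {γ : ℝ → Rn n} {c : ℝ}
    (h : ∀ s ∈ Ioo (0 : ℝ) 1, jacobiG H E (γ s, deriv γ s) = c) : jacobiEnergy H E γ = c := by
  rw [jacobiEnergy, intervalIntegral.integral_of_le zero_le_one,
    Measure.restrict_congr_set Ioo_ae_eq_Ioc.symm, setIntegral_congr_fun measurableSet_Ioo h]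
  simp

/-- Minimizers with fixed endpoints have constant speed `k`, and a time change. -/
theorem exists_speed (hDE : ∀ q ∈ D, potential H q < E) {γ : ℝ → Rn n} (hγ : IsW12 γ)
    {D' : Set (Rn n)} (hD' : IsOpen D') (hD'D : D' ⊆ D) (hne : γ 0 ≠ γ 1)
    (hmem : ∀ s ∈ Ico (0 : ℝ) 1, γ s ∈ D')
    (hint : IntervalIntegrable (fun s => jacobiG H E (γ s, deriv γ s)) volume 0 1)
    (hmin : ∀ η : ℝ → Rn n, IsW12 η → η 0 = γ 0 → η 1 = γ 1 → (∀ s ∈ Ico (0 : ℝ) 1, η s ∈ D') →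
      jacobiEnergy H E γ ≤ jacobiEnergy H E η) :
    ∃ (P : ℝ → Rn n) (k : ℝ), 0 < k ∧ jacobiEnergy H E γ = k ^ 2 ∧
      (∀ s ∈ Ico (0 : ℝ) 1,
        HasDerivWithinAt γ (jacobiUp H E (γ s, P s)) (Icc 0 1) s ∧
        HasDerivWithinAt P (-jacobiUq H E (γ s, P s)) (Icc 0 1) s) ∧
      ∀ s ∈ Ico (0 : ℝ) 1, jacobiU H E (γ s, P s) = k ^ 2 := by
  have hE : ∀ q ∈ D', potential H q < E := fun q hq => hDE q (hD'D hq)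
  obtain ⟨P, hP⟩ := hH.exists_momentum hD' hE hγ hmem hint hmin
  have hconst := hH.jacobiU_const (fun s hs => hE _ (hmem s hs)) hP
  have hd : ∀ s ∈ Ioo (0 : ℝ) 1, HasDerivAt γ (jacobiUp H E (γ s, P s)) s := fun s hs =>
    (hP s ⟨hs.1.le, hs.2⟩).1.hasDerivAt (Icc_mem_nhds hs.1 hs.2)
  set k := energyGauge H E (γ 0, P 0) with hkdef
  have hk2 : jacobiU H E (γ 0, P 0) = k ^ 2 := jacobiU_eq _
  have hk0 : 0 ≤ k := energyGauge_nonneg _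
  refine ⟨P, k, hk0.lt_of_ne ?_, ?_, hP, fun s hs => (hconst s hs).trans hk2⟩
  -- If `k = 0` then `P = 0`, so `γ' = 0` and the endpoints would coincide.
  · intro h0
    have hP0 : ∀ s ∈ Ico (0 : ℝ) 1, P s = 0 := fun s hs => by
      by_contra hne
      have h1 := hconst s hs
      rw [hk2, ← h0, jacobiU_eq] at h1
      have := hH.energyGauge_pos (hE _ (hmem s hs)) hne
      simp at h1
      linarith
    refine hne (constant_of_has_deriv_right_zero (f := γ) (a := 0) (b := 1) hγ.continuousOn
      (fun s hs => ?_) 1 ⟨zero_le_one, le_rfl⟩).symm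
    have h1 := (hP s hs).1
    rw [hP0 s hs, jacobiUp_zero] at h1
    refine h1.mono_of_mem_nhdsWithin ?_
    filter_upwards [mem_nhdsWithin_of_mem_nhds (Iio_mem_nhds hs.2), self_mem_nhdsWithin] with x h3 h4
    exact ⟨hs.1.trans h4, le_of_lt h3⟩
  · refine jacobiEnergy_eq_of_Ioo fun s hs => ?_
    have hs' : s ∈ Ico (0 : ℝ) 1 := ⟨hs.1.le, hs.2⟩
    rw [(hd s hs).deriv, hH.jacobiG_jacobiUp (hE _ (hmem s hs')), hconst s hs', hk2]

/-- Integrability of `w` gives absolute continuity up to `s = 1`, so that test curves need not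
vanish near `1`. -/
theorem TimeChange.absolutelyContinuous {k : ℝ} {γ e : ℝ → Rn n} {w : ℝ → ℝ}
    (hγ : ContinuousOn γ (Icc 0 1)) (h : TimeChange H E k γ e w) :
    AbsolutelyContinuousOnInterval e 0 1 := by
  have hc : ContinuousOn (fun s => partialQ H (γ s) (e s)) (uIcc 0 1) := by
    rw [uIcc_of_le zero_le_one]
    exact hH.continuous_partialQ.comp_continuousOn (hγ.prodMk h.continuousOn)
  have hi : IntervalIntegrable (fun s => -(w s • partialQ H (γ s) (e s))) volume 0 1 :=
    (h.integrable.smul_continuousOn hc).neg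
  refine (absolutelyContinuousOnInterval_add_integral hi (e 0)).congr fun s hs => ?_
  rw [uIcc_of_le zero_le_one] at hs
  have := intervalIntegral.integral_eq_sub_of_hasDerivAt_of_le hs.1
      (h.continuousOn.mono (Icc_subset_Icc_right hs.2))
      (fun x hx => (h.deriv_p x ⟨hx.1.le, hx.2.trans_le hs.2⟩).hasDerivAt
        (Icc_mem_nhds hx.1 (hx.2.trans_le hs.2)))
      (hi.mono_set (by
        rw [uIcc_of_le hs.1, uIcc_of_le zero_le_one]; exact Icc_subset_Icc_right hs.2))
  rw [this, add_sub_cancel]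

/-- Almost everywhere the integrand is `k` times the derivative of `⟨e, ξ⟩`, and the boundary terms
vanish with `ξ`. The energy is not differentiated near `s = 1`, where `∂G/∂q` may be singular. -/
theorem firstVariation_eq_zero {γ P e : ℝ → Rn n} {k : ℝ} {w : ℝ → ℝ} (hk : 0 < k)
    (hγ : ContinuousOn γ (Icc 0 1)) (hVE : ∀ s ∈ Ico (0 : ℝ) 1, potential H (γ s) < E)
    (hP : ∀ s ∈ Ico (0 : ℝ) 1,
        HasDerivWithinAt γ (jacobiUp H E (γ s, P s)) (Icc 0 1) s ∧
        HasDerivWithinAt P (-jacobiUq H E (γ s, P s)) (Icc 0 1) s)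
    (h : TimeChange H E k γ e w) (hPe : ∀ s ∈ Ico (0 : ℝ) 1, P s = k • e s)
    {ξ : ℝ → Rn n} (hξ : IsW12Zero ξ) :
    IntervalIntegrable (firstVariation H E γ ξ) volume 0 1 ∧
      ∫ s in (0 : ℝ)..1, firstVariation H E γ ξ s = 0 := by
  obtain ⟨h1, h2⟩ := (TimeChange.absolutelyContinuous hH hγ h).integral_inner hξ.1.1
  rw [hξ.2.1, hξ.2.2, inner_zero_right, inner_zero_right, sub_zero] at h2
  have hae : ∀ᵐ s ∂volume.restrict (uIoc (0 : ℝ) 1),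
      k * (inner ℝ (deriv e s) (ξ s) + inner ℝ (e s) (deriv ξ s)) = firstVariation H E γ ξ s := by
    rw [uIoc_of_le zero_le_one, Measure.restrict_congr_set Ioo_ae_eq_Ioc.symm,
      ae_restrict_iff' measurableSet_Ioo]
    refine Eventually.of_forall fun s hs => ?_
    have hs' : s ∈ Ico (0 : ℝ) 1 := ⟨hs.1.le, hs.2⟩
    have hn : Icc (0 : ℝ) 1 ∈ 𝓝 s := Icc_mem_nhds hs.1 hs.2
    have d1 := ((hP s hs').1.hasDerivAt hn).deriv
    have d2 : HasDerivAt e (k⁻¹ • -jacobiUq H E (γ s, P s)) s := by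
      refine (((hP s hs').2.hasDerivAt hn).const_smul k⁻¹).congr_of_eventuallyEq ?_
      filter_upwards [Ioo_mem_nhds hs.1 hs.2] with r hr
      simp [hPe r ⟨hr.1.le, hr.2⟩, smul_smul, inv_mul_cancel₀ hk.ne']
    rw [firstVariation, hH.partialQ_jacobiG (hVE s hs'), hH.partialP_jacobiG (hVE s hs'), d1,
      hH.legendreInv_jacobiUp (hVE s hs'), d2.deriv, inner_smul_left, mul_add]
    simp only [conj_trivial]
    rw [mul_inv_cancel_left₀ hk.ne']
    congr 1
    rw [hPe s hs', inner_smul_left]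
    simp
  refine ⟨(h1.const_mul k).congr_ae hae, ?_⟩
  rw [← intervalIntegral.integral_congr_ae ((ae_restrict_iff' measurableSet_uIoc).1 hae),
    intervalIntegral.integral_const_mul, h2, mul_zero]

/-- Minimality is needed only among curves with the same endpoints. -/
theorem minimizer_properties (hD : IsPotentialWell H E D) (hc : IsCompact (closure D))
    {γ : ℝ → Rn n} (hγ : IsW12 γ) (hmem : ∀ s ∈ Ico (0 : ℝ) 1, γ s ∈ D) (h1 : γ 1 ∈ frontier D)
    (hmin : ∀ η : ℝ → Rn n, IsW12 η → η 0 = γ 0 → η 1 = γ 1 → (∀ s ∈ Ico (0 : ℝ) 1, η s ∈ D) →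
      jacobiEnergy H E γ ≤ jacobiEnergy H E η) :
    (∀ ξ : ℝ → Rn n, IsW12Zero ξ →
        IntervalIntegrable (firstVariation H E γ ξ) volume 0 1 ∧
        ∫ s in (0 : ℝ)..1, firstVariation H E γ ξ s = 0) ∧
      ∃ T : ℝ, 0 < T ∧ ∃ σ : ℝ → ℝ,
        BijOn σ (Icc 0 T) (Icc 0 1) ∧ StrictMonoOn σ (Icc 0 T) ∧
        ContDiffOn ℝ 1 σ (Icc 0 T) ∧
        (∀ t ∈ Ico 0 T, 0 < derivWithin σ (Icc 0 T) t) ∧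
        ∃ q p : ℝ → Rn n,
          (∀ t, q t = γ (σ t)) ∧
          IsHamiltonSolution H E T q p ∧
          q 0 = γ 0 ∧ q T ∈ frontier D ∧
          ∀ t ∈ Ico 0 T,
            0 < jacobiG H E (q t, derivWithin q (Icc 0 T) t) ∧
            legendreMap H E (q t, p t) =
              (q t, (Real.sqrt (jacobiG H E (q t, derivWithin q (Icc 0 T) t)))⁻¹ •
                derivWithin q (Icc 0 T) t) := by
  have hVE : ∀ s ∈ Ico (0 : ℝ) 1, potential H (γ s) < E := fun s hs => hD.lt_of_mem _ (hmem s hs)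
  have h0 : γ 0 ∈ D := hmem 0 ⟨le_rfl, one_pos⟩
  have hne : γ 0 ≠ γ 1 := fun h => by
    rw [← h, hD.isOpen.frontier_eq] at h1
    exact h1.2 h0
  have hint := hH.intervalIntegrable_jacobiG hc hγ
    fun s hs => ⟨subset_closure (hmem s hs), hVE s hs⟩
  obtain ⟨P, k, hk, -, hP, hU⟩ :=
    hH.exists_speed hD.lt_of_mem hγ hD.isOpen subset_rfl hne hmem hint hmin
  obtain ⟨C₀, -, hC₀⟩ := hH.exists_timeChange hD hc
  obtain ⟨e, w, htc, -, hPe⟩ := hC₀ γ P k hk hγ.continuousOn hmem hP hU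
  refine ⟨fun ξ hξ => hH.firstVariation_eq_zero hk hγ.continuousOn hVE hP htc hPe hξ, ?_⟩
  obtain ⟨hT, σ, hbij, hmono, hσ0, hσT, hσI, hσd, hsol⟩ :=
    TimeChange.exists_solution hH hk hγ.continuousOn htc
  set T := ∫ s in (0 : ℝ)..1, w s
  have hu : UniqueDiffOn ℝ (Icc 0 T) := uniqueDiffOn_Icc hT
  have hlt : ∀ t ∈ Ico 0 T, potential H (γ (σ t)) < E := fun t ht => hVE _ (hσI t ht)
  have hen : ∀ t ∈ Ico 0 T, H (γ (σ t), e (σ t)) = E := fun t ht =>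
    hsol.energy t (Ico_subset_Icc_self ht)
  have hl : ∀ t ∈ Ico 0 T, 0 < radialSpeed H (γ (σ t), e (σ t)) := fun t ht =>
    hH.radialSpeed_pos (ne_zero_of_energy (hlt t ht) (hen t ht))
  have hqc : ContinuousOn (fun t => γ (σ t)) (Icc 0 T) := fun t ht =>
    (hsol.deriv_q t ht).continuousWithinAt
  have hpc : ContinuousOn (fun t => e (σ t)) (Icc 0 T) := fun t ht =>
    (hsol.deriv_p t ht).continuousWithinAt
  refine ⟨T, hT, σ, hbij, hmono, ?_, fun t ht => ?_, fun t => γ (σ t), fun t => e (σ t),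
    fun _ => rfl, hsol, by simp only [hσ0], by simp only [hσT]; exact h1, fun t ht => ?_⟩
  · rw [show (1 : WithTop ℕ∞) = 0 + 1 by norm_num, contDiffOn_succ_iff_derivWithin hu]
    refine ⟨fun t ht => (hσd t ht).differentiableWithinAt, by simp, contDiffOn_zero.2 ?_⟩
    refine ContinuousOn.congr ((hH.continuous_radialSpeed.comp_continuousOn
      (hqc.prodMk hpc)).div_const k) fun t ht => ?_
    exact (hσd t ht).derivWithin (hu t ht)
  · rw [(hσd t (Ico_subset_Icc_self ht)).derivWithin (hu t (Ico_subset_Icc_self ht))]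
    exact div_pos (hl t ht) hk
  · have hI := Ico_subset_Icc_self ht
    rw [(hsol.deriv_q t hI).derivWithin (hu t hI)]
    have hG := hH.jacobiG_partialP (hlt t ht) (hen t ht) one_pos
    rw [one_smul, one_mul] at hG
    rw [hG, Real.sqrt_sq (hl t ht).le]
    refine ⟨pow_pos (hl t ht) 2, ?_⟩
    have hUp := hH.jacobiUp_of_energy (hlt t ht) (hen t ht) one_pos
    rw [one_smul, one_div] at hUp
    simp only [legendreMap]
    rw [hH.partialP_jacobiU (hlt t ht), hUp]

end IsClassicalHamiltonian

end Minimizers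

/-! ### Weak convergence in `L²`. -/

section WeakCompactness

variable {n : ℕ}

theorem inner_toLp {α : Type*} [MeasurableSpace α] {μ : Measure α} {f g : α → Rn n}
    (hf : MemLp f 2 μ) (hg : MemLp g 2 μ) :
    inner ℝ (hf.toLp f) (hg.toLp g) = ∫ x, inner ℝ (f x) (g x) ∂μ := by
  rw [L2.inner_def]
  refine integral_congr_ae ?_
  filter_upwards [hf.coeFn_toLp, hg.coeFn_toLp] with x h1 h2
  rw [h1, h2]

/-- Bounded sequences of `L²` have weakly convergent subsequences. -/
theorem exists_weak_subseq {μ : Measure ℝ} [IsFiniteMeasure μ] {v : ℕ → ℝ → Rn n}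
    (hv : ∀ k, MemLp (v k) 2 μ) {M : ℝ} (hM : ∀ k, ∫ s, ‖v k s‖ ^ 2 ∂μ ≤ M) :
    ∃ w : ℝ → Rn n, MemLp w 2 μ ∧ ∃ φ : ℕ → ℕ, StrictMono φ ∧ ∀ g : ℝ → Rn n, MemLp g 2 μ →
      Tendsto (fun k => ∫ s, inner ℝ (v (φ k) s) (g s) ∂μ) atTop
        (𝓝 (∫ s, inner ℝ (w s) (g s) ∂μ)) := by
  set X := Lp (Rn n) 2 μ
  have : Fact ((2 : ENNReal) ≠ ⊤) := ⟨ENNReal.ofNat_ne_top⟩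
  set f : ℕ → X := fun k => (hv k).toLp (v k)
  have hf : ∀ k, ‖f k‖ ≤ Real.sqrt M := fun k => by
    refine Real.le_sqrt_of_sq_le ?_
    rw [← real_inner_self_eq_norm_sq, inner_toLp (hv k) (hv k)]
    simpa only [real_inner_self_eq_norm_sq] using hM k
  -- Sequential Banach–Alaoglu in the dual, transported to `L²` by the Riesz isomorphism.
  obtain ⟨a, -, φ, hφ, ha⟩ := WeakDual.isSeqCompact_closedBall ℝ X 0 (Real.sqrt M)
    (x := fun k => StrongDual.toWeakDual (InnerProductSpace.toDual ℝ X (f k))) fun k => by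
      have : ‖InnerProductSpace.toDual ℝ X (f k)‖ ≤ Real.sqrt M := by
        rw [LinearIsometryEquiv.norm_map]; exact hf k
      simpa using this
  set b : X := (InnerProductSpace.toDual ℝ X).symm (WeakDual.toStrongDual a)
  have hb := Lp.memLp b
  refine ⟨b, hb, φ, hφ, fun g hg => ?_⟩
  have h1 := ((WeakDual.eval_continuous (hg.toLp g)).tendsto a).comp ha
  have h2 : ∀ k, ∫ s, inner ℝ (v (φ k) s) (g s) ∂μ = inner ℝ (f (φ k)) (hg.toLp g) := fun k =>
    (inner_toLp _ _).symm
  have h3 : ∫ s, inner ℝ (b s) (g s) ∂μ = inner ℝ b (hg.toLp g) := by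
    rw [← inner_toLp hb hg, Lp.toLp_coeFn]
  simp_rw [h2, h3]
  have h4 : inner ℝ b (hg.toLp g) = a (hg.toLp g) := InnerProductSpace.toDual_symm_apply
  rw [h4]
  exact h1

/-- Test against the indicator of `(0, s]` times a vector: weak convergence of derivatives gives
pointwise convergence of curves. -/
theorem tendsto_integral_of_weak {v : ℕ → ℝ → Rn n} {w : ℝ → Rn n}
    (hv : ∀ k, MemLp (v k) 2 (volume.restrict (Icc (0 : ℝ) 1)))
    (hw : MemLp w 2 (volume.restrict (Icc (0 : ℝ) 1)))
    (h : ∀ g : ℝ → Rn n, MemLp g 2 (volume.restrict (Icc (0 : ℝ) 1)) →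
      Tendsto (fun k => ∫ s in Icc (0 : ℝ) 1, inner ℝ (v k s) (g s)) atTop
        (𝓝 (∫ s in Icc (0 : ℝ) 1, inner ℝ (w s) (g s)))) {s : ℝ} (hs : s ∈ Icc (0 : ℝ) 1) :
    Tendsto (fun k => ∫ r in (0 : ℝ)..s, v k r) atTop (𝓝 (∫ r in (0 : ℝ)..s, w r)) := by
  have key : ∀ u : ℝ → Rn n, MemLp u 2 (volume.restrict (Icc (0 : ℝ) 1)) → ∀ c : Rn n,
      ∫ r in Icc (0 : ℝ) 1, inner ℝ (u r) ((Ioc 0 s).indicator (fun _ => c) r) =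
        inner ℝ (∫ r in (0 : ℝ)..s, u r) c := fun u hu c => by
    have h1 : ∀ r, inner ℝ (u r) ((Ioc 0 s).indicator (fun _ => c) r) =
        (Ioc 0 s).indicator (fun r => inner ℝ (u r) c) r := fun r => by
      by_cases hr : r ∈ Ioc 0 s <;> simp [hr]
    have h2 : Ioc 0 s ∩ Icc (0 : ℝ) 1 = Ioc 0 s :=
      inter_eq_left.2 fun r hr => ⟨hr.1.le, hr.2.trans hs.2⟩
    have hi : IntegrableOn u (Ioc 0 s) :=
      IntegrableOn.mono_set (hu.integrable one_le_two)
        (inter_eq_left.1 h2)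
    simp_rw [h1]
    rw [integral_indicator measurableSet_Ioc, Measure.restrict_restrict measurableSet_Ioc, h2,
      intervalIntegral.integral_of_le hs.1, real_inner_comm, ← integral_inner hi]
    simp_rw [real_inner_comm]
  have hsum : ∀ x : Rn n, x = ∑ i, inner ℝ x (EuclideanSpace.basisFun (Fin n) ℝ i) •
      EuclideanSpace.basisFun (Fin n) ℝ i := fun x => by
    conv_lhs => rw [← (EuclideanSpace.basisFun (Fin n) ℝ).sum_repr' x]
    simp_rw [real_inner_comm]
  have hlim : ∀ c : Rn n, Tendsto (fun k => inner ℝ (∫ r in (0 : ℝ)..s, v k r) c) atTop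
      (𝓝 (inner ℝ (∫ r in (0 : ℝ)..s, w r) c)) := fun c => by
    have h1 := h ((Ioc 0 s).indicator fun _ => c) ((memLp_const c).indicator measurableSet_Ioc)
    rw [key w hw c] at h1
    simpa only [key _ (hv _) c] using h1
  rw [hsum (∫ r in (0 : ℝ)..s, w r)]
  refine Tendsto.congr (fun k => (hsum (∫ r in (0 : ℝ)..s, v k r)).symm) ?_
  exact tendsto_finsetSum _ fun i _ => (hlim _).smul_const _

end WeakCompactness

/-! ### The direct method on compact subsets of `{V < E}`. -/

section DirectMethod

variable {n : ℕ} {H : Rn n × Rn n → ℝ} {E : ℝ}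

namespace IsClassicalHamiltonian

variable (hH : IsClassicalHamiltonian H)
include hH

theorem tendsto_integral_jacobiU {K : Set (Rn n)} (hK : IsCompact K)
    (hKE : ∀ q ∈ K, potential H q < E) {μ : Measure ℝ} {u : ℕ → ℝ → Rn n} {u₀ P : ℝ → Rn n}
    (hu : ∀ k, AEStronglyMeasurable (u k) μ) (hP : MemLp P 2 μ)
    (huK : ∀ k, ∀ᵐ s ∂μ, u k s ∈ K) (hu₀ : ∀ᵐ s ∂μ, potential H (u₀ s) < E)
    (h : ∀ᵐ s ∂μ, Tendsto (fun k => u k s) atTop (𝓝 (u₀ s))) :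
    (∀ k, Integrable (fun s => jacobiU H E (u k s, P s)) μ) ∧
    Tendsto (fun k => ∫ s, jacobiU H E (u k s, P s) ∂μ) atTop
      (𝓝 (∫ s, jacobiU H E (u₀ s, P s) ∂μ)) := by
  obtain ⟨C, hC, hb⟩ := hH.exists_bounds hK hKE
  have hm : ∀ k, AEStronglyMeasurable (fun s => jacobiU H E (u k s, P s)) μ := fun k =>
    hH.aestronglyMeasurable_comp (fun q hq v => hH.continuousAt_jacobiU hq v) (hu k) hP.1
      ((huK k).mono fun s hs => hKE _ hs)
  have hi : Integrable (fun s => (C * ‖P s‖) ^ 2) μ := by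
    simp_rw [mul_pow]
    exact hP.norm.integrable_sq.const_mul _
  have hbd : ∀ k, ∀ᵐ s ∂μ, ‖jacobiU H E (u k s, P s)‖ ≤ (C * ‖P s‖) ^ 2 := fun k => by
    filter_upwards [huK k] with s hs
    rw [Real.norm_of_nonneg (jacobiU_nonneg _), jacobiU_eq]
    exact pow_le_pow_left₀ (energyGauge_nonneg _) (hb _ hs _).1 2
  refine ⟨fun k => hi.mono' (hm k) (hbd k),
    tendsto_integral_of_dominated_convergence _ hm hi hbd ?_⟩
  filter_upwards [h, hu₀] with s hs hs'
  exact (hH.continuousAt_jacobiU hs' _).tendsto.comp (hs.prodMk_nhds tendsto_const_nhds)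

/-- The direct method: the energy attains its minimum among the curves in `K` from `y` to `S`. -/
theorem exists_minimizer {K S : Set (Rn n)} (hK : IsCompact K) (hKE : ∀ q ∈ K, potential H q < E)
    (hS : IsClosed S) {y : Rn n}
    (hne : ∃ γ : ℝ → Rn n, IsW12 γ ∧ γ 0 = y ∧ (∀ s ∈ Icc (0 : ℝ) 1, γ s ∈ K) ∧ γ 1 ∈ S) :
    ∃ γ : ℝ → Rn n, IsW12 γ ∧ γ 0 = y ∧ (∀ s ∈ Icc (0 : ℝ) 1, γ s ∈ K) ∧ γ 1 ∈ S ∧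
      ∀ η : ℝ → Rn n, IsW12 η → η 0 = y → (∀ s ∈ Icc (0 : ℝ) 1, η s ∈ K) → η 1 ∈ S →
        jacobiEnergy H E γ ≤ jacobiEnergy H E η := by
  set A : Set (ℝ → Rn n) :=
    {γ | IsW12 γ ∧ γ 0 = y ∧ (∀ s ∈ Icc (0 : ℝ) 1, γ s ∈ K) ∧ γ 1 ∈ S}
  have hbdd : BddBelow (jacobiEnergy H E '' A) := by
    refine ⟨0, ?_⟩
    rintro _ ⟨γ, hγ, rfl⟩
    exact hH.jacobiEnergy_nonneg fun s hs => hKE _ (hγ.2.2.1 s (Ico_subset_Icc_self hs))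
  have hne' : (jacobiEnergy H E '' A).Nonempty := by
    obtain ⟨γ, hγ⟩ := hne
    exact ⟨_, γ, hγ, rfl⟩
  obtain ⟨u, -, hu, huA⟩ := exists_seq_tendsto_sInf hne' hbdd
  choose γ hγA hγu using huA
  obtain ⟨M, hM⟩ := hu.bddAbove_range
  obtain ⟨c, hc, hcb⟩ := hH.exists_le_jacobiG hK hKE
  have hint : ∀ k, IntervalIntegrable (fun s => jacobiG H E (γ k s, deriv (γ k) s)) volume 0 1 :=
    fun k => hH.intervalIntegrable_jacobiG hK (hγA k).1 fun s hs =>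
      have h := (hγA k).2.2.1 s (Ico_subset_Icc_self hs)
      ⟨h, hKE _ h⟩
  have hIcc : ∀ f : ℝ → ℝ, ∫ s in (0 : ℝ)..1, f s = ∫ s in Icc (0 : ℝ) 1, f s := fun f => by
    rw [intervalIntegral.integral_of_le zero_le_one, integral_Icc_eq_integral_Ioc]
  have hbound : ∀ k, ∫ s in Icc (0 : ℝ) 1, ‖deriv (γ k) s‖ ^ 2 ≤ M / c := fun k => by
    rw [le_div_iff₀' hc, ← integral_const_mul]
    refine le_trans ?_ (hM ⟨k, rfl⟩)
    rw [← hγu k, jacobiEnergy, hIcc]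
    refine setIntegral_mono_on ((hγA k).1.2.norm.integrable_sq.const_mul c)
      ((intervalIntegrable_iff_integrableOn_Icc_of_le zero_le_one).1 (hint k))
      measurableSet_Icc fun s hs => hcb _ ((hγA k).2.2.1 s hs) _
  obtain ⟨w, hw, φ, hφ, hweak⟩ := exists_weak_subseq (fun k => (hγA k).1.2) hbound
  have hpt := fun {s : ℝ} (hs : s ∈ Icc (0 : ℝ) 1) =>
    tendsto_integral_of_weak (fun k => (hγA (φ k)).1.2) hw hweak hs
  set γ₀ : ℝ → Rn n := fun s => y + ∫ r in (0 : ℝ)..s, w r with hγ₀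
  have h00 : γ₀ 0 = y := by simp [hγ₀]
  obtain ⟨hW, hdw⟩ := isW12_of_eq_integral (γ := γ₀) hw fun s _ => by rw [h00]
  have hconv : ∀ s ∈ Icc (0 : ℝ) 1, Tendsto (fun k => γ (φ k) s) atTop (𝓝 (γ₀ s)) := fun s hs => by
    refine ((hpt hs).const_add y).congr fun k => ?_
    rw [(hγA (φ k)).1.eq_integral hs, (hγA (φ k)).2.1]
  have hmem : ∀ s ∈ Icc (0 : ℝ) 1, γ₀ s ∈ K := fun s hs =>
    hK.isClosed.mem_of_tendsto (hconv s hs) (Eventually.of_forall fun k => (hγA (φ k)).2.2.1 s hs)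
  have h1S : γ₀ 1 ∈ S := hS.mem_of_tendsto (hconv 1 ⟨zero_le_one, le_rfl⟩)
    (Eventually.of_forall fun k => (hγA (φ k)).2.2.2)
  refine ⟨γ₀, hW, h00, hmem, h1S, fun η h1 h2 h3 h4 => ?_⟩
  refine le_trans ?_ (csInf_le hbdd ⟨η, ⟨h1, h2, h3, h4⟩, rfl⟩)
  set μ := volume.restrict (Icc (0 : ℝ) 1)
  have hae : ∀ {p : ℝ → Prop}, (∀ s ∈ Icc (0 : ℝ) 1, p s) → ∀ᵐ s ∂μ, p s := fun h =>
    (ae_restrict_iff' measurableSet_Icc).2 (Eventually.of_forall h)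
  -- Lower semicontinuity by duality: `G(q, v) ≥ ⟨v, P⟩ - U(q, P)` along the sequence, with equality
  -- for the limit. For this fixed `P` the first term passes to the limit weakly, the second by
  -- dominated convergence.
  set P : ℝ → Rn n := fun s => legendreInv H E (γ₀ s, w s)
  have hP : MemLp P 2 μ := hH.memLp_legendreInv_comp hK
    (hW.continuousOn.aestronglyMeasurable measurableSet_Icc) hw
    (hae fun s hs => ⟨hmem s hs, hKE _ (hmem s hs)⟩)
  obtain ⟨hUi, hUlim⟩ := hH.tendsto_integral_jacobiU hK hKE
    (fun k => (hγA (φ k)).1.continuousOn.aestronglyMeasurable measurableSet_Icc) hP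
    (fun k => hae (hγA (φ k)).2.2.1) (hae fun s hs => hKE _ (hmem s hs)) (hae hconv)
  obtain ⟨hU₀, -⟩ := hH.tendsto_integral_jacobiU hK hKE
    (fun _ => hW.continuousOn.aestronglyMeasurable measurableSet_Icc) hP
    (fun _ => hae hmem) (hae fun s hs => hKE _ (hmem s hs)) (hae fun s _ => tendsto_const_nhds)
  have hJ : jacobiEnergy H E γ₀ =
      (∫ s, inner ℝ (w s) (P s) ∂μ) - ∫ s, jacobiU H E (γ₀ s, P s) ∂μ := by
    rw [← integral_sub (hw.integrable_real_inner hP) (hU₀ 0), jacobiEnergy, hIcc]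
    refine integral_congr_ae ?_
    filter_upwards [hdw, hae hmem] with s hs hs'
    rw [hs, hH.jacobiG_eq_inner_sub (hKE _ hs')]
  rw [hJ]
  refine le_of_tendsto_of_tendsto ((hweak P hP).sub hUlim) (hu.comp hφ.tendsto_atTop)
    (Eventually.of_forall fun k => ?_)
  simp only [Function.comp]
  rw [← integral_sub ((hγA (φ k)).1.2.integrable_real_inner hP) (hUi k), ← hγu (φ k),
    jacobiEnergy, hIcc]
  refine setIntegral_mono_on (((hγA (φ k)).1.2.integrable_real_inner hP).sub (hUi k))
    ((intervalIntegrable_iff_integrableOn_Icc_of_le zero_le_one).1 (hint (φ k)))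
    measurableSet_Icc fun s hs => hH.inner_sub_le_jacobiG (hKE _ ((hγA (φ k)).2.2.1 s hs)) _ _

end IsClassicalHamiltonian

end DirectMethod

/-! ### Trajectories to the levels `{V = c}`, `c < E`. -/

section Truncation

variable {n : ℕ} {H : Rn n × Rn n → ℝ} {E : ℝ} {D : Set (Rn n)}

theorem exists_first_exit {X : Type*} [TopologicalSpace X] {D : Set X} (hD : IsOpen D) {γ : ℝ → X}
    {a : ℝ} (ha : 0 ≤ a) (hγ : ContinuousOn γ (Icc 0 a)) (h0 : γ 0 ∈ D) (h1 : γ a ∉ D) :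
    ∃ s ∈ Ioc 0 a, γ s ∈ frontier D ∧ ∀ r ∈ Ico 0 s, γ r ∈ D := by
  have hcl : IsClosed (Icc 0 a ∩ γ ⁻¹' Dᶜ) :=
    hγ.preimage_isClosed_of_isClosed isClosed_Icc hD.isClosed_compl
  obtain ⟨s, ⟨hs, hsD⟩, hmin⟩ := (isCompact_Icc.of_isClosed_subset hcl inter_subset_left).exists_isLeast
    ⟨a, ⟨ha, le_rfl⟩, h1⟩
  have hs0 : 0 < s := hs.1.lt_of_ne fun h => hsD (h ▸ h0)
  have hlt : ∀ r ∈ Ico 0 s, γ r ∈ D := fun r hr => by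
    by_contra h
    exact (hmin ⟨⟨hr.1, hr.2.le.trans hs.2⟩, h⟩).not_gt hr.2
  refine ⟨s, ⟨hs0, hs.2⟩, ?_, hlt⟩
  rw [hD.frontier_eq]
  refine ⟨?_, hsD⟩
  have h2 : s ∈ closure (Ico 0 s) := by
    rw [closure_Ico hs0.ne]; exact ⟨hs.1, le_rfl⟩
  have h3 : ContinuousWithinAt γ (Ico 0 s) s :=
    (hγ s hs).mono fun r hr => ⟨hr.1, hr.2.le.trans hs.2⟩
  exact closure_mono (image_subset_iff.2 hlt) (h3.mem_closure_image h2)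

theorem nonempty_curvesToBoundary (hn : 1 ≤ n) (hD : IsOpen D) (hc : IsCompact (closure D))
    {y : Rn n} (hy : y ∈ D) : (curvesToBoundary D y).Nonempty := by
  have : Nonempty (Fin n) := ⟨⟨0, hn⟩⟩
  -- Because `n ≥ 1`, some point lies outside the compact closure of `D`, and the segment from `y`
  -- to it must leave `D`.
  have : NoncompactSpace (Rn n) := NormedSpace.noncompactSpace ℝ (Rn n)
  obtain ⟨z, hz⟩ := (ne_univ_iff_exists_notMem _).1 hc.ne_univ
  obtain ⟨s, hs, hsf, hsD⟩ := exists_first_exit hD zero_le_one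
    (γ := fun s : ℝ => y + s • (z - y)) (by fun_prop) (by simpa using hy)
    (by simpa using fun h => hz (subset_closure h))
  refine ⟨fun r => y + r • (s • (z - y)), ?_, by simp, fun r hr => ?_, by simpa using hsf⟩
  · exact (isW12_of_eq_integral (φ := fun _ => s • (z - y)) (memLp_const _) fun r hr => by
      simp only [zero_smul, add_zero, intervalIntegral.integral_const, sub_zero]).1
  · simp only [smul_smul]
    exact hsD _ ⟨mul_nonneg hr.1 hs.1.le, mul_lt_of_lt_one_left hs.1 hr.2⟩

/-- Substitution of `s p` for `p` in the supremum. It is valid for every `q`, even where the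
supremum takes its default value. -/
theorem jacobiG_smul {q v : Rn n} {s : ℝ} (hs : 0 < s) :
    jacobiG H E (q, s • v) = s ^ 2 * jacobiG H E (q, v) := by
  simp only [jacobiG]
  rw [Real.mul_iSup_of_nonneg (sq_nonneg s), ← (Homeomorph.smulOfNeZero s hs.ne').toEquiv.iSup_comp]
  refine iSup_congr fun p => ?_
  simp only [Homeomorph.coe_toEquiv, Homeomorph.smulOfNeZero_apply, jacobiU_eq,
    IsClassicalHamiltonian.energyGauge_smul hs.le, inner_smul_left, inner_smul_right]
  simp
  ring

theorem IsW12.comp_mul {γ : ℝ → Rn n} (hγ : IsW12 γ) {s : ℝ} (hs : s ∈ Ioc (0 : ℝ) 1) :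
    IsW12 (fun r => γ (s * r)) := by
  have hsub : Icc 0 s ⊆ Icc (0 : ℝ) 1 := Icc_subset_Icc_right hs.2
  have hφ : MemLp (fun r => s • deriv γ (s * r)) 2 (volume.restrict (Icc (0 : ℝ) 1)) := by
    refine MemLp.const_smul ?_ s
    have hm : StronglyMeasurable fun r => deriv γ (s * r) :=
      (stronglyMeasurable_deriv γ).comp_measurable (measurable_const_mul s)
    rw [memLp_two_iff_integrable_sq_norm hm.aestronglyMeasurable]
    have h1 : IntervalIntegrable (fun r => ‖deriv γ r‖ ^ 2) volume 0 s :=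
      (intervalIntegrable_iff_integrableOn_Icc_of_le hs.1.le).2
        (IntegrableOn.mono_set hγ.2.norm.integrable_sq hsub)
    have h2 := h1.comp_mul_left (c := s)
    rw [zero_div, div_self hs.1.ne'] at h2
    exact (intervalIntegrable_iff_integrableOn_Icc_of_le zero_le_one).1 h2
  refine (isW12_of_eq_integral hφ fun r hr => ?_).1
  rw [intervalIntegral.integral_smul, intervalIntegral.smul_integral_comp_mul_left, mul_zero]
  exact hγ.eq_integral ⟨mul_nonneg hs.1.le hr.1, mul_le_one₀ hs.2 hr.1 hr.2⟩

theorem jacobiEnergy_comp_mul {γ : ℝ → Rn n} {s : ℝ} (hs : 0 < s) :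
    jacobiEnergy H E (fun r => γ (s * r)) =
      s * ∫ r in (0 : ℝ)..s, jacobiG H E (γ r, deriv γ r) := by
  have h1 : ∀ r, jacobiG H E (γ (s * r), deriv (fun r => γ (s * r)) r) =
      s ^ 2 * jacobiG H E (γ (s * r), deriv γ (s * r)) := fun r => by
    rw [deriv_comp_mul_left, jacobiG_smul hs]
  simp only [jacobiEnergy, h1]
  rw [intervalIntegral.integral_const_mul,
    intervalIntegral.integral_comp_mul_left (fun r => jacobiG H E (γ r, deriv γ r)) hs.ne']
  simp only [mul_zero, mul_one, smul_eq_mul]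
  field_simp

namespace IsClassicalHamiltonian

variable (hH : IsClassicalHamiltonian H)
include hH

/-- Truncating a curve at a level of the potential does not increase its energy. -/
theorem exists_truncation (hc : IsCompact (closure D)) {c : ℝ}
    {η : ℝ → Rn n} (hη : IsW12 η) (h0 : potential H (η 0) < c) (h1 : c ≤ potential H (η 1))
    (hmem : ∀ s ∈ Icc (0 : ℝ) 1, η s ∈ closure D)
    (hE : ∀ s ∈ Ico (0 : ℝ) 1, potential H (η s) < E) :
    ∃ γ : ℝ → Rn n, IsW12 γ ∧ γ 0 = η 0 ∧ (∀ s ∈ Icc (0 : ℝ) 1, γ s ∈ closure D) ∧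
      (∀ s ∈ Ico (0 : ℝ) 1, potential H (γ s) < c) ∧ potential H (γ 1) = c ∧
      jacobiEnergy H E γ ≤ jacobiEnergy H E η := by
  -- The curve is stopped on first reaching the level `c` and stretched to `[0, 1]`, which
  -- multiplies the energy of the remaining piece by `s ≤ 1`.
  obtain ⟨s, hs, hsf, hsD⟩ := exists_first_exit (hH.isOpen_potential_lt (E := c)) zero_le_one
    hη.continuousOn h0 h1.not_gt
  have hsf' := frontier_lt_subset_eq hH.contDiff_potential.continuous continuous_const hsf
  refine ⟨fun r => η (s * r), hη.comp_mul hs, by simp, fun r hr => hmem _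
    ⟨mul_nonneg hs.1.le hr.1, mul_le_one₀ hs.2 hr.1 hr.2⟩, fun r hr => hsD _
    ⟨mul_nonneg hs.1.le hr.1, mul_lt_of_lt_one_right hs.1 hr.2⟩, by simpa using hsf', ?_⟩
  rw [jacobiEnergy_comp_mul hs.1]
  have hint := hH.intervalIntegrable_jacobiG hc hη
    fun s hs => ⟨hmem s (Ico_subset_Icc_self hs), hE s hs⟩
  have hnn : 0 ≤ᵐ[volume.restrict (Ioc 0 1)] fun r => jacobiG H E (η r, deriv η r) := by
    rw [Measure.restrict_congr_set Ico_ae_eq_Ioc.symm]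
    exact (ae_restrict_iff' measurableSet_Ico).2
      (Eventually.of_forall fun r hr => hH.jacobiG_nonneg (hE r hr) _)
  have h3 : ∫ r in (0 : ℝ)..s, jacobiG H E (η r, deriv η r) ≤ jacobiEnergy H E η :=
    intervalIntegral.integral_mono_interval le_rfl hs.1.le hs.2 hnn hint
  have h4 := hH.jacobiEnergy_nonneg hE
  exact (mul_le_mul_of_nonneg_left h3 hs.1.le).trans (mul_le_of_le_one_left h4 hs.2)

/-- For each level `c < E` of the potential there is a trajectory from `y` to that level, of
length at most `√ψ(y)`, within uniformly bounded time. -/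
theorem exists_trajectory_to_level (hn : 1 ≤ n) (hD : IsPotentialWell H E D)
    (hc : IsCompact (closure D)) {y : Rn n} (hy : y ∈ D) :
    ∃ C : ℝ, ∀ c < E, potential H y < c → ∃ (T : ℝ) (q p : ℝ → Rn n), 0 < T ∧ T ≤ C ∧
      IsHamiltonSolution H E T q p ∧ q 0 = y ∧ (∀ t ∈ Icc 0 T, q t ∈ closure D) ∧
      potential H (q T) = c ∧
      ∫ t in (0 : ℝ)..T, radialSpeed H (q t, p t) ≤ Real.sqrt (psi H E D y) := by
  obtain ⟨C₀, hC₀, hex⟩ := hH.exists_timeChange hD hc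
  refine ⟨C₀ * (Real.sqrt (psi H E D y) + 1), fun c hcE hyc => ?_⟩
  have hV := hH.contDiff_potential.continuous
  have htrunc : ∀ η ∈ curvesToBoundary D y, ∃ γ : ℝ → Rn n, IsW12 γ ∧ γ 0 = y ∧
      (∀ s ∈ Icc (0 : ℝ) 1, γ s ∈ closure D) ∧
      (∀ s ∈ Ico (0 : ℝ) 1, potential H (γ s) < c) ∧ potential H (γ 1) = c ∧
      jacobiEnergy H E γ ≤ jacobiEnergy H E η := by
    rintro η ⟨h1, h2, h3, h4⟩
    rw [← h2]
    refine hH.exists_truncation hc h1 (h2 ▸ hyc)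
      (by rw [hD.eq_of_mem_frontier _ h4]; exact hcE.le) (fun s hs => ?_)
      fun s hs => hD.lt_of_mem _ (h3 s hs)
    rcases hs.2.lt_or_eq with h | rfl
    · exact subset_closure (h3 s ⟨hs.1, h⟩)
    · exact frontier_subset_closure h4
  have hle : ∀ {γ : ℝ → Rn n}, (∀ s ∈ Ico (0 : ℝ) 1, potential H (γ s) < c) →
      potential H (γ 1) = c → ∀ s ∈ Icc (0 : ℝ) 1, potential H (γ s) ≤ c := by
    intro γ h1 h2 s hs
    rcases hs.2.lt_or_eq with h | rfl
    · exact (h1 s ⟨hs.1, h⟩).le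
    · exact h2.le
  have hK : IsCompact (closure D ∩ {q | potential H q ≤ c}) :=
    hc.inter_right (isClosed_le hV continuous_const)
  have hS : IsClosed {q : Rn n | potential H q = c} := isClosed_eq hV continuous_const
  obtain ⟨η₀, hη₀⟩ := nonempty_curvesToBoundary hn hD.isOpen hc hy
  obtain ⟨β, b1, b2, b3, b4, b5, -⟩ := htrunc η₀ hη₀
  obtain ⟨α, a1, a2, a3, a4, hαmin⟩ := hH.exists_minimizer hK
    (fun q hq => lt_of_le_of_lt hq.2 hcE) hS (y := y)
    ⟨β, b1, b2, fun s hs => ⟨b3 s hs, hle b4 b5 s hs⟩, b5⟩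
  -- The minimizer over the closed sublevel may touch the level `c` early. Cutting it there makes it
  -- stay in the open set `{V < c}` before `s = 1`, as the first variation requires, at no cost in
  -- energy.
  obtain ⟨γ, g1, g2, g3, g4, g5, g6⟩ := hH.exists_truncation (D := D) hc a1 (by rwa [a2])
    a4.ge (fun s hs => (a3 s hs).1)
    (fun s hs => lt_of_le_of_lt (a3 s (Ico_subset_Icc_self hs)).2 hcE)
  rw [a2] at g2
  have hγE : ∀ s ∈ Ico (0 : ℝ) 1, potential H (γ s) < E := fun s hs => (g4 s hs).trans hcE
  have hγD : ∀ s ∈ Ico (0 : ℝ) 1, γ s ∈ D := fun s hs =>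
    hD.mem_of_lt (g3 s (Ico_subset_Icc_self hs)) (hγE s hs)
  have hγmin : ∀ η : ℝ → Rn n, IsW12 η → η 0 = y → (∀ s ∈ Icc (0 : ℝ) 1, η s ∈ closure D) →
      (∀ s ∈ Ico (0 : ℝ) 1, potential H (η s) < c) → potential H (η 1) = c →
      jacobiEnergy H E γ ≤ jacobiEnergy H E η := fun η h1 h2 h3 h4 h5 =>
    g6.trans (hαmin η h1 h2 (fun s hs => ⟨h3 s hs, hle h4 h5 s hs⟩) h5)
  -- A curve of `X_y` crosses the level `c`, so its truncation is a competitor.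
  have hpsi : jacobiEnergy H E γ ≤ psi H E D y := by
    refine le_csInf ⟨_, η₀, hη₀, rfl⟩ ?_
    rintro _ ⟨η, hη, rfl⟩
    obtain ⟨β, b1, b2, b3, b4, b5, b6⟩ := htrunc η hη
    exact (hγmin β b1 b2 b3 b4 b5).trans b6
  have hD'D : D ∩ {q | potential H q < c} ⊆ D := inter_subset_left
  obtain ⟨P, k, hk, hJk, hP, hU⟩ := hH.exists_speed hD.lt_of_mem g1
    (hD.isOpen.inter hH.isOpen_potential_lt) hD'D
    (fun h => by rw [g2] at h; rw [← h] at g5; exact hyc.ne g5)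
    (fun s hs => ⟨hγD s hs, g4 s hs⟩)
    (hH.intervalIntegrable_jacobiG hc g1 fun s hs => ⟨subset_closure (hγD s hs), hγE s hs⟩)
    (fun η h1 h2 h3 h4 => by
      refine hγmin η h1 (h2.trans g2) (fun s hs => ?_) (fun s hs => (h4 s hs).2) (by rw [h3, g5])
      rcases hs.2.lt_or_eq with h | rfl
      · exact subset_closure (h4 s ⟨hs.1, h⟩).1
      · rw [h3]; exact g3 1 hs)
  obtain ⟨e, w, htc, hwC, -⟩ := hex γ P k hk g1.continuousOn hγD hP hU
  obtain ⟨hT, σ, hbij, -, hσ0, hσT, -, hσd, hsol⟩ :=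
    TimeChange.exists_solution hH hk g1.continuousOn htc
  have hkpsi : k ≤ Real.sqrt (psi H E D y) := Real.le_sqrt_of_sq_le (hJk ▸ hpsi)
  set T := ∫ s in (0 : ℝ)..1, w s
  refine ⟨T, _, _, hT, hwC.trans (by gcongr), hsol, by simp only [hσ0, g2],
    fun t ht => g3 _ (hbij.mapsTo ht), by simp only [hσT, g5], ?_⟩
  refine le_of_eq_of_le ?_ hkpsi
  have hcont : ContinuousOn (fun t => radialSpeed H (γ (σ t), e (σ t))) (Icc 0 T) :=
    hH.continuous_radialSpeed.comp_continuousOn (ContinuousOn.prodMk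
      (fun t ht => (hsol.deriv_q t ht).continuousWithinAt)
      fun t ht => (hsol.deriv_p t ht).continuousWithinAt)
  have h1 := intervalIntegral.integral_eq_sub_of_hasDerivAt_of_le hT.le
    (fun t ht => (hσd t ht).continuousWithinAt)
    (fun t ht => (hσd t (Ioo_subset_Icc_self ht)).hasDerivAt (Icc_mem_nhds ht.1 ht.2))
    (ContinuousOn.intervalIntegrable_of_Icc hT.le (hcont.div_const k))
  -- Since `σ' = l / k` and `σ` runs from `0` to `1`, the length `∫ l dt` equals `k`.
  rw [intervalIntegral.integral_div, hσ0, hσT, sub_zero, div_eq_one_iff_eq hk.ne'] at h1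
  exact h1

end IsClassicalHamiltonian

end Truncation

/-! ### Compactness and limits of trajectories. -/

section Limits

open scoped NNReal

theorem exists_pointwise_subseq {Z : Type*} [MetricSpace Z] {K : Set Z} (hK : IsCompact K)
    {F : ℕ → ℝ → Z} {L : ℝ≥0} (hF : ∀ k, LipschitzOnWith L (F k) (Icc 0 1))
    (hFK : ∀ k, ∀ s ∈ Icc (0 : ℝ) 1, F k s ∈ K) :
    ∃ f : ℝ → Z, ContinuousOn f (Icc 0 1) ∧ ∃ φ : ℕ → ℕ, StrictMono φ ∧
      ∀ s ∈ Icc (0 : ℝ) 1, Tendsto (fun k => F (φ k) s) atTop (𝓝 (f s)) := by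
  set G : ℕ → BoundedContinuousFunction (Icc (0 : ℝ) 1) Z := fun k =>
    BoundedContinuousFunction.mkOfCompact
      ⟨(Icc (0 : ℝ) 1).domRestrict (F k), (hF k).continuousOn.domRestrict⟩
  have hcpt : IsCompact (closure (range G)) := by
    refine BoundedContinuousFunction.arzela_ascoli K hK (range G) ?_ ?_
    · rintro _ x ⟨k, rfl⟩
      exact hFK k x x.2
    · refine (LipschitzWith.uniformEquicontinuous _ L ?_).equicontinuous
      rintro ⟨_, k, rfl⟩
      exact lipschitzOnWith_iff_restrict.1 (hF k)
  obtain ⟨g, -, φ, hφ, hg⟩ := hcpt.tendsto_subseq (x := G) fun k => subset_closure ⟨k, rfl⟩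
  refine ⟨IccExtend zero_le_one g, (g.continuous.Icc_extend').continuousOn, φ, hφ, fun s hs => ?_⟩
  have h1 := ((continuous_eval_const
    (F := BoundedContinuousFunction (Icc (0 : ℝ) 1) Z) (⟨s, hs⟩ : Icc (0 : ℝ) 1)).tendsto g).comp hg
  rw [IccExtend_of_mem _ _ hs]
  exact h1

theorem tendsto_integral_comp {Z F : Type*} [TopologicalSpace Z] [NormedAddCommGroup F]
    [NormedSpace ℝ F] {K : Set Z} (hK : IsCompact K) {f : Z → F} (hf : Continuous f)
    {z : ℕ → ℝ → Z} {z₀ : ℝ → Z} (hc : ∀ k, ContinuousOn (z k) (Icc 0 1))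
    (hzK : ∀ k, ∀ s ∈ Icc (0 : ℝ) 1, z k s ∈ K)
    (hz : ∀ s ∈ Icc (0 : ℝ) 1, Tendsto (fun k => z k s) atTop (𝓝 (z₀ s))) {s : ℝ}
    (hs : s ∈ Icc (0 : ℝ) 1) :
    Tendsto (fun k => ∫ r in (0 : ℝ)..s, f (z k r)) atTop (𝓝 (∫ r in (0 : ℝ)..s, f (z₀ r))) := by
  obtain ⟨B, hB⟩ := hK.exists_bound_of_continuousOn hf.continuousOn
  have hsub : uIoc 0 s ⊆ Icc (0 : ℝ) 1 := by
    rw [uIoc_of_le hs.1]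
    exact Ioc_subset_Icc_self.trans (Icc_subset_Icc_right hs.2)
  exact intervalIntegral.tendsto_integral_filter_of_dominated_convergence (fun _ => B)
    (Eventually.of_forall fun k => ((hf.comp_continuousOn (hc k)).mono hsub).aestronglyMeasurable
      measurableSet_uIoc)
    (Eventually.of_forall fun k => Eventually.of_forall fun r hr => hB _ (hzK k r (hsub hr)))
    intervalIntegrable_const
    (Eventually.of_forall fun r hr => (hf.tendsto _).comp (hz r (hsub hr)))

/-- Pointwise limits of solutions of an autonomous equation are solutions. -/
theorem eq_integral_of_tendsto {Z : Type*} [NormedAddCommGroup Z] [NormedSpace ℝ Z]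
    [CompleteSpace Z] {K : Set Z} (hK : IsCompact K) {X : Z → Z} (hX : Continuous X)
    {z : ℕ → ℝ → Z} {T : ℕ → ℝ} {z₀ : ℝ → Z} {T₀ : ℝ} (hT : Tendsto T atTop (𝓝 T₀))
    (hzK : ∀ k, ∀ s ∈ Icc (0 : ℝ) 1, z k s ∈ K)
    (hd : ∀ k, ∀ s ∈ Icc (0 : ℝ) 1, HasDerivWithinAt (z k) (T k • X (z k s)) (Icc 0 1) s)
    (hz : ∀ s ∈ Icc (0 : ℝ) 1, Tendsto (fun k => z k s) atTop (𝓝 (z₀ s))) {s : ℝ}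
    (hs : s ∈ Icc (0 : ℝ) 1) : z₀ s = z₀ 0 + ∫ r in (0 : ℝ)..s, T₀ • X (z₀ r) := by
  have hsub : Icc 0 s ⊆ Icc (0 : ℝ) 1 := Icc_subset_Icc_right hs.2
  have hc : ∀ k, ContinuousOn (z k) (Icc 0 1) := fun k s hs => (hd k s hs).continuousWithinAt
  have hXc : ∀ k, ContinuousOn (fun r => X (z k r)) (Icc 0 s) := fun k =>
    hX.comp_continuousOn ((hc k).mono hsub)
  have h1 : ∀ k, z k s = z k 0 + T k • ∫ r in (0 : ℝ)..s, X (z k r) := fun k => by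
    have := intervalIntegral.integral_eq_sub_of_hasDerivAt_of_le hs.1 ((hc k).mono hsub)
      (fun r hr => (hd k r (hsub (Ioo_subset_Icc_self hr))).hasDerivAt
        (Icc_mem_nhds hr.1 (hr.2.trans_le hs.2)))
      (ContinuousOn.intervalIntegrable_of_Icc hs.1 ((hXc k).const_smul (T k)))
    rw [← intervalIntegral.integral_smul, this, add_sub_cancel]
  have h2 := tendsto_integral_comp hK hX hc hzK hz hs
  rw [intervalIntegral.integral_smul]
  refine tendsto_nhds_unique (hz s hs) ?_
  simp_rw [h1]
  exact (hz 0 ⟨le_rfl, zero_le_one⟩).add (hT.smul h2)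

variable {n : ℕ} {H : Rn n × Rn n → ℝ} {E : ℝ} {D : Set (Rn n)}

/-- As `∂H/∂p` is Lipschitz on compact sets and vanishes at `p = 0`, its square is at most `L²
‖p‖²`, hence a multiple of `radialSpeed`. The bound compensates the factor `1 / l` of the
constant-speed parametrization near `∂D`. -/
theorem IsClassicalHamiltonian.exists_sq_norm_partialP_le (hH : IsClassicalHamiltonian H)
    {S : Set (Rn n × Rn n)} (hS : IsCompact S) :
    ∃ C : ℝ, ∀ x ∈ S, ‖partialP H x.1 x.2‖ ^ 2 ≤ C * radialSpeed H x := by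
  -- The points `(q, 0)` are adjoined so that the Lipschitz bound compares `(q, p)` with `(q, 0)`.
  have hS₀ : IsCompact (S ∪ (fun x : Rn n × Rn n => (x.1, (0 : Rn n))) '' S) :=
    hS.union (hS.image (by fun_prop))
  have hlip : LocallyLipschitz (fderiv ℝ H) :=
    (hH.contDiff.fderiv_right (m := 1) (by norm_num)).locallyLipschitz
  obtain ⟨L, hL⟩ := (hlip.locallyLipschitzOn (s := _)).exists_lipschitzOnWith_of_compact hS₀
  obtain ⟨B, hB⟩ := hS.exists_bound_of_continuousOn (f := fun x => (hH.modulus x.1)⁻¹)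
    ((hH.continuous_modulus.comp continuous_fst).inv₀
      fun x => (hH.modulus_pos x.1).ne').continuousOn
  refine ⟨L ^ 2 * (2 * B), ?_⟩
  rintro ⟨q, p⟩ hx
  have h1 : ‖partialP H q p‖ ≤ L * ‖p‖ := by
    have h2 := hL.dist_le_mul (q, p) (Or.inl hx) (q, 0) (Or.inr ⟨(q, p), hx, rfl⟩)
    rw [dist_eq_norm, dist_prod_same_left, dist_zero_right] at h2
    refine le_trans ?_ h2
    have h0 : partialP H q p = partialP H q p - partialP H q 0 := by
      rw [hH.partialP_zero, sub_zero]
    rw [h0,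
      partialP_eq (hH.differentiable (q, p)), partialP_eq (hH.differentiable (q, 0)), ← map_sub,
      LinearIsometryEquiv.norm_map]
    refine ContinuousLinearMap.opNorm_le_bound _ (norm_nonneg _) fun v => ?_
    have := (fderiv ℝ H (q, p) - fderiv ℝ H (q, 0)).le_opNorm (0, v)
    simpa using this
  have h2 := hH.le_radialSpeed q p
  have h3 := hH.modulus_pos q
  have h4 : (hH.modulus q)⁻¹ ≤ B := (le_abs_self _).trans (hB _ hx)
  have h5 := hH.radialSpeed_nonneg (q, p)
  have h6 : ‖p‖ ^ 2 ≤ 2 * (hH.modulus q)⁻¹ * radialSpeed H (q, p) := by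
    rw [mul_assoc, mul_comm (_)⁻¹, ← div_eq_mul_inv, ← mul_div_assoc, le_div_iff₀ h3]
    linarith
  calc ‖partialP H q p‖ ^ 2 ≤ (L * ‖p‖) ^ 2 := by gcongr
    _ = L ^ 2 * ‖p‖ ^ 2 := by ring
    _ ≤ L ^ 2 * (2 * (hH.modulus q)⁻¹ * radialSpeed H (q, p)) := by gcongr
    _ ≤ L ^ 2 * (2 * B * radialSpeed H (q, p)) := by gcongr
    _ = _ := by ring

end Limits

/-! ### The limit trajectory and the attainment of the infimum. -/

section LimitTrajectory

open scoped NNReal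

variable {n : ℕ} {H : Rn n × Rn n → ℝ} {E : ℝ} {D : Set (Rn n)}

namespace IsClassicalHamiltonian

variable (hH : IsClassicalHamiltonian H)
include hH

/-- There is a trajectory from `y` to the boundary, of length at most `√ψ(y)`. -/
theorem exists_trajectory_to_boundary (hn : 1 ≤ n) (hD : IsPotentialWell H E D)
    (hc : IsCompact (closure D)) {y : Rn n} (hy : y ∈ D) :
    ∃ (T : ℝ) (z : ℝ → Rn n × Rn n), 0 < T ∧ ContinuousOn z (Icc 0 1) ∧ (z 0).1 = y ∧
      potential H (z 1).1 = E ∧ (∀ s ∈ Icc (0 : ℝ) 1, (z s).1 ∈ closure D ∧ H (z s) = E) ∧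
      (∀ s ∈ Ico (0 : ℝ) 1, HasDerivWithinAt z
        (T • (partialP H (z s).1 (z s).2, -partialQ H (z s).1 (z s).2)) (Icc 0 1) s) ∧
      T * ∫ s in (0 : ℝ)..1, radialSpeed H (z s) ≤ Real.sqrt (psi H E D y) := by
  obtain ⟨C, hC⟩ := hH.exists_trajectory_to_level hn hD hc hy
  obtain ⟨c, -, hcm, hcE⟩ := exists_seq_strictMono_tendsto' (hD.lt_of_mem y hy)
  choose T q p hT hTC hsol h0 hcl hV hlen using fun k => hC (c k) (hcm k).2 (hcm k).1
  set S : Set (Rn n × Rn n) := {x | x.1 ∈ closure D ∧ H x = E}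
  have hS : IsCompact S := hH.isCompact_energy hc
  set X : Rn n × Rn n → Rn n × Rn n := fun x => (partialP H x.1 x.2, -partialQ H x.1 x.2)
  have hX : Continuous X := hH.continuous_partialP.prodMk hH.continuous_partialQ.neg
  obtain ⟨B, hB⟩ := hS.exists_bound_of_continuousOn hX.continuousOn
  obtain ⟨T₀, hT₀, φ₁, hφ₁, hTlim⟩ :=
    isCompact_Icc.tendsto_subseq (x := T) fun k => (⟨(hT k).le, hTC k⟩ : T k ∈ Icc 0 C)
  -- The times `T k` vary, so all trajectories are rescaled to `[0,1]`; the bound on `T k` makes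
  -- them uniformly Lipschitz.
  set z : ℕ → ℝ → Rn n × Rn n := fun k s => (q k (T k * s), p k (T k * s))
  have hmap : ∀ k, MapsTo (fun s => T k * s) (Icc 0 1) (Icc 0 (T k)) := fun k s hs =>
    ⟨mul_nonneg (hT k).le hs.1, mul_le_of_le_one_right (hT k).le hs.2⟩
  have hzS : ∀ k, ∀ s ∈ Icc (0 : ℝ) 1, z k s ∈ S := fun k s hs =>
    ⟨hcl k _ (hmap k hs), (hsol k).energy _ (hmap k hs)⟩
  have hzd : ∀ k, ∀ s ∈ Icc (0 : ℝ) 1,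
      HasDerivWithinAt (z k) (T k • X (z k s)) (Icc 0 1) s := fun k s hs => by
    have h1 : HasDerivWithinAt (fun s => T k * s) (T k) (Icc 0 1) s := by
      simpa using (hasDerivWithinAt_id s _).const_mul (T k)
    have h2 := ((hsol k).deriv_q _ (hmap k hs)).scomp s h1 (hmap k)
    have h3 := ((hsol k).deriv_p _ (hmap k hs)).scomp s h1 (hmap k)
    exact h2.prodMk h3
  have hzL : ∀ k, LipschitzOnWith (Real.toNNReal (C * B)) (z k) (Icc 0 1) := fun k => by
    refine (convex_Icc 0 1).lipschitzOnWith_of_nnnorm_hasDerivWithin_le (hzd k) fun s hs => ?_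
    rw [← NNReal.coe_le_coe, coe_nnnorm, norm_smul, Real.norm_of_nonneg (hT k).le]
    have h1 := hB _ (hzS k s hs)
    have h2 : T k * ‖X (z k s)‖ ≤ C * B :=
      mul_le_mul (hTC k) h1 (norm_nonneg _) ((hT k).le.trans (hTC k))
    exact h2.trans (Real.le_coe_toNNReal _)
  obtain ⟨z₀, hz₀c, φ₂, hφ₂, hzlim⟩ := exists_pointwise_subseq hS (fun k => hzL (φ₁ k))
    fun k => hzS (φ₁ k)
  have hTlim' : Tendsto (fun k => T (φ₁ (φ₂ k))) atTop (𝓝 T₀) := hTlim.comp hφ₂.tendsto_atTop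
  have hz₀S : ∀ s ∈ Icc (0 : ℝ) 1, z₀ s ∈ S := fun s hs =>
    hS.isClosed.mem_of_tendsto (hzlim s hs) (Eventually.of_forall fun k => hzS _ s hs)
  have hint := fun {s : ℝ} (hs : s ∈ Icc (0 : ℝ) 1) => eq_integral_of_tendsto hS hX hTlim'
    (fun k => hzS (φ₁ (φ₂ k))) (fun k => hzd (φ₁ (φ₂ k))) hzlim hs
  have hzc : ∀ k, ContinuousOn (z k) (Icc 0 1) := fun k s hs => (hzd k s hs).continuousWithinAt
  have i0 : (0 : ℝ) ∈ Icc (0 : ℝ) 1 := ⟨le_rfl, zero_le_one⟩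
  have i1 : (1 : ℝ) ∈ Icc (0 : ℝ) 1 := ⟨zero_le_one, le_rfl⟩
  have hy0 : (z₀ 0).1 = y := by
    refine tendsto_nhds_unique ((continuous_fst.tendsto _).comp (hzlim 0 i0)) ?_
    refine tendsto_const_nhds.congr fun k => ?_
    simp [z, h0]
  have hV1 : potential H (z₀ 1).1 = E := by
    refine tendsto_nhds_unique (((hH.contDiff_potential.continuous.comp continuous_fst).tendsto
      _).comp (hzlim 1 i1)) ?_
    refine ((hcE.comp hφ₁.tendsto_atTop).comp hφ₂.tendsto_atTop).congr fun k => ?_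
    simp [z, hV]
  refine ⟨T₀, z₀, hT₀.1.lt_of_ne ?_, hz₀c, hy0, hV1, hz₀S, fun s hs => ?_, ?_⟩
  -- If the times tended to `0`, the limit would be constant, forcing `V(y) = E`.
  · rintro rfl
    have h1 := hint i1
    simp only [zero_smul, intervalIntegral.integral_zero, add_zero] at h1
    rw [h1, hy0] at hV1
    exact (hD.lt_of_mem y hy).ne hV1
  · exact hasDerivWithinAt_of_eq_integral
      (((hX.comp_continuousOn hz₀c).const_smul T₀).mono Ico_subset_Icc_self)
      (fun s hs => hint (Ico_subset_Icc_self hs)) hs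
  · refine le_of_tendsto (hTlim'.mul (tendsto_integral_comp hS hH.continuous_radialSpeed
      (fun k => hzc (φ₁ (φ₂ k))) (fun k => hzS (φ₁ (φ₂ k))) hzlim i1))
      (Eventually.of_forall fun k => ?_)
    refine le_of_eq_of_le ?_ (hlen (φ₁ (φ₂ k)))
    have := intervalIntegral.mul_integral_comp_mul_left (a := 0) (b := 1) (T (φ₁ (φ₂ k)))
      (f := fun t => radialSpeed H (q (φ₁ (φ₂ k)) t, p (φ₁ (φ₂ k)) t))
    rwa [mul_zero, mul_one] at this

/-- The infimum of the energy is attained. -/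
theorem exists_mem_curvesToBoundary_le (hn : 1 ≤ n) (hD : IsPotentialWell H E D)
    (hc : IsCompact (closure D)) {y : Rn n} (hy : y ∈ D) :
    ∃ γ ∈ curvesToBoundary D y, jacobiEnergy H E γ ≤ psi H E D y := by
  obtain ⟨T, z, hT, hzc, hz0, hz1, hzS, hzd, hlen⟩ :=
    hH.exists_trajectory_to_boundary hn hD hc hy
  -- The limit is only known to lie in the closure of `D` and may reach `∂D` early, so it is cut at
  -- its first exit.
  obtain ⟨a, ha, haf, haD⟩ := exists_first_exit hD.isOpen zero_le_one hzc.fst (by rwa [hz0])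
    (fun h => (hD.lt_of_mem _ h).ne hz1)
  have hsub : Icc 0 a ⊆ Icc (0 : ℝ) 1 := Icc_subset_Icc_right ha.2
  have hIco : ∀ s ∈ Ico 0 a, s ∈ Ico (0 : ℝ) 1 := fun s hs => ⟨hs.1, hs.2.trans_le ha.2⟩
  have hVE : ∀ s ∈ Ico 0 a, potential H (z s).1 < E := fun s hs => hD.lt_of_mem _ (haD s hs)
  have hl : ∀ s ∈ Ico 0 a, 0 < radialSpeed H (z s) := fun s hs =>
    hH.radialSpeed_pos (ne_zero_of_energy (hVE s hs)
      (hzS s (Ico_subset_Icc_self (hIco s hs))).2)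
  have hlc : ContinuousOn (fun s => radialSpeed H (z s)) (Icc 0 1) :=
    hH.continuous_radialSpeed.comp_continuousOn hzc
  have hli : IntervalIntegrable (fun s => radialSpeed H (z s)) volume 0 1 :=
    hlc.intervalIntegrable_of_Icc zero_le_one
  have hpc : ContinuousOn (fun s => ∫ r in (0 : ℝ)..s, radialSpeed H (z r)) (Icc 0 1) := by
    have := (absolutelyContinuousOnInterval_add_integral hli 0).continuousOn
    rw [uIcc_of_le zero_le_one] at this
    simpa only [zero_add] using this
  have hpd : ∀ s ∈ Ico 0 a, HasDerivWithinAt (fun s => ∫ r in (0 : ℝ)..s, radialSpeed H (z r))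
      (radialSpeed H (z s)) (Icc 0 a) s := fun s hs =>
    (hasDerivWithinAt_of_eq_integral (hlc.mono Ico_subset_Icc_self) (c := 0)
      (fun s _ => (zero_add _).symm) (hIco s hs)).mono hsub
  set ℓ : ℝ := T * ∫ r in (0 : ℝ)..a, radialSpeed H (z r) with hℓdef
  have hℓ : 0 < ℓ := mul_pos hT (intervalIntegral.intervalIntegral_pos_of_pos_on
    ((hlc.mono hsub).intervalIntegrable_of_Icc ha.1.le)
    (fun s hs => hl s (Ioo_subset_Ico_self hs)) ha.1)
  have hℓle : ℓ ≤ Real.sqrt (psi H E D y) := by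
    refine le_trans (mul_le_mul_of_nonneg_left ?_ hT.le) hlen
    exact intervalIntegral.integral_mono_interval le_rfl ha.1.le ha.2
      (Eventually.of_forall fun s => hH.radialSpeed_nonneg _) hli
  have hpsi : ℓ ^ 2 ≤ psi H E D y := by
    have h1 : 0 ≤ psi H E D y := by
      by_contra h
      rw [Real.sqrt_eq_zero_of_nonpos (not_le.1 h).le] at hℓle
      exact hℓle.not_gt hℓ
    exact (Real.le_sqrt hℓ.le h1).1 hℓle
  -- With `ℓ` the Jacobi length of the cut trajectory, this factor makes the new parameter
  -- proportional to length and equal to `1` at `a`.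
  set κ : ℝ := T / ℓ
  have hκ : 0 < κ := div_pos hT hℓ
  obtain ⟨-, σ, hbij, hmono, hσc, hσ0, hσ1, -, hσd⟩ := exists_inverse_of_deriv_pos ha.1
    (τ := fun s => κ * ∫ r in (0 : ℝ)..s, radialSpeed H (z r))
    ((hpc.mono hsub).const_mul κ) (by simp) (fun s hs => (hpd s hs).const_mul κ)
    (fun s hs => mul_pos hκ (hl s hs))
  have hτa : κ * ∫ r in (0 : ℝ)..a, radialSpeed H (z r) = 1 := by
    simp only [κ]
    rw [div_mul_eq_mul_div, ← hℓdef, div_self hℓ.ne']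
  simp only [hτa] at hbij hmono hσc hσ1 hσd
  set γ : ℝ → Rn n := fun r => (z (σ r)).1
  set c : ℝ → ℝ := fun r => ℓ / radialSpeed H (z (σ r))
  set φ : ℝ → Rn n := fun r => c r • partialP H (z (σ r)).1 (z (σ r)).2
  have hzσc : ContinuousOn (fun r => z (σ r)) (Icc 0 1) := (hzc.mono hsub).comp hσc hbij.mapsTo
  have hγc : ContinuousOn γ (Icc 0 1) := hzσc.fst
  have hlσ : ∀ r ∈ Ico (0 : ℝ) 1, 0 < radialSpeed H (z (σ r)) := fun r hr => hl _ (hσd r hr).1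
  have hcpos : ∀ r ∈ Ico (0 : ℝ) 1, 0 < c r := fun r hr => div_pos hℓ (hlσ r hr)
  have hcc : ContinuousOn c (Ico 0 1) := continuousOn_const.div
    (hH.continuous_radialSpeed.comp_continuousOn (hzσc.mono Ico_subset_Icc_self))
    fun r hr => (hlσ r hr).ne'
  have hφc : ContinuousOn φ (Ico 0 1) := hcc.smul
    (hH.continuous_partialP.comp_continuousOn (hzσc.mono Ico_subset_Icc_self))
  have hγd : ∀ r ∈ Ico (0 : ℝ) 1, HasDerivWithinAt γ (φ r) (Icc 0 1) r := fun r hr => by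
    obtain ⟨h1, h2⟩ := hσd r hr
    have h3 : HasDerivWithinAt (fun s => (z s).1) (T • partialP H (z (σ r)).1 (z (σ r)).2)
        (Icc 0 a) (σ r) :=
      ((hasFDerivAt_fst (𝕜 := ℝ) (p := z (σ r))).comp_hasDerivWithinAt (σ r)
        (hzd _ (hIco _ h1))).mono hsub
    refine (h3.scomp r h2 hbij.mapsTo).congr_deriv ?_
    rw [smul_smul]
    congr 1
    have := (hlσ r hr).ne'
    simp only [c, κ]
    field_simp
  have hIooIcc : volume.restrict (Icc (0 : ℝ) 1) = volume.restrict (Ioo (0 : ℝ) 1) :=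
    Measure.restrict_congr_set Ioo_ae_eq_Icc.symm
  have hφ : MemLp φ 2 (volume.restrict (Icc (0 : ℝ) 1)) := by
    obtain ⟨C, hC⟩ := hH.exists_sq_norm_partialP_le (hH.isCompact_energy (E := E) hc)
    have hm : AEStronglyMeasurable φ (volume.restrict (Ioo (0 : ℝ) 1)) :=
      (hφc.mono Ioo_subset_Ico_self).aestronglyMeasurable measurableSet_Ioo
    rw [hIooIcc, memLp_two_iff_integrable_sq_norm hm]
    -- This is `σ'`, integrable as the nonnegative derivative of a continuous function on `[0,1]`.
    -- It dominates `‖φ‖²`, which is at most `c² C l = C ℓ² / l`.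
    have h1 : IntegrableOn (fun r => (κ * radialSpeed H (z (σ r)))⁻¹) (Ioo 0 1) :=
      (intervalIntegral.integrableOn_deriv_of_nonneg hσc
        (fun r hr => (hσd r (Ioo_subset_Ico_self hr)).2.hasDerivAt (Icc_mem_nhds hr.1 hr.2))
        fun r hr => (inv_pos.2 (mul_pos hκ (hlσ r (Ioo_subset_Ico_self hr)))).le).mono_set
        Ioo_subset_Ioc_self
    refine (h1.const_mul (ℓ ^ 2 * C * κ)).mono' (hm.norm.pow 2) ?_
    rw [ae_restrict_iff' measurableSet_Ioo]
    refine Eventually.of_forall fun r hr => ?_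
    have hr' := Ioo_subset_Ico_self hr
    have h2 := hC (z (σ r)) (hzS _ (hsub (hbij.mapsTo (Ico_subset_Icc_self hr'))))
    have h3 := hlσ r hr'
    rw [Real.norm_of_nonneg (sq_nonneg _), norm_smul, Real.norm_of_nonneg (hcpos r hr').le, mul_pow]
    calc c r ^ 2 * ‖partialP H (z (σ r)).1 (z (σ r)).2‖ ^ 2
        ≤ c r ^ 2 * (C * radialSpeed H (z (σ r))) := by gcongr
      _ = ℓ ^ 2 * C * κ * (κ * radialSpeed H (z (σ r)))⁻¹ := by
        simp only [c]
        field_simp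
  have hφi := intervalIntegrable_of_memLp hφ
  have hγW : IsW12 γ := by
    refine (isW12_of_eq_integral hφ fun s hs => ?_).1
    have := intervalIntegral.integral_eq_sub_of_hasDerivAt_of_le hs.1
      (hγc.mono (Icc_subset_Icc_right hs.2))
      (fun r hr => (hγd r ⟨hr.1.le, hr.2.trans_le hs.2⟩).hasDerivAt
        (Icc_mem_nhds hr.1 (hr.2.trans_le hs.2)))
      (hφi.mono_set (by
        rw [uIcc_of_le hs.1, uIcc_of_le zero_le_one]; exact Icc_subset_Icc_right hs.2))
    rw [this, add_sub_cancel]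
  refine ⟨γ, ⟨hγW, by simp only [γ, hσ0, hz0], fun r hr => haD _ (hσd r hr).1,
    by simp only [γ, hσ1]; exact haf⟩, le_of_eq_of_le ?_ hpsi⟩
  -- The speed is constant: `G = (c l)² = ℓ²`.
  refine jacobiEnergy_eq_of_Ioo fun r hr => ?_
  have hr' := Ioo_subset_Ico_self hr
  rw [((hγd r hr').hasDerivAt (Icc_mem_nhds hr.1 hr.2)).deriv,
    hH.jacobiG_partialP (hVE _ (hσd r hr').1)
      (hzS _ (hsub (hbij.mapsTo (Ico_subset_Icc_self hr')))).2 (hcpos r hr'),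
    div_mul_cancel₀ _ (hlσ r hr').ne']

end IsClassicalHamiltonian

end LimitTrajectory
theorem mainTheorem3 {n : ℕ} (hn : 1 ≤ n) (H : Rn n × Rn n → ℝ) (E : ℝ) (D : Set (Rn n))
    (hH : IsClassicalHamiltonian H) (hD : IsPotentialWell H E D) (hc : IsCompact (closure D))
    (y : Rn n) (hy : y ∈ D) :
    -- the energy is well defined on `X_y`, and its infimum is attained
    (∀ γ ∈ curvesToBoundary D y,
      IntervalIntegrable (fun s => jacobiG H E (γ s, deriv γ s)) volume 0 1) ∧
    IsLeast (jacobiEnergy H E '' curvesToBoundary D y) (psi H E D y) ∧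
    -- properties of the minimizers
    ∀ γ ∈ curvesToBoundary D y, jacobiEnergy H E γ = psi H E D y →
      (∀ ξ : ℝ → Rn n, IsW12Zero ξ →
        IntervalIntegrable (firstVariation H E γ ξ) volume 0 1 ∧
        ∫ s in (0 : ℝ)..1, firstVariation H E γ ξ s = 0) ∧
      ∃ T : ℝ, 0 < T ∧ ∃ σ : ℝ → ℝ,
        -- `σ` is an increasing homeomorphism of `[0, T]` onto `[0, 1]`, of class `C¹`, and
        -- restricts to a diffeomorphism of `[0, T)` onto `[0, 1)`
        BijOn σ (Icc 0 T) (Icc 0 1) ∧ StrictMonoOn σ (Icc 0 T) ∧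
        ContDiffOn ℝ 1 σ (Icc 0 T) ∧
        (∀ t ∈ Ico 0 T, 0 < derivWithin σ (Icc 0 T) t) ∧
        ∃ q p : ℝ → Rn n,
          (∀ t, q t = γ (σ t)) ∧
          IsHamiltonSolution H E T q p ∧
          q 0 = y ∧ q T ∈ frontier D ∧
          ∀ t ∈ Ico 0 T,
            0 < jacobiG H E (q t, derivWithin q (Icc 0 T) t) ∧
            legendreMap H E (q t, p t) =
              (q t, (Real.sqrt (jacobiG H E (q t, derivWithin q (Icc 0 T) t)))⁻¹ •
                derivWithin q (Icc 0 T) t) := by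
  have hint : ∀ γ ∈ curvesToBoundary D y,
      IntervalIntegrable (fun s => jacobiG H E (γ s, deriv γ s)) volume 0 1 := fun γ hγ =>
    hH.intervalIntegrable_jacobiG hc hγ.1 fun s hs =>
      ⟨subset_closure (hγ.2.2.1 s hs), hD.lt_of_mem _ (hγ.2.2.1 s hs)⟩
  have hbdd : BddBelow (jacobiEnergy H E '' curvesToBoundary D y) := by
    refine ⟨0, ?_⟩
    rintro _ ⟨γ, hγ, rfl⟩
    exact hH.jacobiEnergy_nonneg fun s hs => hD.lt_of_mem _ (hγ.2.2.1 s hs)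
  have hle : ∀ γ ∈ curvesToBoundary D y, psi H E D y ≤ jacobiEnergy H E γ := fun γ hγ =>
    csInf_le hbdd ⟨γ, hγ, rfl⟩
  refine ⟨hint, ⟨?_, ?_⟩, ?_⟩
  · obtain ⟨γ, hγ, h⟩ := hH.exists_mem_curvesToBoundary_le hn hD hc hy
    exact ⟨γ, hγ, h.antisymm (hle γ hγ)⟩
  · rintro _ ⟨γ, hγ, rfl⟩
    exact hle γ hγ
  · rintro γ ⟨h1, rfl, h3, h4⟩ hmin
    -- A competitor with the same endpoints, inside `D` before `s = 1`, again belongs to `X_y`.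
    refine hH.minimizer_properties hD hc h1 h3 h4 fun η k1 k2 k3 k4 => ?_
    rw [hmin]
    exact hle η ⟨k1, k2, k4, k3 ▸ h4⟩
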